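/- Let $d\ge 1$, $\Omega=(0,1)^d$, $0<p\le\infty$ and $s>d/p$ (with $d/\infty=0$), and let $r$ be the smallest integer strictly larger than $\max(s,1)$. For $f\in L_p(\Omega)$ real-valued put $\omega_r(f,t)_p=\sup_{|h|\le t}\|\Delta_h^r f\|_{L_p(\Omega_{rh})}$, where $\Delta_h^r f(x)=(-1)^r\sum_{k=0}^r(-1)^k\binom rk f(x+kh)$, $\Omega_{h}=\{x\in\Omega:[x,x+h]\subset\Omega\}$ and $|h|$ is the Euclidean norm. Let $|f|_{B^s_p(\Omega)}$ be the smallest $M\in[0,\infty]$ with $\omega_r(f,t)_p\le Mt^s$ for all $t>0$, and let $B^s_p(\Omega)=B^s_\infty(L_p(\Omega))$ be the set of all $f\in L_p(\Omega)$ with $|f|_{B^s_p(\Omega)}<\infty$. For $k\ge0$ let $\mathcal T_k$ be the set of closed simplices obtained from the Kuhn decomposition of the closed dyadic cubes $Q=\prod_i[j_i2^{-k},(j_i+1)2^{-k}]\subset[0,1]^d$, that is, of the simplices $\{x\in Q: y_{\sigma(1)}\ge\dots\ge y_{\sigma(d)}\}$, where $y=2^kx-j$ and $\sigma$ is a permutation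 of $\{1,\dots,d\}$. Let $G_{k,r}$ be the tensor product grid in $[0,1]^d$ with spacing $2^{-k}(r-1)^{-1}$. For $g\in C([0,1]^d)$ let $S_k^*(g)$ be the Lagrange interpolant: the continuous function on $[0,1]^d$ that on each $T\in\mathcal T_k$ equals the unique polynomial of total degree less than $r$ that agrees with $g$ at all points of $G_{k,r}\cap T$. Theorem. Every $f\in B^s_p(\Omega)$ agrees a.e. on $\Omega$ with a (unique) continuous function $\tilde f$ on $[0,1]^d$, and, with $S_k^*(f):=S_k^*(\tilde f)$, $$\|f-S_k^*(f)\|_{L_\tau(\Omega)}\le C\,|f|_{B^s_p(\Omega)}\,2^{-k(s-d/p+d/\tau)}\qquad\text{for all } f\in B^s_p(\Omega),\ p\le\tau\le\infty,\ k=0,1,2,\dots,$$ with a constant $C<\infty$ that depends only on $d$, $s$ and $p$ (not on $f$, $k$ or $\tau$). -/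

import Mathlib

open MeasureTheory Finset
open scoped ENNReal NNReal

noncomputable section

/-- The open unit cube `Ω = (0,1)^d`, inside `ℝ^d` with its Euclidean norm and Lebesgue measure. -/
def openCube (d : ℕ) : Set (EuclideanSpace ℝ (Fin d)) :=
  {x | ∀ i, 0 < x i ∧ x i < 1}

/-- The closed unit cube `[0,1]^d`, the closure of `Ω`. -/
def closedCube (d : ℕ) : Set (EuclideanSpace ℝ (Fin d)) :=
  {x | ∀ i, 0 ≤ x i ∧ x i ≤ 1}

/-- Lebesgue measure on `Ω`. -/
def cubeMeasure (d : ℕ) : Measure (EuclideanSpace ℝ (Fin d)) :=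
  volume.restrict (openCube d)

/-! ### Besov smoothness -/

/-- The `r`-th difference `Δ_h^r(f,x) = (-1)^r ∑_{k ≤ r} (-1)^k (r choose k) f(x + k h)`. -/
def rDiff {d : ℕ} (r : ℕ) (h : EuclideanSpace ℝ (Fin d)) (f : EuclideanSpace ℝ (Fin d) → ℝ)
    (x : EuclideanSpace ℝ (Fin d)) : ℝ :=
  (-1) ^ r * ∑ k ∈ range (r + 1), (-1) ^ k * (r.choose k : ℝ) * f (x + (k : ℝ) • h)

/-- `Ω_h`: the points `x ∈ Ω` for which the segment `[x, x + h]` is contained in `Ω`. -/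
def shrunkCube {d : ℕ} (h : EuclideanSpace ℝ (Fin d)) : Set (EuclideanSpace ℝ (Fin d)) :=
  {x | x ∈ openCube d ∧ segment ℝ x (x + h) ⊆ openCube d}

/-- The modulus of smoothness `ω_r(f,t)_p = sup_{|h| ≤ t} ‖Δ_h^r(f,·)‖_{L_p(Ω_{rh})}`. -/
def modulus {d : ℕ} (r : ℕ) (p : ℝ≥0∞) (f : EuclideanSpace ℝ (Fin d) → ℝ) (t : ℝ) : ℝ≥0∞ :=
  ⨆ (h : EuclideanSpace ℝ (Fin d)) (_ : ‖h‖ ≤ t),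
    eLpNorm (rDiff r h f) p (volume.restrict (shrunkCube ((r : ℝ) • h)))

/-- `r(s)`: the smallest integer strictly larger than `max (s, 1)`. -/
def besovOrder (s : ℝ) : ℕ := ⌊max s 1⌋₊ + 1

/-- The semi-(quasi-)norm `|f|_{B_p^s}` of `B_p^s(Ω) = B_∞^s(L_p(Ω))`: the smallest `M` such that
`ω_r(f,t)_p ≤ M t^s` for all `t > 0`, with `r = r(s)`. -/
def besovSeminorm {d : ℕ} (s : ℝ) (p : ℝ≥0∞) (f : EuclideanSpace ℝ (Fin d) → ℝ) : ℝ≥0∞ :=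
  sInf {M : ℝ≥0∞ | ∀ t : ℝ, 0 < t → modulus (besovOrder s) p f t ≤ M * ENNReal.ofReal (t ^ s)}

/-- `f ∈ B_p^s(Ω)`. -/
def MemBesov {d : ℕ} (s : ℝ) (p : ℝ≥0∞) (f : EuclideanSpace ℝ (Fin d) → ℝ) : Prop :=
  MemLp f p (cubeMeasure d) ∧ besovSeminorm s p f < ∞

/-- `g` is a continuous representative on `[0,1]^d` of the a.e. class of `f` on `Ω`. -/
def IsContRep {d : ℕ} (f g : EuclideanSpace ℝ (Fin d) → ℝ) : Prop :=
  ContinuousOn g (closedCube d) ∧ f =ᵐ[cubeMeasure d] g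

/-! ### The interpolation operator -/

/-- The closed Kuhn simplex, belonging to the permutation `σ`, of the closed dyadic cube
`∏ i, [j i 2^{-k}, (j i + 1) 2^{-k}]`: in the local coordinates `y = 2^k x - j` it is
`1 ≥ y (σ 0) ≥ y (σ 1) ≥ ⋯ ≥ y (σ (d-1)) ≥ 0`. -/
def kuhnSimplex {d k : ℕ} (j : Fin d → Fin (2 ^ k)) (σ : Equiv.Perm (Fin d)) :
    Set (EuclideanSpace ℝ (Fin d)) :=
  {x | (∀ i, 0 ≤ 2 ^ k * x i - (j i : ℕ) ∧ 2 ^ k * x i - (j i : ℕ) ≤ 1) ∧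
    Antitone fun a => 2 ^ k * x (σ a) - ((j (σ a) : ℕ) : ℝ)}

/-- The tensor product grid `G_{k,r}` of `[0,1]^d` with spacing `2^{-k} (r-1)^{-1}`. -/
def tensorGrid (d k r : ℕ) : Set (EuclideanSpace ℝ (Fin d)) :=
  {x | ∃ m : Fin d → ℕ, ∀ i, m i ≤ (r - 1) * 2 ^ k ∧
    x i = (m i : ℝ) / (((r - 1 : ℕ) : ℝ) * 2 ^ k)}

/-- `S` is the continuous piecewise polynomial of order `r` (total degree `< r`), subordinate to
the Kuhn simplices of the dyadic cubes of side length `2^{-k}`, that on every closed simplex `T`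
is the polynomial interpolating `f` at the points of `G_{k,r}` in `T`. -/
def IsInterpolant {d : ℕ} (k r : ℕ) (f S : EuclideanSpace ℝ (Fin d) → ℝ) : Prop :=
  ContinuousOn S (closedCube d) ∧
  ∀ (j : Fin d → Fin (2 ^ k)) (σ : Equiv.Perm (Fin d)),
    ∃ P : MvPolynomial (Fin d) ℝ, P.totalDegree < r ∧
      (∀ x ∈ kuhnSimplex j σ, S x = MvPolynomial.eval x.ofLp P) ∧
      (∀ x ∈ tensorGrid d k r ∩ kuhnSimplex j σ, MvPolynomial.eval x.ofLp P = f x)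

/-! ### Well-posedness of the interpolation -/

/-- The local coordinates `y = 2^k x - j`, listed in the order `σ` of a Kuhn simplex and preceded by
`1` and followed by `0`, as affine polynomials. -/
def kuhnCoord {d k : ℕ} (j : Fin d → Fin (2 ^ k)) (σ : Equiv.Perm (Fin d)) :
    ℕ → MvPolynomial (Fin d) ℝ
  | 0 => 1
  | m + 1 => if h : m < d then
      MvPolynomial.C (2 ^ k) * MvPolynomial.X (σ ⟨m, h⟩) -
        MvPolynomial.C (((j (σ ⟨m, h⟩) : ℕ) : ℝ)) else 0

/-- The `a`-th vertex of a Kuhn simplex, in units of `2^{-k}`. -/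
def kuhnVertex {d k : ℕ} (j : Fin d → Fin (2 ^ k)) (σ : Equiv.Perm (Fin d)) (a : ℕ) :
    Fin d → Fin (2 ^ k + 1) :=
  fun i => ⟨(j i : ℕ) + if ((σ.symm i : Fin d) : ℕ) < a then 1 else 0, by
    have := (j i).2; split_ifs <;> omega⟩

/-- The barycentric coordinate of the vertex `v` on a Kuhn simplex (zero if `v` is not a vertex). -/
def kuhnBary {d k : ℕ} (j : Fin d → Fin (2 ^ k)) (σ : Equiv.Perm (Fin d))
    (v : Fin d → Fin (2 ^ k + 1)) : MvPolynomial (Fin d) ℝ :=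
  ∑ a ∈ range (d + 1), if kuhnVertex j σ a = v then kuhnCoord j σ a - kuhnCoord j σ (a + 1) else 0

/-- The continuous piecewise affine nodal function of the vertex `v`. -/
def kuhnHat {d : ℕ} (k : ℕ) (v : Fin d → Fin (2 ^ k + 1)) (x : EuclideanSpace ℝ (Fin d)) : ℝ :=
  max 0 (1 + univ.inf' univ_nonempty
      (fun o : Option (Fin d) => o.elim 0 fun i => 2 ^ k * x i - ((v i : ℕ) : ℝ)) -
    univ.sup' univ_nonempty
      (fun o : Option (Fin d) => o.elim 0 fun i => 2 ^ k * x i - ((v i : ℕ) : ℝ)))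

theorem kuhnHat_continuous {d k : ℕ} (v : Fin d → Fin (2 ^ k + 1)) :
    Continuous (kuhnHat k v) := by
  have h : ∀ o : Option (Fin d), Continuous fun x : EuclideanSpace ℝ (Fin d) =>
      (o.elim 0 fun i => 2 ^ k * x i - ((v i : ℕ) : ℝ) : ℝ) := by
    intro o
    cases o with
    | none => exact continuous_const
    | some i => simp only [Option.elim]; fun_prop
  unfold kuhnHat
  refine continuous_const.max ((continuous_const.add ?_).sub ?_)
  · exact Continuous.finset_inf'_apply _ fun o _ => h o
  · exact Continuous.finset_sup'_apply _ fun o _ => h o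

theorem kuhnCoord_anti {d k : ℕ} {j : Fin d → Fin (2 ^ k)} {σ : Equiv.Perm (Fin d)}
    {x : EuclideanSpace ℝ (Fin d)} (hx : x ∈ kuhnSimplex j σ) :
    Antitone fun m => MvPolynomial.eval x.ofLp (kuhnCoord j σ m) := by
  refine antitone_nat_of_succ_le fun m => ?_
  obtain ⟨h1, h2⟩ := hx
  cases m with
  | zero =>
    simp only [kuhnCoord]
    split_ifs with h
    · simpa using (h1 (σ ⟨0, h⟩)).2
    · simp
  | succ m =>
    simp only [kuhnCoord]
    split_ifs with h h' h'
    · simpa using h2 (show (⟨m, h'⟩ : Fin d) ≤ ⟨m + 1, h⟩ from Nat.le_succ m)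
    · omega
    · simpa using (h1 (σ ⟨m, h'⟩)).1
    · simp

theorem kuhnCoord_symm {d k : ℕ} (j : Fin d → Fin (2 ^ k)) (σ : Equiv.Perm (Fin d))
    (x : EuclideanSpace ℝ (Fin d)) (i : Fin d) :
    MvPolynomial.eval x.ofLp (kuhnCoord j σ ((σ.symm i : Fin d) + 1)) =
      2 ^ k * x i - ((j i : ℕ) : ℝ) := by
  simp [kuhnCoord]

theorem kuhnCoord_last {d k : ℕ} (j : Fin d → Fin (2 ^ k)) (σ : Equiv.Perm (Fin d)) :
    kuhnCoord j σ (d + 1) = 0 := by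
  simp [kuhnCoord]

theorem kuhnVertex_inj {d k : ℕ} {j : Fin d → Fin (2 ^ k)} {σ : Equiv.Perm (Fin d)} {a b : ℕ}
    (ha : a ≤ d) (hb : b ≤ d) (h : kuhnVertex j σ a = kuhnVertex j σ b) : a = b := by
  wlog hab : a < b generalizing a b
  · rcases lt_trichotomy a b with h' | h' | h'
    · exact this ha hb h h'
    · exact h'
    · exact (this hb ha h.symm h').symm
  have := congrFun h (σ ⟨a, by omega⟩)
  simp [kuhnVertex, hab] at this

theorem kuhnBary_sum {d k : ℕ} (j : Fin d → Fin (2 ^ k)) (σ : Equiv.Perm (Fin d)) :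
    ∑ v, kuhnBary j σ v = 1 := by
  simp only [kuhnBary]
  rw [sum_comm]
  simp only [sum_ite_eq, mem_univ, if_true]
  rw [sum_range_sub', kuhnCoord_last]
  simp [kuhnCoord]

theorem kuhnBary_moment {d k : ℕ} (j : Fin d → Fin (2 ^ k)) (σ : Equiv.Perm (Fin d))
    (x : EuclideanSpace ℝ (Fin d)) (i : Fin d) :
    ∑ v, MvPolynomial.eval x.ofLp (kuhnBary j σ v) * ((v i : ℕ) : ℝ) = 2 ^ k * x i := by
  simp only [kuhnBary, map_sum, sum_mul]
  rw [sum_comm]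
  have : ∀ a ∈ range (d + 1), ∑ v : Fin d → Fin (2 ^ k + 1),
      MvPolynomial.eval x.ofLp
        (if kuhnVertex j σ a = v then kuhnCoord j σ a - kuhnCoord j σ (a + 1) else 0) *
        ((v i : ℕ) : ℝ) =
      (MvPolynomial.eval x.ofLp (kuhnCoord j σ a) -
        MvPolynomial.eval x.ofLp (kuhnCoord j σ (a + 1))) * ((j i : ℕ) : ℝ) +
      (if (σ.symm i : ℕ) + 1 ≤ a then MvPolynomial.eval x.ofLp (kuhnCoord j σ a) -
        MvPolynomial.eval x.ofLp (kuhnCoord j σ (a + 1)) else 0) := by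
    intro a _
    rw [sum_eq_single (kuhnVertex j σ a)]
    · simp only [if_true, kuhnVertex, map_sub]
      push_cast
      simp only [Nat.lt_iff_add_one_le]
      split_ifs <;> ring
    · intro v _ hv
      simp [hv.symm]
    · simp
  rw [sum_congr rfl this, sum_add_distrib, ← sum_mul, sum_range_sub', kuhnCoord_last,
    ← sum_filter]
  have hf : (range (d + 1)).filter (fun a => (σ.symm i : ℕ) + 1 ≤ a) =
      Ico ((σ.symm i : ℕ) + 1) (d + 1) := by
    ext a; simp [and_comm]
  have hle : (σ.symm i : ℕ) + 1 ≤ d + 1 := by have := (σ.symm i).2; omega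
  rw [hf, sum_Ico_eq_sum_range]
  have := sum_range_sub' (fun m => MvPolynomial.eval x.ofLp
    (kuhnCoord j σ ((σ.symm i : ℕ) + 1 + m))) (d + 1 - ((σ.symm i : ℕ) + 1))
  simp only [add_zero] at this
  simp only [← add_assoc] at this
  rw [this, Nat.add_sub_cancel' hle, kuhnCoord_last, kuhnCoord_symm]
  simp [kuhnCoord]

theorem kuhnBary_vertex {d k : ℕ} (j : Fin d → Fin (2 ^ k)) (σ : Equiv.Perm (Fin d)) {a : ℕ}
    (ha : a ≤ d) :
    kuhnBary j σ (kuhnVertex j σ a) = kuhnCoord j σ a - kuhnCoord j σ (a + 1) := by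
  unfold kuhnBary
  rw [sum_eq_single a]
  · simp
  · intro b hb hba
    rw [if_neg]
    intro h
    exact hba (kuhnVertex_inj (by simp at hb; omega) ha h)
  · intro h; simp at h; omega

/-- On every Kuhn simplex the nodal functions are the barycentric coordinates. -/
theorem kuhnHat_eq {d k : ℕ} {j : Fin d → Fin (2 ^ k)} {σ : Equiv.Perm (Fin d)}
    {x : EuclideanSpace ℝ (Fin d)} (hx : x ∈ kuhnSimplex j σ) (v : Fin d → Fin (2 ^ k + 1)) :
    kuhnHat k v x = MvPolynomial.eval x.ofLp (kuhnBary j σ v) := by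
  have hY := kuhnCoord_anti hx
  set w : Option (Fin d) → ℝ := fun o => o.elim 0 fun i => 2 ^ k * x i - ((v i : ℕ) : ℝ) with hw
  set Y : ℕ → ℝ := fun m => MvPolynomial.eval x.ofLp (kuhnCoord j σ m) with hYdef
  have hYi : ∀ i, Y ((σ.symm i : Fin d) + 1) = 2 ^ k * x i - ((j i : ℕ) : ℝ) :=
    fun i => kuhnCoord_symm j σ x i
  have hY0 : Y 0 = 1 := by simp [hYdef, kuhnCoord]
  have hYd : Y (d + 1) = 0 := by simp [hYdef, kuhnCoord_last]
  have zero_of : ∀ o o', 1 + w o ≤ w o' → kuhnHat k v x = 0 := by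
    intro o o' h
    unfold kuhnHat
    refine max_eq_left ?_
    have h1 : univ.inf' univ_nonempty w ≤ w o := inf'_le _ (mem_univ o)
    have h2 : w o' ≤ univ.sup' univ_nonempty w := le_sup' w (mem_univ o')
    linarith
  by_cases hv : ∃ a ≤ d, v = kuhnVertex j σ a
  · obtain ⟨a, ha, rfl⟩ := hv
    rw [kuhnBary_vertex j σ ha, map_sub]
    change _ = Y a - Y (a + 1)
    have hwi : ∀ i, w (some i) = Y ((σ.symm i : Fin d) + 1) -
        (if ((σ.symm i : Fin d) : ℕ) < a then 1 else 0) := by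
      intro i
      rw [hYi]
      simp only [hw, kuhnVertex, Option.elim]
      push_cast
      ring
    have hinf : univ.inf' univ_nonempty w = Y a - 1 := by
      apply le_antisymm
      · rcases Nat.eq_zero_or_pos a with rfl | hpos
        · rw [hY0]
          exact (inf'_le w (mem_univ none)).trans (by simp [hw])
        · refine (inf'_le w (mem_univ (some (σ ⟨a - 1, by omega⟩)))).trans ?_
          rw [hwi]
          have : a - 1 + 1 = a := by omega
          have h3 : a - 1 < a := by omega
          simp [this, h3]
      · refine le_inf' _ _ fun o _ => ?_
        cases o with
        | none =>
          have := hY (Nat.zero_le a)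
          simp only [hw, Option.elim]
          change Y a ≤ Y 0 at this
          linarith
        | some i =>
          rw [hwi]
          split_ifs with h
          · have : Y a ≤ Y ((σ.symm i : Fin d) + 1) := hY (Nat.succ_le_of_lt h)
            linarith
          · have h1 : Y a ≤ Y 0 := hY (Nat.zero_le a)
            have h2 : Y (d + 1) ≤ Y ((σ.symm i : Fin d) + 1) :=
              hY (by have := (σ.symm i).2; omega)
            linarith
    have hsup : univ.sup' univ_nonempty w = Y (a + 1) := by
      apply le_antisymm
      · refine sup'_le _ _ fun o _ => ?_
        cases o with
        | none =>
          have : Y (d + 1) ≤ Y (a + 1) := hY (by omega)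
          simp only [hw, Option.elim]
          linarith
        | some i =>
          rw [hwi]
          split_ifs with h
          · have h1 : Y ((σ.symm i : Fin d) + 1) ≤ Y 0 := hY (Nat.zero_le _)
            have h2 : Y (d + 1) ≤ Y (a + 1) := hY (by omega)
            linarith
          · have : Y ((σ.symm i : Fin d) + 1) ≤ Y (a + 1) := hY (by omega)
            linarith
      · rcases ha.lt_or_eq with hlt | rfl
        · refine le_trans ?_ (le_sup' w (mem_univ (some (σ ⟨a, hlt⟩))))
          rw [hwi]
          simp
        · rw [hYd]
          exact le_trans (by simp [hw]) (le_sup' w (mem_univ none))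
    have : kuhnHat k (kuhnVertex j σ a) x =
        max 0 (1 + univ.inf' univ_nonempty w - univ.sup' univ_nonempty w) := rfl
    rw [this, hinf, hsup]
    have : Y (a + 1) ≤ Y a := hY (Nat.le_succ a)
    rw [max_eq_right (by linarith)]
    ring
  · have hR : MvPolynomial.eval x.ofLp (kuhnBary j σ v) = 0 := by
      unfold kuhnBary
      rw [sum_eq_zero, map_zero]
      intro a ha
      rw [if_neg]
      rintro rfl
      exact hv ⟨a, by simp at ha; omega, rfl⟩
    rw [hR]
    have hwn : w none = 0 := rfl
    have hws : ∀ i, w (some i) = Y ((σ.symm i : Fin d) + 1) + ((j i : ℕ) : ℝ) - ((v i : ℕ) : ℝ) := by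
      intro i; rw [hYi]; simp [hw]
    have hYb : ∀ m, m ≤ d + 1 → 0 ≤ Y m ∧ Y m ≤ 1 := fun m hm =>
      ⟨hYd ▸ hY hm, hY0 ▸ hY (Nat.zero_le m)⟩
    have hYb' : ∀ i : Fin d, 0 ≤ Y ((σ.symm i : Fin d) + 1) ∧ Y ((σ.symm i : Fin d) + 1) ≤ 1 :=
      fun i => hYb _ (by have := (σ.symm i).2; omega)
    by_cases h1 : ∃ i, (v i : ℕ) < j i
    · obtain ⟨i, hi⟩ := h1
      refine zero_of none (some i) ?_
      rw [hwn, hws]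
      have : ((v i : ℕ) : ℝ) + 1 ≤ ((j i : ℕ) : ℝ) := by exact_mod_cast hi
      linarith [(hYb' i).1]
    by_cases h2 : ∃ i, (j i : ℕ) + 1 < v i
    · obtain ⟨i, hi⟩ := h2
      refine zero_of (some i) none ?_
      rw [hwn, hws]
      have : ((j i : ℕ) : ℝ) + 1 + 1 ≤ ((v i : ℕ) : ℝ) := by exact_mod_cast hi
      linarith [(hYb' i).2]
    push Not at h1 h2
    by_cases h3 : ∃ b b' : Fin d, b ≤ b' ∧ (v (σ b) : ℕ) = j (σ b) ∧
        (v (σ b') : ℕ) = j (σ b') + 1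
    · obtain ⟨b, b', hbb, hb, hb'⟩ := h3
      refine zero_of (some (σ b')) (some (σ b)) ?_
      rw [hws, hws, hb, hb']
      push_cast
      simp only [Equiv.symm_apply_apply]
      have : Y (b' + 1) ≤ Y (b + 1) := hY (by have : (b : ℕ) ≤ b' := hbb; omega)
      linarith
    push Not at h3
    exfalso
    apply hv
    have hch : ∀ i, (v i : ℕ) = j i ∨ (v i : ℕ) = j i + 1 := fun i => by
      have := h1 i; have := h2 i; omega
    by_cases h4 : ∃ m, ∃ h : m < d, (v (σ ⟨m, h⟩) : ℕ) = j (σ ⟨m, h⟩)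
    · classical
      refine ⟨Nat.find h4, ?_, ?_⟩
      · obtain ⟨h, _⟩ := Nat.find_spec h4; omega
      · obtain ⟨hm, hm'⟩ := Nat.find_spec h4
        funext i
        apply Fin.ext
        simp only [kuhnVertex]
        split_ifs with hi
        · have := Nat.find_min h4 hi
          push Not at this
          have h5 := this (σ.symm i).2
          simp only [Fin.eta, Equiv.apply_symm_apply] at h5
          rcases hch i with h6 | h6
          · exact absurd h6 h5
          · exact h6
        · have h5 := h3 ⟨Nat.find h4, hm⟩ (σ.symm i) (by
            change Nat.find h4 ≤ _; omega) hm'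
          simp only [Equiv.apply_symm_apply] at h5
          rcases hch i with h6 | h6
          · simpa using h6
          · exact absurd h6 h5
    · push Not at h4
      refine ⟨d, le_rfl, ?_⟩
      funext i
      apply Fin.ext
      simp only [kuhnVertex, (σ.symm i).2, if_true]
      have h5 := h4 (σ.symm i) (σ.symm i).2
      simp only [Fin.eta, Equiv.apply_symm_apply] at h5
      rcases hch i with h6 | h6
      · exact absurd h6 h5
      · exact h6

theorem kuhnCoord_degree {d k : ℕ} (j : Fin d → Fin (2 ^ k)) (σ : Equiv.Perm (Fin d)) (m : ℕ) :
    (kuhnCoord j σ m).totalDegree ≤ 1 := by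
  cases m with
  | zero => simp [kuhnCoord]
  | succ m =>
    simp only [kuhnCoord]
    split_ifs with h
    · refine (MvPolynomial.totalDegree_sub _ _).trans
        (max_le ?_ (by rw [MvPolynomial.totalDegree_C]; omega))
      refine (MvPolynomial.totalDegree_mul _ _).trans ?_
      rw [MvPolynomial.totalDegree_C, MvPolynomial.totalDegree_X]
    · simp

theorem kuhnBary_degree {d k : ℕ} (j : Fin d → Fin (2 ^ k)) (σ : Equiv.Perm (Fin d))
    (v : Fin d → Fin (2 ^ k + 1)) : (kuhnBary j σ v).totalDegree ≤ 1 := by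
  refine MvPolynomial.totalDegree_finsetSum_le fun a _ => ?_
  split_ifs
  · exact (MvPolynomial.totalDegree_sub _ _).trans
      (max_le (kuhnCoord_degree j σ _) (kuhnCoord_degree j σ _))
  · simp

/-- The grid point with barycentric multi-index `α / N`. -/
def kuhnNode {d k : ℕ} (N : ℕ) (α : (Fin d → Fin (2 ^ k + 1)) → ℕ) : EuclideanSpace ℝ (Fin d) :=
  WithLp.toLp 2 fun i => (∑ v, (α v : ℝ) * ((v i : ℕ) : ℝ)) / ((N : ℝ) * 2 ^ k)

theorem binomProd_nat (b a : ℕ) :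
    (∏ m ∈ range a, 1 / ((m : ℝ) + 1) * ((b : ℝ) - m)) = (b.choose a : ℝ) := by
  induction a with
  | zero => simp
  | succ a ih =>
    rw [prod_range_succ, ih]
    have h := Nat.choose_succ_right_eq b a
    have h' : (b.choose (a + 1) : ℝ) * ((a : ℝ) + 1) = b.choose a * ((b : ℝ) - a) := by
      rcases le_or_gt a b with hab | hab
      · rw [← Nat.cast_sub hab]; exact_mod_cast h
      · rw [Nat.choose_eq_zero_of_lt hab, Nat.choose_eq_zero_of_lt (by omega)]; simp
    have : (a : ℝ) + 1 ≠ 0 := by positivity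
    field_simp
    linarith

/-- The interpolant exists, for every function `f` and every `r ≥ 2`. -/
theorem exists_isInterpolant {d : ℕ} (k r : ℕ) (hr : 2 ≤ r) (f : EuclideanSpace ℝ (Fin d) → ℝ) :
    ∃ S, IsInterpolant k r f S := by
  obtain ⟨N, rfl⟩ : ∃ N, r = N + 1 := ⟨r - 1, by omega⟩
  have hN : 1 ≤ N := by omega
  have hN0 : (N : ℝ) ≠ 0 := by positivity
  refine ⟨fun x => ∑ α ∈ piAntidiag (univ : Finset (Fin d → Fin (2 ^ k + 1))) N,
    f (kuhnNode N α) * ∏ v, ∏ m ∈ range (α v), 1 / ((m : ℝ) + 1) * (N * kuhnHat k v x - m),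
    ?_, fun j σ => ?_⟩
  · refine Continuous.continuousOn ?_
    refine continuous_finsetSum _ fun α _ => continuous_const.mul ?_
    refine continuous_finsetProd _ fun v _ => continuous_finsetProd _ fun m _ => ?_
    have := kuhnHat_continuous (k := k) v
    fun_prop
  · refine ⟨∑ α ∈ piAntidiag (univ : Finset (Fin d → Fin (2 ^ k + 1))) N,
      MvPolynomial.C (f (kuhnNode N α)) * ∏ v, ∏ m ∈ range (α v),
        (MvPolynomial.C (1 / ((m : ℝ) + 1)) *
          (MvPolynomial.C (N : ℝ) * kuhnBary j σ v - MvPolynomial.C (m : ℝ))), ?_, ?_, ?_⟩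
    · refine Nat.lt_succ_of_le (MvPolynomial.totalDegree_finsetSum_le fun α hα => ?_)
      refine (MvPolynomial.totalDegree_mul _ _).trans ?_
      rw [MvPolynomial.totalDegree_C, zero_add]
      refine (MvPolynomial.totalDegree_finsetProd _ _).trans ?_
      rw [mem_piAntidiag] at hα
      rw [← hα.1]
      refine sum_le_sum fun v _ => ?_
      refine (MvPolynomial.totalDegree_finsetProd _ _).trans ?_
      calc _ ≤ ∑ m ∈ range (α v), 1 := by
            refine sum_le_sum fun m _ => ?_
            refine (MvPolynomial.totalDegree_mul _ _).trans ?_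
            rw [MvPolynomial.totalDegree_C, zero_add]
            refine (MvPolynomial.totalDegree_sub _ _).trans
              (max_le ?_ (by rw [MvPolynomial.totalDegree_C]; omega))
            refine (MvPolynomial.totalDegree_mul _ _).trans ?_
            rw [MvPolynomial.totalDegree_C, zero_add]
            exact kuhnBary_degree j σ v
        _ = α v := by simp
    · intro x hx
      simp only [map_sum, map_mul, map_prod, map_sub, MvPolynomial.eval_C, kuhnHat_eq hx]
    · rintro x ⟨⟨m, hm⟩, hx⟩
      have hm2 : ∀ i, (N : ℝ) * (2 ^ k * x i) = m i := fun i => by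
        rw [(hm i).2]; simp only [Nat.add_sub_cancel]; field_simp
      -- the scaled barycentric coordinates of a grid point are natural numbers
      have hcoord : ∀ a, ∃ z : ℤ, (N : ℝ) * MvPolynomial.eval x.ofLp (kuhnCoord j σ a) = z := by
        intro a
        cases a with
        | zero => exact ⟨N, by simp [kuhnCoord]⟩
        | succ a =>
          simp only [kuhnCoord]
          split_ifs with h
          · refine ⟨(m (σ ⟨a, h⟩) : ℤ) - N * ((j (σ ⟨a, h⟩) : ℕ) : ℤ), ?_⟩
            push_cast
            rw [← hm2]
            simp
            ring
          · exact ⟨0, by simp⟩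
      have hβ : ∀ v, ∃ b : ℕ, (N : ℝ) * MvPolynomial.eval x.ofLp (kuhnBary j σ v) = b := by
        intro v
        choose z hz using hcoord
        have hint : (N : ℝ) * MvPolynomial.eval x.ofLp (kuhnBary j σ v) =
            ((∑ a ∈ range (d + 1), if kuhnVertex j σ a = v then z a - z (a + 1) else 0 : ℤ) : ℝ) := by
          simp only [kuhnBary, map_sum, mul_sum]
          push_cast
          refine sum_congr rfl fun a _ => ?_
          split_ifs
          · rw [map_sub, mul_sub, hz, hz]
          · simp
        have hnn : (0 : ℝ) ≤ (N : ℝ) * MvPolynomial.eval x.ofLp (kuhnBary j σ v) := by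
          rw [← kuhnHat_eq hx]
          exact mul_nonneg (Nat.cast_nonneg _) (le_max_left _ _)
        rw [hint] at hnn ⊢
        obtain ⟨b, hb⟩ := Int.eq_ofNat_of_zero_le (by exact_mod_cast hnn)
        exact ⟨b, by rw [hb]; simp⟩
      choose β hβ using hβ
      have hsum : ∑ v, β v = N := by
        have h1 : (∑ v, (β v : ℝ)) = N := by
          simp only [← hβ]
          rw [← mul_sum, ← map_sum, kuhnBary_sum]
          simp
        exact_mod_cast h1
      have hnode : kuhnNode N β = x := by
        ext i
        simp only [kuhnNode, ← hβ, mul_assoc]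
        rw [← mul_sum, kuhnBary_moment]
        field_simp
      simp only [map_sum, map_mul, map_prod, map_sub, MvPolynomial.eval_C, hβ, binomProd_nat]
      rw [sum_eq_single β]
      · simp [hnode]
      · intro α hα hne
        rw [mem_piAntidiag] at hα
        have : ∃ v, β v < α v := by
          by_contra! hcon
          apply hne
          have := (sum_eq_sum_iff_of_le (s := univ) fun v _ => hcon v).1 (by rw [hα.1, hsum])
          exact funext fun v => this v (mem_univ v)
        obtain ⟨v, hv⟩ := this
        rw [prod_eq_zero (mem_univ v), mul_zero]
        exact_mod_cast Nat.choose_eq_zero_of_lt hv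
      · intro h
        exact absurd (by simp [mem_piAntidiag, hsum]) h

/-- A polynomial of total degree `< r` is determined on a simplex by its values at the points of
`G_{k,r}` in that simplex. -/
theorem kuhn_unisolvent {d k r : ℕ} (hr : 2 ≤ r) (j : Fin d → Fin (2 ^ k))
    (σ : Equiv.Perm (Fin d)) (P Q : MvPolynomial (Fin d) ℝ) (hP : P.totalDegree < r)
    (hQ : Q.totalDegree < r)
    (h : ∀ x ∈ tensorGrid d k r ∩ kuhnSimplex j σ,
      MvPolynomial.eval x.ofLp P = MvPolynomial.eval x.ofLp Q) : P = Q := by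
  obtain ⟨N, rfl⟩ : ∃ N, r = N + 1 := ⟨r - 1, by omega⟩
  have hN : 1 ≤ N := by omega
  have hN0 : (N : ℝ) ≠ 0 := by positivity
  set A : Set (Fin d →₀ ℕ) := {n | (n.sum fun _ e => e) ≤ N} with hA
  have hAs : ∀ α ∈ A, ∑ i, α i ≤ N := fun α hα => by
    simpa [hA, Finsupp.sum_fintype] using hα
  have : Finite A := by
    refine Finite.of_injective
      (fun (α : A) (i : Fin d) => (⟨α.1 i, Nat.lt_succ_of_le
        ((single_le_sum (f := fun i => α.1 i) (fun _ _ => Nat.zero_le _) (mem_univ i)).trans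
          (hAs _ α.2))⟩ : Fin (N + 1))) ?_
    intro α β hab
    apply Subtype.ext
    ext i
    simpa using congrFun hab i
  have := Fintype.ofFinite A
  set z : A → Fin d → ℕ := fun α a => ∑ b ∈ Ici a, α.1 b with hz
  have hzN : ∀ α a, z α a ≤ N := fun α a =>
    (sum_le_sum_of_subset (subset_univ _)).trans (hAs _ α.2)
  have hzanti : ∀ α, Antitone (z α) := fun α a b hab =>
    sum_le_sum_of_subset (Ici_subset_Ici.2 hab)
  have hzinj : Function.Injective z := by
    intro α β hab
    apply Subtype.ext
    have hIoi : ∀ a, ∑ b ∈ Ioi a, α.1 b = ∑ b ∈ Ioi a, β.1 b := by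
      intro a
      by_cases hlast : (a : ℕ) + 1 < d
      · have : Ioi a = Ici (⟨a + 1, hlast⟩ : Fin d) := by
          ext b
          rw [mem_Ioi, mem_Ici]
          exact Nat.lt_iff_add_one_le
        rw [this]
        exact congrFun hab _
      · have : Ioi a = ∅ := by
          refine eq_empty_of_forall_notMem fun b hb => ?_
          have h0 : a < b := mem_Ioi.1 hb
          have h1 : (a : ℕ) < b := h0
          have h2 := b.2
          omega
        rw [this]; simp
    ext a
    have h1 := congrFun hab a
    simp only [hz] at h1
    rw [← Ioi_insert, sum_insert (by simp), sum_insert (by simp), hIoi a] at h1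
    omega
  set node : A → EuclideanSpace ℝ (Fin d) := fun α =>
    WithLp.toLp 2 fun i => ((((j i : ℕ) * N + z α (σ.symm i) : ℕ) : ℝ)) / ((N : ℝ) * 2 ^ k)
    with hnode
  have hnodeY : ∀ α i, 2 ^ k * (node α) i - ((j i : ℕ) : ℝ) = (z α (σ.symm i) : ℝ) / N := by
    intro α i
    simp only [hnode]
    push_cast
    field_simp
    ring
  have hmem : ∀ α, node α ∈ tensorGrid d k (N + 1) ∩ kuhnSimplex j σ := by
    intro α
    refine ⟨⟨fun i => (j i : ℕ) * N + z α (σ.symm i), fun i => ⟨?_, ?_⟩⟩, fun i => ?_, ?_⟩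
    · have h1 := (j i).2
      have h2 := hzN α (σ.symm i)
      simp only [Nat.add_sub_cancel]
      calc (j i : ℕ) * N + z α (σ.symm i) ≤ ((j i : ℕ) + 1) * N := by linarith
        _ ≤ 2 ^ k * N := Nat.mul_le_mul_right _ h1
        _ = N * 2 ^ k := mul_comm _ _
    · simp [hnode]
    · rw [hnodeY]
      refine ⟨by positivity, ?_⟩
      rw [div_le_one (by positivity)]
      exact Nat.cast_le.2 (hzN α _)
    · intro a b hab
      simp only [hnodeY, Equiv.symm_apply_apply]
      have : (z α b : ℝ) ≤ z α a := by exact_mod_cast hzanti α hab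
      gcongr
  have hinj : Function.Injective node := by
    intro α β hab
    apply hzinj
    funext a
    have h1 := hnodeY α (σ a)
    have h2 := hnodeY β (σ a)
    rw [hab, h2] at h1
    simp only [Equiv.symm_apply_apply] at h1
    field_simp at h1
    exact_mod_cast h1.symm
  let E : MvPolynomial.restrictTotalDegree (Fin d) ℝ N →ₗ[ℝ] (A → ℝ) :=
    { toFun := fun p α => MvPolynomial.eval (node α).ofLp p.1
      map_add' := fun p q => by ext; simp
      map_smul' := fun c p => by ext; simp }
  have hsurj : Function.Surjective E := by
    intro c
    obtain ⟨S, -, hS⟩ := exists_isInterpolant k (N + 1) hr (Function.extend node c 0)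
    obtain ⟨p, hp, -, hp2⟩ := hS j σ
    refine ⟨⟨p, (MvPolynomial.mem_restrictTotalDegree _ _ _).2 (Nat.le_of_lt_succ hp)⟩, ?_⟩
    funext α
    change MvPolynomial.eval (node α).ofLp p = c α
    rw [hp2 _ (hmem α), hinj.extend_apply]
  let b : Module.Basis A ℝ (MvPolynomial.restrictTotalDegree (Fin d) ℝ N) :=
    MvPolynomial.basisRestrictSupport ℝ A
  have hfin : FiniteDimensional ℝ (MvPolynomial.restrictTotalDegree (Fin d) ℝ N) :=
    b.finiteDimensional_of_finite
  have hEinj : Function.Injective E := by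
    refine (LinearMap.injective_iff_surjective_of_finrank_eq_finrank ?_).2 hsurj
    rw [Module.finrank_eq_card_basis b, Module.finrank_fintype_fun_eq_card]
  have := @hEinj ⟨P, (MvPolynomial.mem_restrictTotalDegree _ _ _).2 (Nat.le_of_lt_succ hP)⟩
    ⟨Q, (MvPolynomial.mem_restrictTotalDegree _ _ _).2 (Nat.le_of_lt_succ hQ)⟩
    (funext fun α => h _ (hmem α))
  exact congrArg Subtype.val this

/-- The Kuhn simplices cover `[0,1]^d`. -/
theorem exists_mem_kuhnSimplex {d : ℕ} (k : ℕ) {x : EuclideanSpace ℝ (Fin d)}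
    (hx : x ∈ closedCube d) :
    ∃ (j : Fin d → Fin (2 ^ k)) (σ : Equiv.Perm (Fin d)), x ∈ kuhnSimplex j σ := by
  have h : ∀ i, ∃ j : Fin (2 ^ k), 0 ≤ 2 ^ k * x i - ((j : ℕ) : ℝ) ∧
      2 ^ k * x i - ((j : ℕ) : ℝ) ≤ 1 := by
    intro i
    obtain ⟨h0, h1⟩ := hx i
    have h2 : (0 : ℝ) ≤ 2 ^ k * x i := by positivity
    rcases h1.lt_or_eq with h1 | h1
    · refine ⟨⟨⌊2 ^ k * x i⌋₊, ?_⟩, ?_, ?_⟩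
      · rw [Nat.floor_lt h2]
        push_cast
        have : (0 : ℝ) < 2 ^ k := by positivity
        nlinarith
      · exact sub_nonneg.2 (Nat.floor_le h2)
      · have := (Nat.lt_floor_add_one (2 ^ k * x i)).le
        simp only
        linarith
    · refine ⟨⟨2 ^ k - 1, Nat.sub_lt (by positivity) one_pos⟩, ?_⟩
      simp only [h1]
      rw [Nat.cast_sub Nat.one_le_two_pow]
      simp
  choose j hj using h
  set y : Fin d → ℝ := fun i => -(2 ^ k * x i - ((j i : ℕ) : ℝ)) with hy
  refine ⟨j, Tuple.sort y, hj, fun a b hab => ?_⟩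
  have := Tuple.monotone_sort y hab
  simp only [hy, Function.comp] at this
  simp only
  linarith

/-- The interpolant is unique on `[0,1]^d`. -/
theorem IsInterpolant.eqOn {d k r : ℕ} (hr : 2 ≤ r) {f S S' : EuclideanSpace ℝ (Fin d) → ℝ}
    (hS : IsInterpolant k r f S) (hS' : IsInterpolant k r f S') :
    Set.EqOn S S' (closedCube d) := by
  intro x hx
  obtain ⟨j, σ, hT⟩ := exists_mem_kuhnSimplex k hx
  obtain ⟨P, hP, hPS, hPf⟩ := hS.2 j σ
  obtain ⟨Q, hQ, hQS, hQf⟩ := hS'.2 j σ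
  have : P = Q := kuhn_unisolvent hr j σ P Q hP hQ fun y hy => by rw [hPf y hy, hQf y hy]
  rw [hPS x hT, hQS x hT, this]

/-- The interpolation operator `S_k^* = S_{k,r}^*`, `r ≥ 2`: `interpolant k r f` is the interpolant
of `f`, which exists and is unique on `[0,1]^d`. -/
def interpolant {d : ℕ} (k r : ℕ) (f : EuclideanSpace ℝ (Fin d) → ℝ) :
    EuclideanSpace ℝ (Fin d) → ℝ :=
  Classical.epsilon (IsInterpolant k r f)

theorem interpolant_spec {d : ℕ} (k r : ℕ) (hr : 2 ≤ r) (f : EuclideanSpace ℝ (Fin d) → ℝ) :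
    IsInterpolant k r f (interpolant k r f) :=
  Classical.epsilon_spec (exists_isInterpolant k r hr f)

theorem two_le_besovOrder (s : ℝ) : 2 ≤ besovOrder s := by
  unfold besovOrder
  have : 1 ≤ ⌊max s 1⌋₊ := Nat.le_floor (by simp)
  omega

end

/-! The core is a Whitney estimate in the uniform norm: on a cube, `f` lies within a constant times
a weighted sum of the `L_q` norms of its dyadic differences of some polynomial of degree `< r`. Here
`q = p` if `p < ∞`; for `p = ∞` any finite `q` with `s q > d` serves. The argument covers `p < 1`,
because no local integrability of `f` is used.

On a finite grid the estimate is linear algebra. A grid function annihilated by enough `r`-th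
differences is a polynomial of degree `< r` (`exists_polynomial_of_fwdDiff_eq_zero`), so a function
with small differences is near such a polynomial (`exists_polynomial_near_on_grid`). If the
differences on the lattices `x + 2^{-j} ℤ^d` decay like `G ρ^j` with `ρ < 1`, repeated halving of
the cube turns this into one polynomial within `C G` of `f` at all dyadic lattice points of the cube
(`exists_polynomial_near_on_dyadic`).

A good base point `x` is found by averaging (`exists_polynomial_near_of_diffSum`). The mean over `x`
of the weighted sum of the `q`-th powers of all differences at all lattice points is controlled by
`diffSum`, and when this sum is finite at `x`, every single difference decays geometrically. For
almost every `x` the bound on the countable set of lattice points then holds almost everywhere, by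
continuity of translations in `L_1` (`ae_abs_sub_eval_le`).

Rescaled to cubes of side `2^{-k}`, the estimate has right-hand sides `cellSum` that tend to zero
because `s > d/p`. Gluing the local polynomials with the piecewise linear partition of unity gives
continuous functions converging uniformly to a representative of `f` (`exists_isContRep`).
Interpolation reproduces polynomials and has Lebesgue constants independent of `k`, so its local
error obeys the same bound (`exists_local_error_bound`). For `p < ∞`, summing `p`-th powers over the
disjoint dyadic cubes gives the bound for `τ = p`, the largest local error gives `τ = ∞`, and
splitting the power `τ = (τ - p) + p` gives the rest with one constant
(`lintegral_sub_interpolant_le`). For `p = ∞` only `τ = ∞` occurs. -/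

noncomputable section

/-! ### Grid functions annihilated by differences are polynomials. -/

theorem fwdDiff_iter_eq_zero_of_forall {M : Type*} [AddCommMonoid M] {n : ℕ} {h y : M}
    {f : M → ℝ} (hf : ∀ k ≤ n, f (y + k • h) = 0) : (fwdDiff h)^[n] f y = 0 := by
  rw [fwdDiff_iter_eq_sum_shift]
  refine sum_eq_zero fun k hk => ?_
  rw [hf k (by simp at hk; omega), smul_zero]

/-- The last of the `n + 1` values enters the `n`-th difference with coefficient `1`, so it is
determined by the others. -/
theorem eq_zero_of_fwdDiff_iter_eq_zero {M : Type*} [AddCommMonoid M] {n : ℕ} {h y : M}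
    {f : M → ℝ} (h0 : (fwdDiff h)^[n] f y = 0) (hf : ∀ k < n, f (y + k • h) = 0) :
    f (y + n • h) = 0 := by
  rw [fwdDiff_iter_eq_sum_shift, sum_range_succ, sum_eq_zero] at h0
  · simpa using h0
  · intro k hk
    rw [hf k (by simpa using hk), smul_zero]

theorem fwdDiff_iter_sub {M : Type*} [AddCommMonoid M] (n : ℕ) (h y : M) (f g : M → ℝ) :
    (fwdDiff h)^[n] (fun x => f x - g x) y = (fwdDiff h)^[n] f y - (fwdDiff h)^[n] g y := by
  simp only [fwdDiff_iter_eq_sum_shift, smul_sub, sum_sub_distrib]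

/-- A function on a grid that vanishes on the initial box and is killed by the coordinate
differences vanishes. -/
theorem eq_zero_on_grid {d r K : ℕ} {χ : (Fin d → ℕ) → ℝ}
    (h0 : ∀ m, (∀ i, m i < r) → χ m = 0)
    (hd : ∀ m i, (∀ j, (m + r • Pi.single i 1 : Fin d → ℕ) j < K) →
      (fwdDiff (Pi.single i 1))^[r] χ m = 0) :
    ∀ m, (∀ i, m i < K) → χ m = 0 := by
  intro m
  induction hn : ∑ i, m i using Nat.strong_induction_on generalizing m with
  | _ n ih =>
    intro hm
    by_cases hr : ∀ i, m i < r
    · exact h0 m hr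
    push Not at hr
    obtain ⟨i, hi⟩ := hr
    -- The difference based at `m' = m - r e_i` has `m` as its last point. Its other points have
    -- smaller coordinate sum, so the induction hypothesis applies to them.
    set m' : Fin d → ℕ := Function.update m i (m i - r) with hm'
    have key : ∀ k : ℕ, m' + k • Pi.single i 1 = Function.update m i (m i - r + k) := by
      intro k
      funext j
      by_cases hj : j = i
      · subst hj; simp [hm']
      · simp [hm', hj]
    have htop : m' + r • Pi.single i 1 = m := by
      rw [key, Nat.sub_add_cancel hi, Function.update_eq_self]
    rw [← htop]
    refine eq_zero_of_fwdDiff_iter_eq_zero (hd m' i (by rw [htop]; exact hm)) fun k hk => ?_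
    rw [key]
    have hlt : m i - r + k < m i := by omega
    refine ih _ ?_ _ rfl ?_
    · rw [← hn]
      refine sum_lt_sum (fun j _ => ?_) ⟨i, mem_univ i, by simpa using hlt⟩
      by_cases hj : j = i
      · subst hj; simpa using hlt.le
      · simp [hj]
    · intro j
      by_cases hj : j = i
      · subst hj; simpa using hlt.trans (hm j)
      · simpa [hj] using hm j

/-- Tensor product interpolation. -/
theorem exists_tensor_interpolant {d r : ℕ} (hr : 1 ≤ r) (φ : (Fin d → ℕ) → ℝ) :
    ∃ P : MvPolynomial (Fin d) ℝ, (∀ i, P.degreeOf i < r) ∧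
      ∀ m : Fin d → ℕ, (∀ i, m i < r) → MvPolynomial.eval (fun i => (m i : ℝ)) P = φ m := by
  classical
  let L : ℕ → Fin d → MvPolynomial (Fin d) ℝ := fun b i =>
    ∏ l ∈ (range r).erase b, (MvPolynomial.C (((b : ℝ) - l)⁻¹) *
      (MvPolynomial.X i - MvPolynomial.C (l : ℝ)))
  have hL : ∀ b i (m : Fin d → ℕ), b < r → m i < r →
      MvPolynomial.eval (fun i => (m i : ℝ)) (L b i) = if m i = b then 1 else 0 := by
    intro b i m hb hm
    simp only [L, map_prod, map_mul, MvPolynomial.eval_C, map_sub, MvPolynomial.eval_X]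
    split_ifs with h
    · refine prod_eq_one fun l hl => ?_
      rw [h]
      refine inv_mul_cancel₀ (sub_ne_zero.2 ?_)
      have := ne_of_mem_erase hl
      exact_mod_cast this.symm
    · refine prod_eq_zero (mem_erase.2 ⟨h, mem_range.2 hm⟩) ?_
      simp
  refine ⟨∑ β ∈ Fintype.piFinset fun _ : Fin d => range r,
    MvPolynomial.C (φ β) * ∏ i, L (β i) i, fun i => ?_, fun m hm => ?_⟩
  · refine (MvPolynomial.degreeOf_sum_le _ _ _).trans_lt ?_
    rw [Finset.sup_lt_iff (show (⊥ : ℕ) < r from hr)]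
    intro β hβ
    refine (MvPolynomial.degreeOf_C_mul_le _ _ _).trans_lt ?_
    refine (MvPolynomial.degreeOf_prod_le _ _ _).trans_lt ?_
    have h1 : ∀ j ∈ (univ : Finset (Fin d)), (L (β j) j).degreeOf i ≤ if j = i then r - 1 else 0 := by
      intro j _
      refine (MvPolynomial.degreeOf_prod_le _ _ _).trans ?_
      have h2 : ∀ l ∈ (range r).erase (β j), (MvPolynomial.C (((β j : ℝ) - l)⁻¹) *
          (MvPolynomial.X j - MvPolynomial.C (l : ℝ))).degreeOf i ≤ if j = i then 1 else 0 := by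
        intro l _
        refine (MvPolynomial.degreeOf_C_mul_le _ _ _).trans ?_
        refine (MvPolynomial.degreeOf_sub_le _ _ _).trans ?_
        rw [MvPolynomial.degreeOf_C, MvPolynomial.degreeOf_X]
        simp [eq_comm]
      refine (sum_le_sum h2).trans ?_
      have hβj : β j ∈ range r := Fintype.mem_piFinset.1 hβ j
      rw [sum_const, card_erase_of_mem hβj, card_range]
      split_ifs <;> simp
    refine (sum_le_sum h1).trans_lt ?_
    simp
    omega
  · simp only [map_sum, map_mul, MvPolynomial.eval_C, map_prod]
    rw [sum_eq_single m]
    · rw [prod_eq_one, mul_one]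
      intro i _
      rw [hL _ _ _ (hm i) (hm i), if_pos rfl]
    · intro β hβ hne
      obtain ⟨i, hi⟩ := Function.ne_iff.1 hne
      rw [prod_eq_zero (mem_univ i), mul_zero]
      rw [hL _ _ _ (by simpa using Fintype.mem_piFinset.1 hβ i) (hm i), if_neg (Ne.symm hi)]
    · intro h
      exact absurd (Fintype.mem_piFinset.2 fun i => mem_range.2 (hm i)) h

/-- A step in direction `i` changes only the factor `(m i) ^ s i` of a monomial, and the `r`-th
difference kills powers below `r`. -/
theorem fwdDiff_iter_eval_single {d r : ℕ} {P : MvPolynomial (Fin d) ℝ} {i : Fin d}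
    (hP : P.degreeOf i < r) (m : Fin d → ℕ) :
    (fwdDiff (Pi.single i 1))^[r]
      (fun m : Fin d → ℕ => MvPolynomial.eval (fun i => (m i : ℝ)) P) m = 0 := by
  have h1 : (fun m : Fin d → ℕ => MvPolynomial.eval (fun i => (m i : ℝ)) P) =
      ∑ s ∈ P.support, P.coeff s • fun m : Fin d → ℕ => ∏ j, (m j : ℝ) ^ s j := by
    funext m
    simp [MvPolynomial.eval_eq']
  rw [h1, fwdDiff_iter_finsetSum, Finset.sum_apply]
  refine sum_eq_zero fun s hs => ?_
  rw [fwdDiff_iter_const_smul, Pi.smul_apply]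
  have hsi : s i < r := (MvPolynomial.le_degreeOf_of_mem_support i hs).trans_lt hP
  have h2 := congrFun (fwdDiff_iter_pow_eq_zero_of_lt (R := ℝ) hsi) (m i : ℝ)
  rw [fwdDiff_iter_eq_sum_shift] at h2 ⊢
  have h3 : ∀ k : ℕ, ∏ j, (((m + k • Pi.single i 1 : Fin d → ℕ) j : ℕ) : ℝ) ^ s j =
      ((m i : ℝ) + k) ^ s i * ∏ j ∈ univ.erase i, (m j : ℝ) ^ s j := by
    intro k
    rw [← mul_prod_erase _ _ (mem_univ i)]
    congr 1
    · simp
    · refine prod_congr rfl fun j hj => ?_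
      simp [ne_of_mem_erase hj]
  simp only [h3, ← smul_mul_assoc, ← sum_mul]
  simp only [nsmul_eq_mul, mul_one, Pi.zero_apply] at h2
  rw [h2, smul_zero, zero_mul]

/-- A polynomial killed by the `r`-th difference at all natural numbers has degree `< r`. -/
theorem natDegree_lt_of_fwdDiff_iter_eq_zero {q : Polynomial ℝ} {r : ℕ} (hr : 1 ≤ r)
    (h : ∀ t : ℕ, (fwdDiff (1 : ℝ))^[r] (fun x => q.eval x) t = 0) : q.natDegree < r := by
  by_contra! hq
  obtain ⟨n, hn⟩ := Nat.exists_eq_add_of_le' hq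
  have h1 := congrFun q.fwdDiff_iter_degree_eq_factorial 0
  have h2 : (fwdDiff (1 : ℝ))^[q.natDegree] (fun x => q.eval x) 0 = 0 := by
    rw [hn, Function.iterate_add_apply]
    refine fwdDiff_iter_eq_zero_of_forall fun k _ => ?_
    simpa using h k
  have h3 : q.leadingCoeff = 0 := by
    have : q.leadingCoeff * (q.natDegree.factorial : ℝ) = 0 := by
      rw [← h2]; simpa using h1.symm
    rcases mul_eq_zero.1 this with h | h
    · exact h
    · exact absurd h (by exact_mod_cast q.natDegree.factorial_ne_zero)
  rw [Polynomial.leadingCoeff_eq_zero] at h3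
  simp [h3] at hq
  omega

/-- The restriction of a polynomial to the line through the origin with direction `e`. -/
theorem coeff_lineRestrict {d : ℕ} (P : MvPolynomial (Fin d) ℝ) (e : Fin d → ℝ) (n : ℕ) :
    (MvPolynomial.aeval (fun i => Polynomial.C (e i) * Polynomial.X) P).coeff n =
      MvPolynomial.eval e (MvPolynomial.homogeneousComponent n P) := by
  conv_lhs => rw [P.as_sum]
  rw [map_sum, Polynomial.finsetSum_coeff, MvPolynomial.homogeneousComponent_apply, map_sum,
    sum_filter]
  refine sum_congr rfl fun s _ => ?_
  rw [MvPolynomial.aeval_monomial, Finsupp.prod_fintype _ _ (by simp)]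
  simp only [mul_pow, prod_mul_distrib, MvPolynomial.eval_monomial,
    Finsupp.prod_fintype _ _ (fun i => pow_zero (e i)), prod_pow_eq_pow_sum, ← map_pow, ← map_prod]
  rw [Polynomial.algebraMap_eq, ← mul_assoc, ← map_mul, Polynomial.coeff_C_mul_X_pow,
    Finsupp.degree_eq_sum]
  simp only [eq_comm]

/-- A function on a large grid that is killed by all `r`-th differences is a polynomial of total
degree `< r`. -/
theorem exists_polynomial_of_fwdDiff_eq_zero {d r K : ℕ} (hr : 2 ≤ r) (hK : r * r ≤ K)
    {φ : (Fin d → ℕ) → ℝ}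
    (h : ∀ m e : Fin d → ℕ, (∀ i, e i < r) → (∀ i, (m + r • e) i < K) →
      (fwdDiff e)^[r] φ m = 0) :
    ∃ P : MvPolynomial (Fin d) ℝ, P.totalDegree < r ∧
      ∀ m : Fin d → ℕ, (∀ i, m i < K) → MvPolynomial.eval (fun i => (m i : ℝ)) P = φ m := by
  obtain ⟨P, hPdeg, hP⟩ := exists_tensor_interpolant (d := d) (r := r) (by omega) φ
  have hgrid : ∀ m : Fin d → ℕ, (∀ i, m i < K) →
      MvPolynomial.eval (fun i => (m i : ℝ)) P - φ m = 0 := by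
    refine eq_zero_on_grid (r := r) (fun m hm => by rw [hP m hm, sub_self]) fun m i hm => ?_
    rw [fwdDiff_iter_sub, fwdDiff_iter_eval_single (hPdeg i), h m _ _ hm, sub_zero]
    intro j
    by_cases hj : j = i
    · subst hj; simp; omega
    · simp [hj]; omega
  have hPe : ∀ e : Fin d → ℕ, (∀ i, e i < r) → ∀ m, (fwdDiff e)^[r]
      (fun m : Fin d → ℕ => MvPolynomial.eval (fun i => (m i : ℝ)) P) m = 0 := by
    intro e he m
    -- The grid argument is now applied to the function `Δ_e^r P` itself; the size of the box only
    -- has to exceed the coordinates of `m`.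
    refine eq_zero_on_grid (r := r) (K := ∑ i, m i + 1) (fun m hm => ?_) (fun m i _ => ?_) m
      (fun i => Nat.lt_succ_of_le (single_le_sum (f := m) (fun _ _ => Nat.zero_le _) (mem_univ i)))
    -- Since `m i ≤ r - 1` and `r e_i ≤ r (r - 1)`, all points of the difference stay below `r * r ≤
    -- K`, where `P` agrees with `φ`.
    · have hlt : ∀ i, (m + r • e) i < K := fun i => by
        have h1 := hm i
        have h2 := he i
        have : r * (e i + 1) ≤ r * r := Nat.mul_le_mul_left r h2
        simp only [Pi.add_apply, Pi.smul_apply, smul_eq_mul]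
        linarith
      have := h m e he hlt
      rw [fwdDiff_iter_eq_sum_shift] at this ⊢
      rw [← this]
      refine sum_congr rfl fun k hk => ?_
      rw [sub_eq_zero.1 (hgrid (m + k • e) fun i => ?_)]
      refine lt_of_le_of_lt ?_ (hlt i)
      have : k ≤ r := by simp at hk; omega
      simp only [Pi.add_apply, Pi.smul_apply, smul_eq_mul]
      gcongr
    -- Differences commute, so the coordinate difference may act on `P` before `Δ_e^r` does, and it
    -- already gives zero.
    · have hcomm : Function.Commute (fwdDiff (G := ℝ) (Pi.single i 1 : Fin d → ℕ)) (fwdDiff e) := by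
        intro f
        funext x
        simp only [fwdDiff, add_right_comm x e]
        ring
      rw [← Function.comp_apply (f := (fwdDiff (Pi.single i 1))^[r]), (hcomm.iterate_iterate r r).comp_eq,
        Function.comp_apply]
      exact fwdDiff_iter_eq_zero_of_forall fun k _ => fwdDiff_iter_eval_single (hPdeg i) _
  refine ⟨P, ?_, fun m hm => sub_eq_zero.1 (hgrid m hm)⟩
  -- For `e` in `{0, …, r-1}^d` the polynomial `t ↦ P(t e)` has vanishing `r`-th differences, hence
  -- degree `< r`. Its `n`-th coefficient is the homogeneous component of degree `n` at `e`. That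
  -- component has degree `< r` in each variable and vanishes at all these `e`, so it is zero.
  have hcomp : ∀ n, r ≤ n → MvPolynomial.homogeneousComponent n P = 0 := by
    intro n hn
    refine MvPolynomial.eq_zero_of_eval_zero_at_prod_finset _
      (fun _ => (range r).image (Nat.cast : ℕ → ℝ)) (fun i => ?_) (fun x hx => ?_)
    · rw [card_image_of_injective _ Nat.cast_injective, card_range]
      refine lt_of_le_of_lt ?_ (hPdeg i)
      rw [MvPolynomial.degreeOf_le_iff]
      intro s hs
      refine MvPolynomial.le_degreeOf_of_mem_support i ?_
      rw [MvPolynomial.support_homogeneousComponent] at hs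
      exact (mem_filter.1 hs).1
    · have : ∀ i, ∃ b : ℕ, b < r ∧ (b : ℝ) = x i := fun i => by simpa using hx i
      choose e he hex using this
      rw [← coeff_lineRestrict]
      refine Polynomial.coeff_eq_zero_of_natDegree_lt (lt_of_lt_of_le ?_ hn)
      refine natDegree_lt_of_fwdDiff_iter_eq_zero (by omega) fun t => ?_
      have := hPe e he (t • e)
      rw [fwdDiff_iter_eq_sum_shift] at this ⊢
      rw [← this]
      refine sum_congr rfl fun k _ => ?_
      congr 1
      rw [← Polynomial.coe_evalRingHom, MvPolynomial.aeval_def, MvPolynomial.eval₂_comp_left,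
        MvPolynomial.eval]
      congr 1
      · ext; simp
      · funext i
        simp [← hex]
        ring
  rw [MvPolynomial.totalDegree, Finset.sup_lt_iff (show (⊥ : ℕ) < r by simp; omega)]
  intro s hs
  by_contra! hdeg
  have := congrArg (MvPolynomial.coeff s) (hcomp _ hdeg)
  rw [MvPolynomial.coeff_homogeneousComponent, if_pos (by rw [Finsupp.degree_eq_sum, Finsupp.sum_fintype]; simp)] at this
  exact MvPolynomial.mem_support_iff.1 hs this

/-! ### Stability constants from finite-dimensional linear algebra. -/

theorem exists_leftInverse_on_range {V W : Type*} [AddCommGroup V] [Module ℝ V] [AddCommGroup W]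
    [Module ℝ W] (D : V →ₗ[ℝ] W) : ∃ g : W →ₗ[ℝ] V, ∀ v, D (g (D v)) = D v := by
  obtain ⟨g, hg⟩ := D.rangeRestrict.exists_rightInverse_of_surjective D.range_rangeRestrict
  obtain ⟨g', hg'⟩ := LinearMap.exists_extend g
  refine ⟨g', fun v => ?_⟩
  have h1 : g' (D v) = g (D.rangeRestrict v) := by
    rw [← hg']; rfl
  rw [h1]
  have := LinearMap.congr_fun hg (D.rangeRestrict v)
  simpa using congrArg Subtype.val this

theorem abs_apply_le_of_abs_le {κ ι : Type*} [Fintype κ] [DecidableEq κ]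
    (g : (κ → ℝ) →ₗ[ℝ] (ι → ℝ)) (i : ι) {w : κ → ℝ} {G : ℝ} (hw : ∀ k, |w k| ≤ G) :
    |g w i| ≤ (∑ k, |g (fun j => if k = j then 1 else 0) i|) * G := by
  rw [LinearMap.pi_apply_eq_sum_univ g w, Finset.sum_apply, sum_mul]
  refine (abs_sum_le_sum_abs _ _).trans (sum_le_sum fun k _ => ?_)
  rw [Pi.smul_apply, smul_eq_mul, abs_mul, mul_comm]
  exact mul_le_mul_of_nonneg_left (hw k) (abs_nonneg _)

/-- A vector that a linear map nearly annihilates is near its kernel. -/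
theorem exists_near_ker {ι κ : Type*} [Fintype ι] [Fintype κ]
    (D : (ι → ℝ) →ₗ[ℝ] (κ → ℝ)) :
    ∃ C : ℝ, 0 ≤ C ∧ ∀ φ G, (∀ k, |D φ k| ≤ G) → ∃ ψ, D ψ = 0 ∧ ∀ i, |φ i - ψ i| ≤ C * G := by
  classical
  obtain ⟨g, hg⟩ := exists_leftInverse_on_range D
  refine ⟨∑ i, ∑ k, |g (fun j => if k = j then 1 else 0) i|,
    sum_nonneg fun _ _ => sum_nonneg fun _ _ => abs_nonneg _, fun φ G hG => ?_⟩
  -- The correction `g (D φ)` has the same image as `φ` and is bounded by the matrix entries of `g`,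
  -- which do not depend on `φ`.
  refine ⟨φ - g (D φ), by rw [map_sub, hg, sub_self], fun i => ?_⟩
  have h1 : φ i - (φ - g (D φ)) i = g (D φ) i := by simp
  rw [h1]
  -- Without any condition `G` may be negative, but then `D φ = 0` and the constant is an empty sum.
  rcases isEmpty_or_nonempty κ with hκ | ⟨⟨k⟩⟩
  · have : D φ = 0 := Subsingleton.elim _ _
    simp [this]
  · have hG0 : 0 ≤ G := (abs_nonneg _).trans (hG k)
    refine (abs_apply_le_of_abs_le g i hG).trans (mul_le_mul_of_nonneg_right ?_ hG0)
    exact single_le_sum (f := fun i => ∑ k, |g (fun j => if k = j then 1 else 0) i|)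
      (fun _ _ => sum_nonneg fun _ _ => abs_nonneg _) (mem_univ i)

/-- Whitney's theorem on a finite grid. -/
theorem exists_polynomial_near_on_grid {d r K : ℕ} (hr : 2 ≤ r) (hK : r * r ≤ K) :
    ∃ C : ℝ, 0 ≤ C ∧ ∀ (φ : (Fin d → ℕ) → ℝ) (G : ℝ), 0 ≤ G →
      (∀ m e : Fin d → ℕ, (∀ i, e i < r) → (∀ i, (m + r • e) i < K) →
        |(fwdDiff e)^[r] φ m| ≤ G) →
      ∃ P : MvPolynomial (Fin d) ℝ, P.totalDegree < r ∧
        ∀ m : Fin d → ℕ, (∀ i, m i < K) →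
          |φ m - MvPolynomial.eval (fun i => (m i : ℝ)) P| ≤ C * G := by
  classical
  let ext : ((Fin d → Fin K) → ℝ) →ₗ[ℝ] ((Fin d → ℕ) → ℝ) :=
    { toFun := fun φ m => if h : ∀ i, m i < K then φ fun i => ⟨m i, h i⟩ else 0
      map_add' := fun φ ψ => by
        funext m; simp only [Pi.add_apply]; split_ifs <;> simp
      map_smul' := fun c φ => by
        funext m; simp only [Pi.smul_apply, RingHom.id_apply]; split_ifs <;> simp }
  have hext : ∀ φ m (h : ∀ i, m i < K), ext φ m = φ fun i => ⟨m i, h i⟩ := fun φ m h => by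
    simp [ext, h]
  -- All differences that stay inside the box form one linear map; those that leave it are replaced
  -- by zero, so that only actual grid values enter.
  let D : ((Fin d → Fin K) → ℝ) →ₗ[ℝ] ((Fin d → Fin K) × (Fin d → Fin r) → ℝ) :=
    { toFun := fun φ me => if ∀ i, (me.1 i : ℕ) + r * (me.2 i : ℕ) < K then
        (fwdDiff fun i => (me.2 i : ℕ))^[r] (ext φ) (fun i => (me.1 i : ℕ)) else 0
      map_add' := fun φ ψ => by
        funext m; simp only [Pi.add_apply, map_add, fwdDiff_iter_add]; split_ifs <;> simp
      map_smul' := fun c φ => by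
        funext m; simp only [Pi.smul_apply, RingHom.id_apply, map_smul, fwdDiff_iter_const_smul]
        split_ifs <;> simp }
  obtain ⟨C, hC, hD⟩ := exists_near_ker D
  refine ⟨C, hC, fun φ G hG h => ?_⟩
  have hle : ∀ {m e : Fin d → ℕ} {k : ℕ}, (∀ i, (m + r • e) i < K) → k ≤ r →
      ∀ i, (m + k • e) i < K := by
    intro m e k h hk i
    refine lt_of_le_of_lt ?_ (h i)
    simp only [Pi.add_apply, Pi.smul_apply, smul_eq_mul]
    gcongr
  obtain ⟨ψ, hψ, hφψ⟩ := hD (fun m => φ fun i => (m i : ℕ)) G (by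
    rintro ⟨m, e⟩
    simp only [D, LinearMap.coe_mk, AddHom.coe_mk]
    split_ifs with hme
    · have hme' : ∀ i, ((fun i => (m i : ℕ)) + r • (fun i => (e i : ℕ)) : Fin d → ℕ) i < K := hme
      convert h (fun i => m i) (fun i => e i) (fun i => (e i).2) hme' using 2
      rw [fwdDiff_iter_eq_sum_shift, fwdDiff_iter_eq_sum_shift]
      refine sum_congr rfl fun k hk => ?_
      rw [hext _ _ (hle hme' (by simp at hk; omega))]
    · simpa using hG)
  obtain ⟨P, hP, hPψ⟩ := exists_polynomial_of_fwdDiff_eq_zero (φ := ext ψ) hr hK (by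
    intro m e he hme
    have hm : ∀ i, m i < K := fun i => by simpa using hle (k := 0) hme (Nat.zero_le _) i
    have := congrFun hψ (fun i => ⟨m i, hm i⟩, fun i => ⟨e i, he i⟩)
    simp only [D, LinearMap.coe_mk, AddHom.coe_mk] at this
    rw [if_pos (fun i => by simpa using hme i)] at this
    exact this)
  refine ⟨P, hP, fun m hm => ?_⟩
  rw [hPψ m hm, hext _ _ hm]
  exact hφψ fun i => ⟨m i, hm i⟩

/-- Polynomials of degree `< r` are bounded on bounded sets by their values on a unisolvent set. -/
theorem exists_bound_of_unisolvent {d r : ℕ} (hr : 1 ≤ r) (X : Set (Fin d → ℝ)) (hX : X.Finite)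
    (hu : ∀ P : MvPolynomial (Fin d) ℝ, P.totalDegree < r →
      (∀ x ∈ X, MvPolynomial.eval x P = 0) → P = 0) (B : ℝ) :
    ∃ C : ℝ, 0 ≤ C ∧ ∀ P : MvPolynomial (Fin d) ℝ, P.totalDegree < r → ∀ G : ℝ, 0 ≤ G →
      (∀ x ∈ X, |MvPolynomial.eval x P| ≤ G) →
      ∀ y : Fin d → ℝ, (∀ i, |y i| ≤ B) → |MvPolynomial.eval y P| ≤ C * G := by
  classical
  have := hX.fintype
  let V := MvPolynomial.restrictTotalDegree (Fin d) ℝ (r - 1)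
  have hV : ∀ P : MvPolynomial (Fin d) ℝ, P ∈ V ↔ P.totalDegree < r := fun P => by
    rw [MvPolynomial.mem_restrictTotalDegree]; omega
  let E : V →ₗ[ℝ] (X → ℝ) :=
    { toFun := fun P x => MvPolynomial.eval x.1 P.1
      map_add' := fun p q => by ext; simp
      map_smul' := fun c p => by ext; simp }
  have hE : LinearMap.ker E = ⊥ := by
    rw [LinearMap.ker_eq_bot']
    intro P hP
    exact Subtype.ext (hu P.1 ((hV _).1 P.2) fun x hx => congrFun hP ⟨x, hx⟩)
  -- Unisolvence makes evaluation on `X` injective. A left inverse expresses `P` through its values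
  -- on `X` and finitely many fixed polynomials, each bounded on the compact box.
  obtain ⟨g, hg⟩ := E.exists_leftInverse_of_injective hE
  have hb : ∀ x : X, ∃ c : ℝ, 0 ≤ c ∧ ∀ y : Fin d → ℝ, (∀ i, |y i| ≤ B) →
      |MvPolynomial.eval y (g (fun j => if x = j then 1 else 0)).1| ≤ c := by
    intro x
    have hc : IsCompact (Set.univ.pi fun _ : Fin d => Set.Icc (-B) B) :=
      isCompact_univ_pi fun _ => isCompact_Icc
    obtain ⟨c, hc⟩ := hc.exists_bound_of_continuousOn
      (MvPolynomial.continuous_eval (g (fun j => if x = j then 1 else 0)).1).continuousOn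
    exact ⟨max c 0, le_max_right _ _, fun y hy =>
      (hc y fun i _ => abs_le.1 (hy i)).trans (le_max_left _ _)⟩
  choose c hc0 hc using hb
  refine ⟨∑ x, c x, sum_nonneg fun x _ => hc0 x, fun P hP G hG h y hy => ?_⟩
  have h1 : P = (g (E ⟨P, (hV P).2 hP⟩)).1 := by
    have := LinearMap.congr_fun hg ⟨P, (hV P).2 hP⟩
    exact (congrArg Subtype.val this).symm
  rw [h1, LinearMap.pi_apply_eq_sum_univ g, AddSubmonoidClass.coe_finsetSum, map_sum, sum_mul]
  refine (abs_sum_le_sum_abs _ _).trans (sum_le_sum fun x _ => ?_)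
  rw [SetLike.val_smul, MvPolynomial.smul_eval, abs_mul, mul_comm]
  exact mul_le_mul (hc x y hy) (h x.1 x.2) (abs_nonneg _) (hc0 x)

/-- Polynomials of degree `< r` are stable under affine substitutions. -/
theorem exists_affine_substitution {d r : ℕ} (P : MvPolynomial (Fin d) ℝ) (hP : P.totalDegree < r)
    (a : ℝ) (b : Fin d → ℝ) : ∃ P' : MvPolynomial (Fin d) ℝ, P'.totalDegree < r ∧
      ∀ y, MvPolynomial.eval y P' = MvPolynomial.eval (a • y + b) P := by
  refine ⟨MvPolynomial.bind₁ (fun i => MvPolynomial.C a * MvPolynomial.X i + MvPolynomial.C (b i)) P,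
    ?_, fun y => ?_⟩
  · refine lt_of_le_of_lt ?_ hP
    conv_lhs => rw [P.as_sum]
    rw [map_sum]
    refine MvPolynomial.totalDegree_finsetSum_le fun s hs => ?_
    rw [MvPolynomial.bind₁_monomial]
    refine (MvPolynomial.totalDegree_mul _ _).trans ?_
    rw [MvPolynomial.totalDegree_C, zero_add]
    refine (MvPolynomial.totalDegree_finsetProd _ _).trans ?_
    refine le_trans (sum_le_sum (g := fun i => s i) fun i _ => ?_) (MvPolynomial.le_totalDegree hs)
    refine (MvPolynomial.totalDegree_pow _ _).trans ?_
    refine (Nat.mul_le_mul_left (s i) (?_ : _ ≤ 1)).trans (mul_one _).le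
    refine (MvPolynomial.totalDegree_add _ _).trans (max_le ?_ (by simp))
    refine (MvPolynomial.totalDegree_mul _ _).trans ?_
    rw [MvPolynomial.totalDegree_C, MvPolynomial.totalDegree_X]
  · rw [MvPolynomial.eval, MvPolynomial.eval₂Hom_bind₁]
    congr 1
    congr 1
    funext i
    simp

/-- A polynomial of degree `< r` is determined by its values on a grid of `r` points in every
direction. -/
theorem eq_zero_of_eval_grid_eq_zero {d r : ℕ} (P : MvPolynomial (Fin d) ℝ)
    (hP : P.totalDegree < r)
    (h : ∀ m : Fin d → ℕ, (∀ i, m i < r) → MvPolynomial.eval (fun i => (m i : ℝ)) P = 0) :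
    P = 0 := by
  refine MvPolynomial.eq_zero_of_eval_zero_at_prod_finset _
    (fun _ => (range r).image (Nat.cast : ℕ → ℝ)) (fun i => ?_) (fun x hx => ?_)
  · rw [card_image_of_injective _ Nat.cast_injective, card_range]
    exact (MvPolynomial.degreeOf_le_totalDegree _ _).trans_lt hP
  · have : ∀ i, ∃ b : ℕ, b < r ∧ (b : ℝ) = x i := fun i => by simpa using hx i
    choose e he hex using this
    rw [← funext hex]
    exact h e he

theorem exists_bound_of_grid {d r : ℕ} (hr : 1 ≤ r) (B : ℝ) :
    ∃ C : ℝ, 0 ≤ C ∧ ∀ P : MvPolynomial (Fin d) ℝ, P.totalDegree < r → ∀ G : ℝ, 0 ≤ G →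
      (∀ m : Fin d → ℕ, (∀ i, m i < r) → |MvPolynomial.eval (fun i => (m i : ℝ)) P| ≤ G) →
      ∀ y : Fin d → ℝ, (∀ i, |y i| ≤ B) → |MvPolynomial.eval y P| ≤ C * G := by
  obtain ⟨C, hC, h⟩ := exists_bound_of_unisolvent hr
    ((fun (m : Fin d → ℕ) (i : Fin d) => (m i : ℝ)) '' {m : Fin d → ℕ | ∀ i, m i < r})
    (Set.Finite.image _ ((Set.Finite.pi fun _ => Set.finite_Iio r).subset fun m hm i _ => hm i))
    (fun P hP hx => eq_zero_of_eval_grid_eq_zero P hP fun m hm => hx _ ⟨m, hm, rfl⟩) B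
  refine ⟨C, hC, fun P hP G hG hm => h P hP G hG ?_⟩
  rintro _ ⟨m, hm', rfl⟩
  exact hm m hm'

/-! ### Whitney's estimate on all dyadic refinements of a lattice. -/

/-- The half-open unit cube `[0,1)^d`. -/
def halfCube (d : ℕ) : Set (Fin d → ℝ) := {y | ∀ i, 0 ≤ y i ∧ y i < 1}

/-- `y` lies on the lattice `x + 2^{-j} ℤ^d`. -/
def OnLattice {d : ℕ} (x : Fin d → ℝ) (j : ℕ) (y : Fin d → ℝ) : Prop :=
  ∀ i, ∃ n : ℤ, 2 ^ j * (y i - x i) = n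

/-- The step `2^{-j} e`. -/
def dyadicStep {d : ℕ} (j : ℕ) (e : Fin d → ℕ) : Fin d → ℝ := fun i => (e i : ℝ) / 2 ^ j

theorem fwdDiff_iter_comp_affine {V : Type*} [AddCommGroup V] [Module ℝ V] (r : ℕ) (f : V → ℝ)
    (a : ℝ) (b h y : V) : (fwdDiff h)^[r] (fun y => f (a • y + b)) y =
      (fwdDiff (a • h))^[r] f (a • y + b) := by
  simp only [fwdDiff_iter_eq_sum_shift]
  refine sum_congr rfl fun k _ => ?_
  rw [smul_add, smul_comm a k h, add_right_comm]

theorem onLattice_of_le {d : ℕ} {x y : Fin d → ℝ} {j k : ℕ} (hjk : j ≤ k) (h : OnLattice x j y) :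
    OnLattice x k y := by
  intro i
  obtain ⟨n, hn⟩ := h i
  refine ⟨2 ^ (k - j) * n, ?_⟩
  push_cast
  rw [← hn, ← mul_assoc, ← pow_add, Nat.sub_add_cancel hjk]

/-- The lattice points of the unit cube form a grid. -/
theorem onLattice_grid {d : ℕ} (x : Fin d → ℝ) (j : ℕ) :
    ∃ u : Fin d → ℝ, (∀ i, 0 ≤ u i ∧ u i < 1) ∧
      (∀ m : Fin d → ℕ, OnLattice x j (fun i => (m i + u i) / 2 ^ j)) ∧
      ∀ y, OnLattice x j y → y ∈ halfCube d →
        ∃ m : Fin d → ℕ, (∀ i, m i < 2 ^ j) ∧ y = fun i => (m i + u i) / 2 ^ j := by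
  have h2 : (0 : ℝ) < 2 ^ j := by positivity
  -- The offset is the fractional part of `2^j x`. Because the cube is half-open, its lattice points
  -- correspond exactly to the indices `m` with `m i < 2^j`, whatever the offset is.
  refine ⟨fun i => Int.fract (2 ^ j * x i), fun i => ⟨Int.fract_nonneg _, Int.fract_lt_one _⟩,
    fun m i => ⟨m i - ⌊2 ^ j * x i⌋, ?_⟩, fun y hy hyQ => ?_⟩
  · have := Int.floor_add_fract (2 ^ j * x i)
    push_cast
    field_simp
    linarith
  · have : ∀ i, ∃ m : ℕ, m < 2 ^ j ∧ 2 ^ j * y i = m + Int.fract (2 ^ j * x i) := by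
      intro i
      obtain ⟨n, hn⟩ := hy i
      have h3 := Int.floor_add_fract (2 ^ j * x i)
      have h4 : 2 ^ j * y i = ((n + ⌊2 ^ j * x i⌋ : ℤ) : ℝ) + Int.fract (2 ^ j * x i) := by
        push_cast; linarith
      have h5 := Int.fract_lt_one (2 ^ j * x i)
      have h6 := Int.fract_nonneg (2 ^ j * x i)
      have h7 : 0 ≤ 2 ^ j * y i := mul_nonneg h2.le (hyQ i).1
      have h8 : 2 ^ j * y i < 2 ^ j := by nlinarith [(hyQ i).2]
      have h9 : 0 ≤ n + ⌊2 ^ j * x i⌋ := by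
        have : ((-1 : ℤ) : ℝ) < ((n + ⌊2 ^ j * x i⌋ : ℤ) : ℝ) := by push_cast at *; linarith
        have := Int.cast_lt.1 this
        omega
      obtain ⟨m, hm⟩ := Int.eq_ofNat_of_zero_le h9
      rw [hm] at h4
      refine ⟨m, ?_, by simpa using h4⟩
      have : (m : ℝ) < 2 ^ j := by simp at h4; linarith
      exact_mod_cast this
    choose m hm1 hm2 using this
    refine ⟨m, hm1, funext fun i => ?_⟩
    rw [← hm2]
    field_simp

theorem grid_mem_halfCube {d j : ℕ} {u : Fin d → ℝ} (hu : ∀ i, 0 ≤ u i ∧ u i < 1) {m : Fin d → ℕ}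
    (hm : ∀ i, m i < 2 ^ j) : (fun i => (m i + u i) / 2 ^ j) ∈ halfCube d := by
  intro i
  have := hu i
  have h2 : (0 : ℝ) < 2 ^ j := by positivity
  have h3 : (m i : ℝ) + 1 ≤ 2 ^ j := by exact_mod_cast hm i
  exact ⟨div_nonneg (by linarith [(m i).cast_nonneg (α := ℝ)]) h2.le,
    (div_lt_one h2).2 (by linarith)⟩

/-- Whitney's theorem on the lattice points of the unit cube. -/
theorem exists_polynomial_near_on_lattice {d r κ : ℕ} (hr : 2 ≤ r) (hκ : r * r ≤ 2 ^ κ) :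
    ∃ C : ℝ, 0 ≤ C ∧ ∀ (f : (Fin d → ℝ) → ℝ) (x : Fin d → ℝ) (G : ℝ), 0 ≤ G →
      (∀ e : Fin d → ℕ, (∀ i, e i < r) → ∀ y, OnLattice x κ y → y ∈ halfCube d →
        y + (r : ℝ) • dyadicStep κ e ∈ halfCube d → |(fwdDiff (dyadicStep κ e))^[r] f y| ≤ G) →
      ∃ P : MvPolynomial (Fin d) ℝ, P.totalDegree < r ∧
        ∀ y, OnLattice x κ y → y ∈ halfCube d → |f y - MvPolynomial.eval y P| ≤ C * G := by
  obtain ⟨C, hC, h⟩ := exists_polynomial_near_on_grid (d := d) hr hκ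
  refine ⟨C, hC, fun f x G hG hf => ?_⟩
  obtain ⟨u, hu, hu1, hu2⟩ := onLattice_grid x κ
  have h2 : (0 : ℝ) < 2 ^ κ := by positivity
  obtain ⟨P, hP, hPf⟩ := h (fun m => f fun i => (m i + u i) / 2 ^ κ) G hG (by
    intro m e he hme
    have hm : ∀ i, m i < 2 ^ κ := fun i => by have := hme i; simp at this; omega
    have key := hf e he _ (hu1 m) (grid_mem_halfCube hu hm) (by
      convert grid_mem_halfCube hu hme using 1
      funext i
      simp [dyadicStep]
      ring)
    convert key using 2
    rw [fwdDiff_iter_eq_sum_shift, fwdDiff_iter_eq_sum_shift]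
    refine sum_congr rfl fun k _ => ?_
    congr 2
    funext i
    simp [dyadicStep]
    ring)
  obtain ⟨P', hP', hPP'⟩ := exists_affine_substitution P hP (2 ^ κ) (-u)
  refine ⟨P', hP', fun y hy hyQ => ?_⟩
  obtain ⟨m, hm, rfl⟩ := hu2 y hy hyQ
  rw [hPP']
  convert hPf m hm using 5
  funext i
  simp
  field_simp
  ring

/-- The constant is uniform in the lattice offset: the offset is removed by an affine substitution
that sends the cube into the box of radius `2 ^ κ`. -/
theorem exists_bound_of_lattice {d r κ : ℕ} (hr : 1 ≤ r) (hκ : r ≤ 2 ^ κ) :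
    ∃ C : ℝ, 0 ≤ C ∧ ∀ (x : Fin d → ℝ) (P : MvPolynomial (Fin d) ℝ), P.totalDegree < r →
      ∀ G : ℝ, 0 ≤ G →
      (∀ y, OnLattice x κ y → y ∈ halfCube d → |MvPolynomial.eval y P| ≤ G) →
      ∀ y ∈ halfCube d, |MvPolynomial.eval y P| ≤ C * G := by
  obtain ⟨C, hC, h⟩ := exists_bound_of_grid (d := d) hr (2 ^ κ)
  refine ⟨C, hC, fun x P hP G hG hx y hy => ?_⟩
  obtain ⟨u, hu, hu1, hu2⟩ := onLattice_grid x κ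
  have h2 : (1 : ℝ) ≤ 2 ^ κ := one_le_pow₀ (by norm_num)
  obtain ⟨P', hP', hPP'⟩ := exists_affine_substitution P hP ((2 ^ κ)⁻¹) ((2 ^ κ : ℝ)⁻¹ • u)
  have := h P' hP' G hG (fun m hm => by
    rw [hPP']
    convert hx _ (hu1 m) (grid_mem_halfCube hu fun i => (hm i).trans_le hκ) using 4
    funext i
    simp
    ring) ((2 ^ κ : ℝ) • y - u) (fun i => by
      have h3 := hy i
      have h4 := hu i
      simp only [Pi.sub_apply, Pi.smul_apply, smul_eq_mul]
      rw [abs_le]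
      constructor <;> nlinarith)
  rw [hPP'] at this
  convert this using 4
  funext i
  simp
  field_simp
  ring

/-- A function whose `r`-th differences on the dyadic refinements of a lattice decay geometrically
is close to a polynomial of degree `< r` on all lattice points of the unit cube. -/
theorem exists_polynomial_near_on_dyadic {d r : ℕ} (hr : 2 ≤ r) {ρ : ℝ} (hρ0 : 0 < ρ)
    (hρ1 : ρ < 1) :
    ∃ C : ℝ, 0 ≤ C ∧ ∀ (f : (Fin d → ℝ) → ℝ) (x : Fin d → ℝ) (G : ℝ), 0 ≤ G →
      (∀ (j : ℕ) (e : Fin d → ℕ), (∀ i, e i < r) → ∀ y, OnLattice x j y → y ∈ halfCube d →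
        y + (r : ℝ) • dyadicStep j e ∈ halfCube d →
        |(fwdDiff (dyadicStep j e))^[r] f y| ≤ G * ρ ^ j) →
      ∃ P : MvPolynomial (Fin d) ℝ, P.totalDegree < r ∧
        ∀ j y, OnLattice x j y → y ∈ halfCube d → |f y - MvPolynomial.eval y P| ≤ C * G := by
  -- The approximation uses level `κ + 1`, so that the trace of the lattice on a half-size subcube,
  -- rescaled, still has level `κ` and at least `r` points in each direction. This is enough to
  -- compare two polynomials there.
  obtain ⟨κ, hκ⟩ : ∃ κ, r * r ≤ 2 ^ κ := ⟨r * r, Nat.lt_two_pow_self.le⟩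
  have hrκ : r ≤ 2 ^ κ := le_trans (by nlinarith) hκ
  have hκ' : r * r ≤ 2 ^ (κ + 1) := hκ.trans (Nat.pow_le_pow_right (by norm_num) (by omega))
  obtain ⟨C₁, hC₁, hW⟩ := exists_polynomial_near_on_lattice (d := d) hr hκ'
  obtain ⟨C₂, hC₂, hB⟩ := exists_bound_of_lattice (d := d) (show 1 ≤ r by omega) hrκ
  have h1ρ : 0 < 1 - ρ := by linarith
  -- Chosen so that `C ρ + 2 C₁ C₂ ≤ C`: passing to a subcube multiplies `G` by `ρ` and costs one
  -- comparison of polynomials.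
  set C := C₁ + 2 * C₁ * C₂ / (1 - ρ) with hC
  have hCC₁ : C₁ ≤ C := le_add_of_nonneg_right (by positivity)
  have hC0 : 0 ≤ C := hC₁.trans hCC₁
  have hCstep : C * ρ + 2 * C₁ * C₂ ≤ C := by
    have : C - (C * ρ + 2 * C₁ * C₂) = C₁ * (1 - ρ) := by
      rw [hC]; field_simp; ring
    nlinarith
  have hρj : ∀ j, ρ ^ j ≤ 1 := fun j => pow_le_one₀ hρ0.le hρ1.le
  have main : ∀ n (f : (Fin d → ℝ) → ℝ) (x : Fin d → ℝ) (G : ℝ), 0 ≤ G →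
      (∀ (j : ℕ) (e : Fin d → ℕ), (∀ i, e i < r) → ∀ y, OnLattice x j y → y ∈ halfCube d →
        y + (r : ℝ) • dyadicStep j e ∈ halfCube d →
        |(fwdDiff (dyadicStep j e))^[r] f y| ≤ G * ρ ^ j) →
      ∀ P : MvPolynomial (Fin d) ℝ, P.totalDegree < r →
        (∀ y, OnLattice x (κ + 1) y → y ∈ halfCube d → |f y - MvPolynomial.eval y P| ≤ C₁ * G) →
        ∀ y, OnLattice x (κ + 1 + n) y → y ∈ halfCube d →
          |f y - MvPolynomial.eval y P| ≤ C * G := by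
    intro n
    induction n with
    | zero =>
      intro f x G hG _ P _ hPf y hy hyQ
      exact (hPf y hy hyQ).trans (mul_le_mul_of_nonneg_right hCC₁ hG)
    | succ n ih =>
      intro f x G hG hf P hP hPf y hy hyQ
      -- `ι` selects the half-size subcube containing `y`. Rescaling it to the unit cube turns level
      -- `j + 1` into level `j`, hence replaces `G` by `G ρ`.
      set ι : Fin d → ℝ := fun i => if y i < 1 / 2 then 0 else 1 with hι
      have hι01 : ∀ i, ι i = 0 ∨ ι i = 1 := fun i => by
        simp only [hι]; split_ifs <;> simp
      have hQ : ∀ z ∈ halfCube d, (1 / 2 : ℝ) • z + (1 / 2 : ℝ) • ι ∈ halfCube d := by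
        intro z hz i
        have h1 := hz i
        simp only [Pi.add_apply, Pi.smul_apply, smul_eq_mul]
        rcases hι01 i with h | h <;> rw [h] <;> constructor <;> linarith
      set x' : Fin d → ℝ := fun i => 2 * x i - ι i with hx'
      have hlat : ∀ j z, OnLattice x' j z → OnLattice x (j + 1) ((1 / 2 : ℝ) • z + (1 / 2 : ℝ) • ι) := by
        intro j z hz i
        obtain ⟨n, hn⟩ := hz i
        refine ⟨n, ?_⟩
        rw [← hn, hx']
        simp only [Pi.add_apply, Pi.smul_apply, smul_eq_mul, pow_succ]
        ring
      set f' : (Fin d → ℝ) → ℝ := fun z => f ((1 / 2 : ℝ) • z + (1 / 2 : ℝ) • ι) with hf'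
      have hstep : ∀ j (e : Fin d → ℕ), (1 / 2 : ℝ) • dyadicStep j e = dyadicStep (j + 1) e := by
        intro j e
        funext i
        simp only [dyadicStep, Pi.smul_apply, smul_eq_mul, pow_succ]
        field_simp
      have hf'' : ∀ (j : ℕ) (e : Fin d → ℕ), (∀ i, e i < r) → ∀ y, OnLattice x' j y →
          y ∈ halfCube d → y + (r : ℝ) • dyadicStep j e ∈ halfCube d →
          |(fwdDiff (dyadicStep j e))^[r] f' y| ≤ (G * ρ) * ρ ^ j := by
        intro j e he z hz hzQ hzQ'
        rw [hf', fwdDiff_iter_comp_affine, hstep]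
        refine (hf (j + 1) e he _ (hlat j z hz) (hQ z hzQ) ?_).trans (le_of_eq (by ring))
        convert hQ _ hzQ' using 1
        rw [← hstep, smul_add, smul_comm, add_right_comm]
      have hGρ : 0 ≤ G * ρ := mul_nonneg hG hρ0.le
      have hGρ' : G * ρ ≤ G := mul_le_of_le_one_right hG hρ1.le
      obtain ⟨P', hP', hPf'⟩ := hW f' x' (G * ρ) hGρ fun e he z hz hz1 hz2 =>
        (hf'' _ e he z hz hz1 hz2).trans (mul_le_of_le_one_right hGρ (hρj _))
      obtain ⟨P'', hP'', hPP''⟩ := exists_affine_substitution P hP (1 / 2) ((1 / 2 : ℝ) • ι)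
      -- `P'` is near the rescaled `f` by Whitney's estimate on the subcube, and `P''`, the rescaled
      -- `P`, is so by hypothesis. Hence they are near each other on the lattice of level `κ`, and
      -- so on the whole cube.
      have hcmp := hB x' (P' - P'')
        ((MvPolynomial.totalDegree_sub _ _).trans_lt (max_lt hP' hP'')) (2 * C₁ * G) (by positivity)
        (fun z hz hzQ => by
          have h1 := hPf' z (onLattice_of_le (Nat.le_succ κ) hz) hzQ
          have h2 := hPf _ (hlat _ z hz) (hQ z hzQ)
          rw [← hPP''] at h2
          rw [map_sub, abs_le]
          have h3 : C₁ * (G * ρ) ≤ C₁ * G := mul_le_mul_of_nonneg_left hGρ' hC₁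
          rw [abs_le] at h1 h2
          simp only [hf'] at h1
          constructor <;> linarith)
      set y' : Fin d → ℝ := fun i => 2 * y i - ι i with hy'
      have hyy' : (1 / 2 : ℝ) • y' + (1 / 2 : ℝ) • ι = y := by
        funext i; simp [hy']; ring
      have hy'Q : y' ∈ halfCube d := by
        intro i
        have h1 := hyQ i
        simp only [hy', hι]
        split_ifs with h <;> constructor <;> linarith
      have hy'L : OnLattice x' (κ + 1 + n) y' := by
        intro i
        obtain ⟨m, hm⟩ := hy i
        refine ⟨m, ?_⟩
        rw [← hm, hx', hy']
        simp only [← add_assoc, pow_succ]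
        ring
      have h1 := ih f' x' (G * ρ) hGρ hf'' P' hP' hPf' y' hy'L hy'Q
      have h2 := hcmp y' hy'Q
      rw [map_sub, hPP'', hyy'] at h2
      simp only [hf'] at h1
      rw [hyy'] at h1
      have h3 : C * (G * ρ) + C₂ * (2 * C₁ * G) ≤ C * G := by nlinarith
      rw [abs_le] at h1 h2 ⊢
      constructor <;> linarith
  refine ⟨C, hC0, fun f x G hG hf => ?_⟩
  obtain ⟨P, hP, hPf⟩ := hW f x G hG fun e he z hz hz1 hz2 =>
    (hf _ e he z hz hz1 hz2).trans (mul_le_of_le_one_right hG (hρj _))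
  exact ⟨P, hP, fun j y hy hyQ => main j f x G hG hf P hP hPf y
    (onLattice_of_le (by omega) hy) hyQ⟩

/-! ### From lattice points to almost every point. -/

theorem tendsto_lintegral_translate {d : ℕ} {h : (Fin d → ℝ) → ℝ} (hh : MemLp h 1 volume)
    {v : ℕ → Fin d → ℝ} {v₀ : Fin d → ℝ} (hv : Filter.Tendsto v Filter.atTop (nhds v₀)) :
    Filter.Tendsto (fun n => ∫⁻ x, ‖h (v n + x) - h (v₀ + x)‖ₑ) Filter.atTop (nhds 0) := by
  have : Fact ((1 : ℝ≥0∞) ≠ ∞) := ⟨by simp⟩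
  have h1 : Filter.Tendsto (fun n => DomAddAct.mk (v n) +ᵥ hh.toLp h) Filter.atTop
      (nhds (DomAddAct.mk v₀ +ᵥ hh.toLp h)) :=
    (DomAddAct.continuous_mk.tendsto v₀ |>.comp hv).vadd tendsto_const_nhds
  rw [tendsto_iff_edist_tendsto_0] at h1
  refine h1.congr fun n => ?_
  rw [DomAddAct.mk_vadd_toLp, DomAddAct.mk_vadd_toLp, Lp.edist_toLp_toLp,
    eLpNorm_one_eq_lintegral_enorm]
  rfl

/-- The dyadic rounding of a vector. -/
def dyadicFloor {d : ℕ} (n : ℕ) (v : Fin d → ℝ) : Fin d → ℝ := fun i => (⌊2 ^ n * v i⌋ : ℝ) / 2 ^ n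

theorem measurable_dyadicFloor {d : ℕ} (n : ℕ) : Measurable (dyadicFloor (d := d) n) := by
  refine measurable_pi_lambda _ fun i => ?_
  unfold dyadicFloor
  have : Measurable fun v : Fin d → ℝ => 2 ^ n * v i := by fun_prop
  exact ((Measurable.of_discrete (f := fun z : ℤ => (z : ℝ))).comp
    (Int.measurable_floor.comp this)).div_const _

theorem tendsto_dyadicFloor {d : ℕ} (v : Fin d → ℝ) :
    Filter.Tendsto (fun n => dyadicFloor n v) Filter.atTop (nhds v) := by
  rw [tendsto_pi_nhds]
  intro i
  have h0 : Filter.Tendsto (fun n : ℕ => v i - (1 / 2 : ℝ) ^ n) Filter.atTop (nhds (v i)) := by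
    have := tendsto_pow_atTop_nhds_zero_of_lt_one (r := (1 / 2 : ℝ)) (by norm_num) (by norm_num)
    simpa using this.const_sub (v i)
  refine tendsto_of_tendsto_of_tendsto_of_le_of_le h0 tendsto_const_nhds (fun n => ?_) fun n => ?_
  · have h2 : (0 : ℝ) < 2 ^ n := by positivity
    simp only [dyadicFloor, one_div, inv_pow]
    rw [le_div_iff₀ h2, sub_mul, inv_mul_cancel₀ h2.ne']
    linarith [Int.lt_floor_add_one (2 ^ n * v i)]
  · have h2 : (0 : ℝ) < 2 ^ n := by positivity
    simp only [dyadicFloor]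
    rw [div_le_iff₀ h2]
    linarith [Int.floor_le (2 ^ n * v i)]

theorem onLattice_dyadicFloor {d : ℕ} (n : ℕ) (x v : Fin d → ℝ) :
    OnLattice x n (dyadicFloor n v + x) := by
  intro i
  refine ⟨⌊2 ^ n * v i⌋, ?_⟩
  simp only [dyadicFloor, Pi.add_apply]
  field_simp
  ring

theorem ae_ae_eq_zero_of_lintegral_eq_zero {X : Type*} [MeasureSpace X] [SFinite (volume : Measure X)]
    {K : X × X → ℝ≥0∞} (hK : Measurable K) (h : ∀ v, ∫⁻ x, K (x, v) = 0) :
    ∀ᵐ x : X, ∀ᵐ v : X, K (x, v) = 0 := by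
  have h2 : ∫⁻ x, ∫⁻ v, K (x, v) = 0 := by
    rw [lintegral_lintegral_swap (f := fun x v => K (x, v)) hK.aemeasurable]
    simp [h]
  rw [lintegral_eq_zero_iff hK.lintegral_prod_right'] at h2
  filter_upwards [h2] with x hx
  exact (lintegral_eq_zero_iff (hK.comp measurable_prodMk_left)).1 hx

/-- For fixed `v = y - x` the `L_1` norm in `x` of the translation error tends to zero, so by Fatou
its lower limit vanishes for almost every `x`. Fubini exchanges the roles of `x` and `v`. A lower
limit suffices, since a single good lattice point near `y` is needed later. -/
theorem ae_ae_liminf_translate {d : ℕ} {h : (Fin d → ℝ) → ℝ} (hm : Measurable h)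
    (hh : MemLp h 1 volume) : ∀ᵐ x : Fin d → ℝ, ∀ᵐ y : Fin d → ℝ,
      Filter.liminf (fun n => ‖h (dyadicFloor n (y - x) + x) - h y‖ₑ) Filter.atTop = 0 := by
  have hmeas : Measurable fun z : (Fin d → ℝ) × (Fin d → ℝ) =>
      Filter.liminf (fun n => ‖h (dyadicFloor n z.2 + z.1) - h (z.2 + z.1)‖ₑ) Filter.atTop := by
    refine Measurable.liminf fun n => ?_
    have h1 := measurable_dyadicFloor (d := d) n
    exact ((hm.comp ((h1.comp measurable_snd).add measurable_fst)).sub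
      (hm.comp (measurable_snd.add measurable_fst))).enorm
  have h1 := ae_ae_eq_zero_of_lintegral_eq_zero hmeas fun v => by
    refine le_antisymm ?_ zero_le
    refine (lintegral_liminf_le fun n => ?_).trans ?_
    · exact ((hm.comp (measurable_const_add (dyadicFloor n v))).sub
        (hm.comp (measurable_const_add v))).enorm
    · rw [(tendsto_lintegral_translate hh (tendsto_dyadicFloor v)).liminf_eq]
  filter_upwards [h1] with x hx
  filter_upwards [(measurePreserving_sub_right volume x).quasiMeasurePreserving.ae hx] with y hy
  simpa only [sub_add_cancel] using hy

theorem measurableSet_halfCube (d : ℕ) : MeasurableSet (halfCube d) := by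
  have : halfCube d = Set.univ.pi fun _ => Set.Ico 0 1 := by
    ext; simp [halfCube]
  rw [this]
  exact MeasurableSet.univ_pi fun _ => measurableSet_Ico

theorem halfCube_ae_eq (d : ℕ) :
    halfCube d =ᵐ[volume] {y : Fin d → ℝ | ∀ i, 0 < y i ∧ y i < 1} := by
  have h1 : halfCube d = Set.univ.pi fun _ => Set.Ico 0 1 := by
    ext; simp [halfCube]
  have h2 : {y : Fin d → ℝ | ∀ i, 0 < y i ∧ y i < 1} = Set.univ.pi fun _ => Set.Ioo 0 1 := by
    ext; simp
  rw [h1, h2, volume_pi]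
  exact Measure.univ_pi_Ico_ae_eq_Icc.trans Measure.univ_pi_Ioo_ae_eq_Icc.symm

theorem volume_halfCube (d : ℕ) : volume (halfCube d) = 1 := by
  have h1 : halfCube d = Set.univ.pi fun _ => Set.Ico 0 1 := by
    ext; simp [halfCube]
  rw [h1, Real.volume_pi_Ico]
  simp

/-- For almost every `x`, a polynomial bound for `f` on the dyadic lattice points generated by `x`
holds almost everywhere. -/
theorem ae_abs_sub_eval_le {d : ℕ} {f : (Fin d → ℝ) → ℝ} (hf : Measurable f) :
    ∀ᵐ x : Fin d → ℝ, ∀ (P : MvPolynomial (Fin d) ℝ) (c : ℝ),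
      (∀ j y, OnLattice x j y → y ∈ halfCube d → |f y - MvPolynomial.eval y P| ≤ c) →
      ∀ᵐ y ∂volume.restrict (halfCube d), |f y - MvPolynomial.eval y P| ≤ c := by
  -- `f` is only measurable; the arctangent makes it bounded, hence integrable on the cube, and is
  -- undone by the tangent at the end.
  set h : (Fin d → ℝ) → ℝ := (halfCube d).indicator fun y => Real.arctan (f y) with hh
  have hm : Measurable h := (Real.measurable_arctan.comp hf).indicator (measurableSet_halfCube d)
  have hL : MemLp h 1 volume := by
    rw [hh, memLp_indicator_iff_restrict (measurableSet_halfCube d)]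
    have : IsFiniteMeasure (volume.restrict (halfCube d)) :=
      ⟨by rw [Measure.restrict_apply_univ, volume_halfCube]; simp⟩
    refine MemLp.of_bound (Real.measurable_arctan.comp hf).aestronglyMeasurable (Real.pi / 2)
      (Filter.Eventually.of_forall fun y => ?_)
    rw [Real.norm_eq_abs, abs_le]
    exact ⟨(Real.neg_pi_div_two_lt_arctan _).le, (Real.arctan_lt_pi_div_two _).le⟩
  filter_upwards [ae_ae_liminf_translate hm hL] with x hx P c hP
  rw [Measure.restrict_congr_set (halfCube_ae_eq d)]
  have hopen : IsOpen {y : Fin d → ℝ | ∀ i, 0 < y i ∧ y i < 1} := by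
    have h2 : {y : Fin d → ℝ | ∀ i, 0 < y i ∧ y i < 1} = Set.univ.pi fun _ => Set.Ioo 0 1 := by
      ext; simp
    rw [h2]
    exact isOpen_set_pi Set.finite_univ fun _ _ => isOpen_Ioo
  have hsub : ∀ y ∈ {y : Fin d → ℝ | ∀ i, 0 < y i ∧ y i < 1}, y ∈ halfCube d :=
    fun y hy i => ⟨(hy i).1.le, (hy i).2⟩
  filter_upwards [ae_restrict_of_ae hx, ae_restrict_mem hopen.measurableSet] with y hy hyQ
  -- If the bound fails at `y`, it fails for every argument near `y` and every value near `f y`.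
  -- Some lattice point `dyadicFloor n (y - x) + x` has both properties, against the hypothesis.
  by_contra! hlt
  have hcont : ContinuousAt (fun p : ℝ × (Fin d → ℝ) => |Real.tan p.1 - MvPolynomial.eval p.2 P|)
      (Real.arctan (f y), y) := by
    refine ContinuousAt.abs (ContinuousAt.sub ?_ ?_)
    · exact ContinuousAt.comp (g := Real.tan) (f := Prod.fst)
        (Real.continuousAt_tan.2 (Real.cos_arctan_pos _).ne') continuousAt_fst
    · exact (MvPolynomial.continuous_eval P).continuousAt.comp continuousAt_snd
  have hev := hcont.eventually (lt_mem_nhds (by simpa [Real.tan_arctan] using hlt))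
  rw [nhds_prod_eq, Filter.eventually_prod_iff] at hev
  obtain ⟨pa, hpa, pb, hpb, hab⟩ := hev
  obtain ⟨ε, hε, hεpa⟩ := Metric.eventually_nhds_iff.1 hpa
  have hfreq : ∃ᶠ n in Filter.atTop,
      ‖h (dyadicFloor n (y - x) + x) - h y‖ₑ < ENNReal.ofReal ε := by
    refine Filter.frequently_lt_of_liminf_lt ?_ ?_
    · isBoundedDefault
    · rw [hy]; simpa using hε
  have hyn : Filter.Tendsto (fun n => dyadicFloor n (y - x) + x) Filter.atTop (nhds y) := by
    simpa using (tendsto_dyadicFloor (y - x)).add_const x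
  obtain ⟨n, hn1, hn2, hn3⟩ := (hfreq.and_eventually
    ((hyn.eventually hpb).and (hyn.eventually (hopen.mem_nhds hyQ)))).exists
  have h1 := hP n _ (onLattice_dyadicFloor n x (y - x)) (hsub _ hn3)
  have h2 : h y = Real.arctan (f y) := Set.indicator_of_mem (hsub _ hyQ) _
  have h3 : h (dyadicFloor n (y - x) + x) = Real.arctan (f (dyadicFloor n (y - x) + x)) :=
    Set.indicator_of_mem (hsub _ hn3) _
  rw [h2, h3, ← ofReal_norm, ENNReal.ofReal_lt_ofReal_iff hε, ← dist_eq_norm] at hn1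
  have h4 := hab (hεpa hn1) hn2
  simp only [Real.tan_arctan] at h4
  linarith

/-! ### Choice of the base point of the lattice by averaging. -/

/-- The weighted sum of the `L_q` norms of the dyadic differences of `f` on the unit cube. -/
def diffSum {d : ℕ} (r : ℕ) (q ρ : ℝ) (f : (Fin d → ℝ) → ℝ) : ℝ≥0∞ :=
  ∑' j : ℕ, (2 ^ d * ENNReal.ofReal (ρ ^ (-q))) ^ j *
    ∑ e ∈ Fintype.piFinset fun _ : Fin d => range r,
      ∫⁻ y in {y | y ∈ halfCube d ∧ y + (r : ℝ) • dyadicStep j e ∈ halfCube d},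
        ‖(fwdDiff (dyadicStep j e))^[r] f y‖ₑ ^ q

theorem measurable_fwdDiff_iter {V : Type*} [AddCommMonoid V] [MeasurableSpace V] [MeasurableAdd V]
    {f : V → ℝ} (hf : Measurable f) (h : V) (r : ℕ) : Measurable ((fwdDiff h)^[r] f) := by
  induction r with
  | zero => exact hf
  | succ r ih =>
    rw [Function.iterate_succ_apply']
    exact (ih.comp (measurable_add_const h)).sub ih

/-- Local polynomial approximation in the uniform norm, in terms of dyadic differences. -/
theorem exists_polynomial_near_of_diffSum {d r : ℕ} (hr : 2 ≤ r) {q ρ : ℝ} (hq : 0 < q)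
    (hρ0 : 0 < ρ) (hρ1 : ρ < 1) :
    ∃ C : ℝ, 0 ≤ C ∧ ∀ f : (Fin d → ℝ) → ℝ, Measurable f → diffSum r q ρ f ≠ ∞ →
      ∃ P : MvPolynomial (Fin d) ℝ, P.totalDegree < r ∧
        ∀ᵐ y ∂volume.restrict (halfCube d),
          |f y - MvPolynomial.eval y P| ≤ C * (diffSum r q ρ f).toReal ^ (1 / q) := by
  obtain ⟨C, hC, hdy⟩ := exists_polynomial_near_on_dyadic (d := d) hr hρ0 hρ1
  refine ⟨C * (2 ^ d) ^ (1 / q), by positivity, fun f hf hN => ?_⟩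
  set A : ℕ → (Fin d → ℕ) → Set (Fin d → ℝ) := fun j e =>
    {y | y ∈ halfCube d ∧ y + (r : ℝ) • dyadicStep j e ∈ halfCube d} with hA
  have hAm : ∀ j e, MeasurableSet (A j e) := fun j e =>
    (measurableSet_halfCube d).inter (measurable_add_const _ (measurableSet_halfCube d))
  set D : ℕ → (Fin d → ℕ) → (Fin d → ℝ) → ℝ≥0∞ := fun j e =>
    (A j e).indicator fun y => ‖(fwdDiff (dyadicStep j e))^[r] f y‖ₑ ^ q with hD
  have hDm : ∀ j e, Measurable (D j e) := fun j e =>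
    ((measurable_fwdDiff_iter hf _ r).enorm.pow_const q).indicator (hAm j e)
  set w : ℝ≥0∞ := ENNReal.ofReal (ρ ^ (-q)) with hw
  -- For `x` and `y` in `[0,1)^d`, a difference `y - x = 2^{-j} m` forces `-2^j ≤ m i < 2^j`. The
  -- number of such `m` is `2^d (2^d)^j`, which accounts for the factor `(2^d)^j` in `diffSum`.
  set box : ℕ → Finset (Fin d → ℤ) := fun j =>
    Fintype.piFinset fun _ => Finset.Ico (-2 ^ j) (2 ^ j) with hbox
  set E := Fintype.piFinset fun _ : Fin d => range r with hE
  set sh : ℕ → (Fin d → ℤ) → (Fin d → ℝ) := fun j m i => (m i : ℝ) / 2 ^ j with hsh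
  set Φ : (Fin d → ℝ) → ℝ≥0∞ := fun x =>
    ∑' j : ℕ, w ^ j * ∑ e ∈ E, ∑ m ∈ box j, D j e (x + sh j m) with hΦ
  have hDsh : ∀ j e m, Measurable fun x => D j e (x + sh j m) := fun j e m =>
    (hDm j e).comp (measurable_add_const _)
  have hΦ1 : ∀ j, Measurable fun x => ∑ e ∈ E, ∑ m ∈ box j, D j e (x + sh j m) := fun j =>
    Finset.measurable_fun_sum _ fun e _ => Finset.measurable_fun_sum _ fun m _ => hDsh j e m
  have hΦm : Measurable Φ := Measurable.tsum fun j => (hΦ1 j).const_mul _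
  have hint : ∫⁻ x, Φ x = 2 ^ d * diffSum r q ρ f := by
    rw [hΦ, lintegral_tsum fun j => ((hΦ1 j).const_mul _).aemeasurable, diffSum,
      ← ENNReal.tsum_mul_left]
    refine tsum_congr fun j => ?_
    rw [lintegral_const_mul _ (hΦ1 j), lintegral_finsetSum _ fun e _ =>
      Finset.measurable_fun_sum _ fun m _ => hDsh j e m]
    have h1 : ∀ e ∈ E, ∫⁻ x, ∑ m ∈ box j, D j e (x + sh j m) =
        (2 ^ d * (2 ^ d) ^ j) * ∫⁻ y in A j e, ‖(fwdDiff (dyadicStep j e))^[r] f y‖ₑ ^ q := by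
      intro e _
      rw [lintegral_finsetSum _ fun m _ => hDsh j e m]
      simp only [lintegral_add_right_eq_self (D j e)]
      rw [sum_const, hD, lintegral_indicator (hAm j e), nsmul_eq_mul]
      congr 1
      rw [hbox, Fintype.card_piFinset]
      simp only [Int.card_Ico, sub_neg_eq_add, prod_const, card_univ, Fintype.card_fin]
      have : ((2 : ℤ) ^ j + 2 ^ j).toNat = 2 * 2 ^ j := by
        have : (2 : ℤ) ^ j + 2 ^ j = ((2 * 2 ^ j : ℕ) : ℤ) := by push_cast; ring
        rw [this, Int.toNat_natCast]
      rw [this]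
      push_cast
      rw [mul_pow, ← pow_mul, ← pow_mul, mul_comm j d]
    rw [sum_congr rfl h1, ← mul_sum, mul_pow]
    ring
  have hprob : IsProbabilityMeasure (volume.restrict (halfCube d)) :=
    ⟨by rw [Measure.restrict_apply_univ, volume_halfCube]⟩
  -- On a probability space some point outside a given null set has value at most the mean. The null
  -- set collects the `x` for which the passage to almost every `y` fails.
  obtain ⟨x, hxN, hx⟩ := exists_notMem_null_le_lintegral (μ := volume.restrict (halfCube d))
    hΦm.aemeasurable (ae_iff.1 ((ae_restrict_of_ae (ae_abs_sub_eval_le hf)).and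
      (ae_restrict_mem (measurableSet_halfCube d))))
  simp only [Set.mem_ofPred_eq, not_not] at hxN
  obtain ⟨hxP, hxQ⟩ := hxN
  have hxle : Φ x ≤ 2 ^ d * diffSum r q ρ f :=
    hx.trans ((setLIntegral_le_lintegral _ _).trans hint.le)
  have hfin : 2 ^ d * diffSum r q ρ f ≠ ∞ := ENNReal.mul_ne_top (by simp) hN
  set G : ℝ := (2 ^ d * diffSum r q ρ f).toReal ^ (1 / q) with hG
  have hG0 : 0 ≤ G := by positivity
  have hGeq : G = (2 ^ d) ^ (1 / q) * (diffSum r q ρ f).toReal ^ (1 / q) := by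
    rw [hG, ENNReal.toReal_mul, Real.mul_rpow (by positivity) (by positivity)]
    simp
  obtain ⟨P, hP, hPf⟩ := hdy f x G hG0 (by
    intro j e he y hy hyQ hyQ'
    choose m hm using hy
    have hyx : y = x + sh j m := by
      funext i
      simp only [hsh, Pi.add_apply, ← hm]
      field_simp
      ring
    have hmbox : m ∈ box j := by
      refine Fintype.mem_piFinset.2 fun i => Finset.mem_Ico.2 ?_
      have h2 : (0 : ℝ) < 2 ^ j := by positivity
      have h3 := hyQ i
      have h4 := hxQ i
      have h5 := hm i
      constructor
      · have : ((-2 ^ j : ℤ) : ℝ) ≤ m i := by push_cast; rw [← h5]; nlinarith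
        exact_mod_cast this
      · have : (m i : ℝ) < ((2 ^ j : ℤ) : ℝ) := by push_cast; rw [← h5]; nlinarith
        exact_mod_cast this
    -- Each individual difference is one term of `Φ x`; the weight `w ^ j = ρ^(-q j)` then yields
    -- the decay `G ρ^j`.
    have h1 : w ^ j * D j e y ≤ Φ x := by
      refine le_trans ?_ (ENNReal.le_tsum j)
      gcongr
      refine le_trans ?_ (single_le_sum (f := fun e => ∑ m ∈ box j, D j e (x + sh j m))
        (fun _ _ => zero_le) (Fintype.mem_piFinset.2 fun i => mem_range.2 (he i)))
      rw [hyx]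
      exact single_le_sum (f := fun m => D j e (x + sh j m)) (fun _ _ => zero_le) hmbox
    have hDy : D j e y = ENNReal.ofReal (|(fwdDiff (dyadicStep j e))^[r] f y| ^ q) := by
      rw [hD]
      simp only
      rw [Set.indicator_of_mem (show y ∈ A j e from ⟨hyQ, hyQ'⟩), ← ofReal_norm, Real.norm_eq_abs,
        ENNReal.ofReal_rpow_of_nonneg (abs_nonneg _) hq.le]
    rw [hDy, hw, ← ENNReal.ofReal_pow (by positivity), ← ENNReal.ofReal_mul (by positivity)] at h1
    have h2 := (ENNReal.ofReal_le_iff_le_toReal hfin).1 (h1.trans hxle)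
    have h3 := Real.rpow_le_rpow (by positivity) h2 (show 0 ≤ 1 / q by positivity)
    rw [← hG, Real.mul_rpow (by positivity) (by positivity), ← Real.rpow_mul (abs_nonneg _),
      mul_one_div_cancel hq.ne', Real.rpow_one, ← Real.rpow_natCast, ← Real.rpow_mul hρ0.le,
      ← Real.rpow_mul hρ0.le] at h3
    have h4 : -q * (j : ℝ) * (1 / q) = -(j : ℝ) := by field_simp
    rw [h4, Real.rpow_neg hρ0.le, Real.rpow_natCast] at h3
    have h5 : 0 < ρ ^ j := by positivity
    rw [inv_mul_le_iff₀ h5] at h3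
    linarith)
  refine ⟨P, hP, ?_⟩
  have := hxP P (C * G) hPf
  rw [hGeq, ← mul_assoc] at this
  exact this

/-! ### Differences on the open cube and rescaling to cells. -/

theorem rDiff_eq_fwdDiff_iter {d : ℕ} (r : ℕ) (h : EuclideanSpace ℝ (Fin d))
    (f : EuclideanSpace ℝ (Fin d) → ℝ) : rDiff r h f = (fwdDiff h)^[r] f := by
  funext x
  rw [rDiff, fwdDiff_iter_eq_sum_shift, mul_sum]
  refine sum_congr rfl fun k hk => ?_
  have hk : k ≤ r := by simp at hk; omega
  have h1 : (-1 : ℝ) ^ r * (-1) ^ k = (-1) ^ (r - k) := by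
    obtain ⟨n, rfl⟩ := Nat.exists_eq_add_of_le hk
    rw [Nat.add_sub_cancel_left, ← pow_add, show k + n + k = 2 * k + n by ring, pow_add, pow_mul]
    simp
  rw [← Nat.cast_smul_eq_nsmul ℝ k h, zsmul_eq_mul]
  push_cast
  rw [← h1]
  ring

theorem convex_openCube (d : ℕ) : Convex ℝ (openCube d) := by
  intro x hx y hy a b ha hb hab i
  have h1 := hx i
  have h2 := hy i
  simp only [PiLp.add_apply, PiLp.smul_apply, smul_eq_mul]
  obtain rfl : b = 1 - a := by linarith
  constructor
  · rcases ha.eq_or_lt with rfl | ha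
    · simpa using h2.1
    · nlinarith [mul_pos ha h1.1, mul_nonneg hb h2.1.le]
  · rcases ha.eq_or_lt with rfl | ha
    · simpa using h2.2
    · nlinarith [mul_pos ha (sub_pos.2 h1.2), mul_nonneg hb (sub_pos.2 h2.2).le]

theorem mem_shrunkCube {d : ℕ} {h x : EuclideanSpace ℝ (Fin d)} :
    x ∈ shrunkCube h ↔ x ∈ openCube d ∧ x + h ∈ openCube d :=
  ⟨fun hx => ⟨hx.1, hx.2 (right_mem_segment ℝ _ _)⟩,
    fun hx => ⟨hx.1, (convex_openCube d).segment_subset hx.1 hx.2⟩⟩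

theorem isOpen_openCube (d : ℕ) : IsOpen (openCube d) := by
  have : openCube d = ⋂ i, {x | 0 < x i ∧ x i < 1} := by ext; simp [openCube]
  rw [this]
  refine isOpen_iInter_of_finite fun i => ?_
  have h : Continuous fun x : EuclideanSpace ℝ (Fin d) => x i := by fun_prop
  exact (isOpen_lt continuous_const h).inter (isOpen_lt h continuous_const)

theorem measurableSet_shrunkCube {d : ℕ} (h : EuclideanSpace ℝ (Fin d)) :
    MeasurableSet (shrunkCube h) := by
  have : shrunkCube h = openCube d ∩ (fun x => x + h) ⁻¹' openCube d := by
    ext; exact mem_shrunkCube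
  rw [this]
  exact (isOpen_openCube d).measurableSet.inter
    (measurable_add_const h (isOpen_openCube d).measurableSet)

/-- All points `x + k h` with `k ≤ r` lie on the segment from `x` to `x + r h`, hence in the cube,
and translations preserve null sets. -/
theorem rDiff_ae_eq {d r : ℕ} {f g : EuclideanSpace ℝ (Fin d) → ℝ} (hfg : f =ᵐ[cubeMeasure d] g)
    (h : EuclideanSpace ℝ (Fin d)) :
    rDiff r h f =ᵐ[volume.restrict (shrunkCube ((r : ℝ) • h))] rDiff r h g := by
  have h1 : ∀ᵐ x ∂volume, x ∈ openCube d → f x = g x :=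
    (ae_restrict_iff' (isOpen_openCube d).measurableSet).1 hfg
  have h2 : ∀ᵐ x ∂volume, ∀ k ∈ range (r + 1), x + (k : ℝ) • h ∈ openCube d →
      f (x + (k : ℝ) • h) = g (x + (k : ℝ) • h) := by
    rw [Filter.eventually_all_finset]
    intro k _
    exact (measurePreserving_add_right volume ((k : ℝ) • h)).quasiMeasurePreserving.ae h1
  refine (ae_restrict_iff' (measurableSet_shrunkCube _)).2 ?_
  filter_upwards [h2] with x hx hxs
  rw [rDiff, rDiff]
  congr 1
  refine sum_congr rfl fun k hk => ?_
  rw [hx k hk (hxs.2 ?_)]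
  rw [segment_eq_image']
  rcases Nat.eq_zero_or_pos r with rfl | hr
  · have : k = 0 := by simpa using hk
    exact ⟨0, by simp, by simp [this]⟩
  · have hr' : (0 : ℝ) < r := by exact_mod_cast hr
    have hk' : (k : ℝ) ≤ r := by
      have : k ≤ r := by simp at hk; omega
      exact_mod_cast this
    refine ⟨(k : ℝ) / r, ⟨by positivity, (div_le_one hr').2 hk'⟩, ?_⟩
    simp only [add_sub_cancel_left, smul_smul]
    rw [div_mul_cancel₀ _ hr'.ne']

/-- The half-open cube with corner `c` and side length `2^{-k}`. -/
def cell {d : ℕ} (c : Fin d → ℝ) (k : ℕ) : Set (EuclideanSpace ℝ (Fin d)) :=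
  {x | ∀ i, 0 ≤ 2 ^ k * (x i - c i) ∧ 2 ^ k * (x i - c i) < 1}

/-- The affine map of the unit cube onto a cell. -/
def cellMap {d : ℕ} (c : Fin d → ℝ) (k : ℕ) (y : Fin d → ℝ) : EuclideanSpace ℝ (Fin d) :=
  WithLp.toLp 2 (((2 : ℝ) ^ k)⁻¹ • y + c)

theorem cellMap_mem_cell {d : ℕ} {c : Fin d → ℝ} {k : ℕ} {y : Fin d → ℝ} :
    cellMap c k y ∈ cell c k ↔ y ∈ halfCube d := by
  have h2 : (2 : ℝ) ^ k ≠ 0 := by positivity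
  simp [cellMap, cell, halfCube, h2]

theorem measurable_cellMap {d : ℕ} (c : Fin d → ℝ) (k : ℕ) : Measurable (cellMap c k) := by
  have h : Continuous (cellMap c k) :=
    (PiLp.continuous_toLp 2 _).comp ((continuous_const_smul _).add continuous_const)
  exact h.measurable

theorem measurableSet_cell {d : ℕ} (c : Fin d → ℝ) (k : ℕ) : MeasurableSet (cell c k) := by
  have : cell c k = ⋂ i, {x | 0 ≤ 2 ^ k * (x i - c i) ∧ 2 ^ k * (x i - c i) < 1} := by
    ext; simp [cell]
  rw [this]
  refine MeasurableSet.iInter fun i => ?_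
  have h : Measurable fun x : EuclideanSpace ℝ (Fin d) => 2 ^ k * (x i - c i) := by fun_prop
  exact (measurableSet_le measurable_const h).inter (measurableSet_lt h measurable_const)

theorem lintegral_cellMap {d : ℕ} (c : Fin d → ℝ) (k : ℕ)
    {g : EuclideanSpace ℝ (Fin d) → ℝ≥0∞} (hg : Measurable g) :
    ∫⁻ y, g (cellMap c k y) = (2 ^ d) ^ k * ∫⁻ x, g x := by
  have h2 : (0 : ℝ) < 2 ^ k := by positivity
  have hm : Measurable fun y : Fin d → ℝ => g (WithLp.toLp 2 (y + c)) :=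
    hg.comp ((PiLp.volume_preserving_toLp (Fin d)).measurable.comp (measurable_add_const c))
  have h1 : ∫⁻ y, g (cellMap c k y) = ∫⁻ y, g (WithLp.toLp 2 (y + c))
      ∂(Measure.map (((2 : ℝ) ^ k)⁻¹ • ·) (volume : Measure (Fin d → ℝ))) := by
    rw [lintegral_map hm (measurable_const_smul _)]
    rfl
  rw [h1, Measure.map_addHaar_smul _ (inv_ne_zero h2.ne'), lintegral_smul_measure,
    lintegral_add_right_eq_self (fun y : Fin d → ℝ => g (WithLp.toLp 2 y)),
    (PiLp.volume_preserving_toLp (Fin d)).lintegral_comp hg]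
  rw [smul_eq_mul]
  congr 1
  rw [Module.finrank_fin_fun, inv_pow, inv_inv, abs_of_pos (by positivity),
    ENNReal.ofReal_pow (by positivity), ENNReal.ofReal_pow (by positivity)]
  simp [← pow_mul, mul_comm]

theorem ae_of_ae_cellMap {d : ℕ} (c : Fin d → ℝ) (k : ℕ) {S : Set (EuclideanSpace ℝ (Fin d))}
    (hS : MeasurableSet S) (h : ∀ᵐ y, cellMap c k y ∈ S) : ∀ᵐ x, x ∈ S := by
  have h1 := lintegral_cellMap c k (g := Sᶜ.indicator 1) (measurable_one.indicator hS.compl)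
  have h2 : ∫⁻ y, Sᶜ.indicator 1 (cellMap c k y) = (0 : ℝ≥0∞) := by
    rw [lintegral_congr_ae (g := fun _ => 0), lintegral_zero]
    filter_upwards [h] with y hy
    exact Set.indicator_of_notMem (show cellMap c k y ∉ Sᶜ from fun h => h hy) _
  rw [h2, lintegral_indicator_one hS.compl] at h1
  change S ∈ ae volume
  rw [mem_ae_iff]
  simpa using h1.symm

/-- The dyadic step as a Euclidean vector. -/
def euclStep {d : ℕ} (j : ℕ) (e : Fin d → ℕ) : EuclideanSpace ℝ (Fin d) :=
  WithLp.toLp 2 (dyadicStep j e)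

theorem norm_euclStep_le {d r : ℕ} (j : ℕ) {e : Fin d → ℕ} (he : ∀ i, e i < r) :
    ‖euclStep j e‖ ≤ r * d * (1 / 2) ^ j := by
  have h1 : ‖euclStep j e‖ ≤ ∑ i, ‖(euclStep j e) i‖ := by
    have := norm_sum_le univ fun i => EuclideanSpace.single i ((euclStep j e) i)
    simp only [PiLp.norm_single] at this
    refine le_trans (le_of_eq ?_) this
    congr 1
    ext i
    simp
  refine h1.trans ?_
  have h2 : ∀ i ∈ (univ : Finset (Fin d)), ‖(euclStep j e) i‖ ≤ r * (1 / 2) ^ j := by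
    intro i _
    simp only [euclStep, dyadicStep]
    rw [Real.norm_of_nonneg (by positivity), div_eq_mul_inv, one_div, inv_pow]
    have : (e i : ℝ) ≤ r := by exact_mod_cast (he i).le
    gcongr
  refine (sum_le_sum h2).trans (le_of_eq ?_)
  simp
  ring

/-- The weighted sum of the `L_q` norms of the dyadic differences of `f` on a cell. -/
def cellSum {d : ℕ} (r : ℕ) (q ρ : ℝ) (f : EuclideanSpace ℝ (Fin d) → ℝ) (c : Fin d → ℝ)
    (k : ℕ) : ℝ≥0∞ :=
  ∑' j : ℕ, (2 ^ d * ENNReal.ofReal (ρ ^ (-q))) ^ j *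
    ∑ e ∈ Fintype.piFinset fun _ : Fin d => range r,
      (2 ^ d) ^ k * ∫⁻ x in {x | x ∈ cell c k ∧ x + (r : ℝ) • euclStep (j + k) e ∈ cell c k},
        ‖rDiff r (euclStep (j + k) e) f x‖ₑ ^ q

theorem cellMap_add_step {d : ℕ} (c : Fin d → ℝ) (k j : ℕ) (a : ℝ) (e : Fin d → ℕ) (y : Fin d → ℝ) :
    cellMap c k (y + a • dyadicStep j e) = cellMap c k y + a • euclStep (j + k) e := by
  ext i
  simp only [cellMap, euclStep, dyadicStep, PiLp.add_apply, PiLp.smul_apply, smul_eq_mul,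
    Pi.add_apply, Pi.smul_apply, pow_add]
  field_simp
  ring

theorem measurableSet_cell_inter {d : ℕ} (c : Fin d → ℝ) (k : ℕ) (h : EuclideanSpace ℝ (Fin d)) :
    MeasurableSet {x | x ∈ cell c k ∧ x + h ∈ cell c k} :=
  (measurableSet_cell c k).inter (measurable_add_const h (measurableSet_cell c k))

/-- The change of variables produces the factor `2^{dk}` and turns steps of level `j` into steps of
level `j + k`. -/
theorem diffSum_comp_cellMap {d : ℕ} (r : ℕ) (q ρ : ℝ) {f : EuclideanSpace ℝ (Fin d) → ℝ}
    (hf : Measurable f) (c : Fin d → ℝ) (k : ℕ) :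
    diffSum r q ρ (fun y => f (cellMap c k y)) = cellSum r q ρ f c k := by
  unfold diffSum cellSum
  refine tsum_congr fun j => ?_
  congr 1
  refine sum_congr rfl fun e _ => ?_
  have hm := measurableSet_cell_inter c k ((r : ℝ) • euclStep (j + k) e)
  have hfm : Measurable fun x => ‖rDiff r (euclStep (j + k) e) f x‖ₑ ^ q := by
    rw [rDiff_eq_fwdDiff_iter]
    exact (measurable_fwdDiff_iter hf _ r).enorm.pow_const q
  rw [← lintegral_indicator hm, ← lintegral_cellMap c k (hfm.indicator hm), ← lintegral_indicator]
  · refine lintegral_congr fun y => ?_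
    have hiff : (cellMap c k y ∈ cell c k ∧
        cellMap c k y + (r : ℝ) • euclStep (j + k) e ∈ cell c k) ↔
        (y ∈ halfCube d ∧ y + (r : ℝ) • dyadicStep j e ∈ halfCube d) := by
      rw [← cellMap_add_step, cellMap_mem_cell, cellMap_mem_cell]
    classical
    rw [Set.indicator_apply, Set.indicator_apply]
    refine if_congr hiff.symm ?_ rfl
    congr 2
    rw [rDiff_eq_fwdDiff_iter, fwdDiff_iter_eq_sum_shift, fwdDiff_iter_eq_sum_shift]
    refine sum_congr rfl fun l _ => ?_
    rw [← Nat.cast_smul_eq_nsmul ℝ l (dyadicStep j e), cellMap_add_step, Nat.cast_smul_eq_nsmul]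
  · exact (measurableSet_halfCube d).inter (measurable_add_const _ (measurableSet_halfCube d))

/-- Local polynomial approximation on cells. -/
theorem exists_polynomial_near_on_cell {d r : ℕ} (hr : 2 ≤ r) {q ρ : ℝ} (hq : 0 < q)
    (hρ0 : 0 < ρ) (hρ1 : ρ < 1) :
    ∃ C : ℝ, 0 ≤ C ∧ ∀ f : EuclideanSpace ℝ (Fin d) → ℝ, Measurable f → ∀ c k,
      cellSum r q ρ f c k ≠ ∞ →
      ∃ P : MvPolynomial (Fin d) ℝ, P.totalDegree < r ∧ ∀ᵐ x, x ∈ cell c k →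
        |f x - MvPolynomial.eval x.ofLp P| ≤ C * (cellSum r q ρ f c k).toReal ^ (1 / q) := by
  obtain ⟨C, hC, h⟩ := exists_polynomial_near_of_diffSum (d := d) hr hq hρ0 hρ1
  refine ⟨C, hC, fun f hf c k hN => ?_⟩
  rw [← diffSum_comp_cellMap r q ρ hf] at hN ⊢
  obtain ⟨P, hP, hPf⟩ := h (fun y => f (cellMap c k y)) (hf.comp (measurable_cellMap c k)) hN
  obtain ⟨P', hP', hPP'⟩ := exists_affine_substitution P hP (2 ^ k) (-((2 : ℝ) ^ k) • c)
  set b := C * (diffSum r q ρ fun y => f (cellMap c k y)).toReal ^ (1 / q)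
  have h1 : Measurable fun x : EuclideanSpace ℝ (Fin d) =>
      |f x - MvPolynomial.eval x.ofLp P'| := by
    have : Continuous fun x : EuclideanSpace ℝ (Fin d) => MvPolynomial.eval x.ofLp P' :=
      (MvPolynomial.continuous_eval P').comp (PiLp.continuous_ofLp 2 _)
    exact (hf.sub this.measurable).abs
  have h2 : ∀ᵐ x, x ∈ (cell c k)ᶜ ∪ {x | |f x - MvPolynomial.eval x.ofLp P'| ≤ b} := by
    refine ae_of_ae_cellMap c k ((measurableSet_cell c k).compl.union
      (measurableSet_le h1 measurable_const)) ?_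
    filter_upwards [(ae_restrict_iff' (measurableSet_halfCube d)).1 hPf] with y hy
    by_cases hyc : y ∈ halfCube d
    · refine Or.inr ?_
      have h3 := hy hyc
      have h4 : MvPolynomial.eval (cellMap c k y).ofLp P' = MvPolynomial.eval y P := by
        rw [hPP']
        congr 2
        funext i
        have h2 : (2 : ℝ) ^ k ≠ 0 := by positivity
        simp [cellMap]
      rw [Set.mem_ofPred_eq, h4]
      exact h3
    · exact Or.inl fun h => hyc (cellMap_mem_cell.1 h)
  refine ⟨P', hP', ?_⟩
  filter_upwards [h2] with x hx hxc
  exact hx.resolve_left fun h => h hxc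

/-! ### Bounds for the cell sums by differences on the whole cube. -/

/-- The cell with corner `c` and side length `2^{-k}` lies in the unit cube. -/
def CellInCube {d : ℕ} (c : Fin d → ℝ) (k : ℕ) : Prop := ∀ i, 0 ≤ c i ∧ c i + ((2 : ℝ) ^ k)⁻¹ ≤ 1

theorem ae_apply_ne_zero (d : ℕ) : ∀ᵐ x : EuclideanSpace ℝ (Fin d), ∀ i, x i ≠ 0 := by
  rw [ae_all_iff]
  intro i
  have hm : MeasurableSet {x : EuclideanSpace ℝ (Fin d) | x i ≠ 0} := by
    have h : Continuous fun x : EuclideanSpace ℝ (Fin d) => x i := by fun_prop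
    exact (isOpen_ne_fun h continuous_const).measurableSet
  refine ae_of_ae_cellMap 0 0 hm ?_
  have := Measure.ae_eval_ne (μ := fun _ : Fin d => (volume : Measure ℝ)) i 0
  rw [← volume_pi] at this
  filter_upwards [this] with y hy
  have h : cellMap 0 0 y = WithLp.toLp 2 y := by simp [cellMap]
  rw [h]
  exact hy

theorem lt_one_of_mem_cell {d : ℕ} {c : Fin d → ℝ} {k : ℕ} (hc : CellInCube c k)
    {x : EuclideanSpace ℝ (Fin d)} (hx : x ∈ cell c k) (i : Fin d) : 0 ≤ x i ∧ x i < 1 := by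
  have h1 := hc i
  have h2 := hx i
  have h3 : (0 : ℝ) < 2 ^ k := by positivity
  have h4 : 0 ≤ x i - c i := nonneg_of_mul_nonneg_right h2.1 h3
  have h5 : x i - c i < (2 ^ k)⁻¹ := by
    rw [← one_div, lt_div_iff₀' h3]
    exact h2.2
  constructor <;> linarith

/-- The half-open cell may touch the coordinate hyperplanes, which are not in the open cube; this is
a null set. A nonnegative step keeps the coordinates positive. -/
theorem ae_mem_shrunkCube {d : ℕ} {c : Fin d → ℝ} {k : ℕ} (hc : CellInCube c k)
    {h : EuclideanSpace ℝ (Fin d)} (hh : ∀ i, 0 ≤ h i) :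
    ∀ᵐ x, x ∈ {x | x ∈ cell c k ∧ x + h ∈ cell c k} → x ∈ shrunkCube h := by
  filter_upwards [ae_apply_ne_zero d] with x hx hxc
  refine mem_shrunkCube.2 ⟨fun i => ?_, fun i => ?_⟩
  · have h1 := lt_one_of_mem_cell hc hxc.1 i
    exact ⟨lt_of_le_of_ne h1.1 (hx i).symm, h1.2⟩
  · have h1 := lt_one_of_mem_cell hc hxc.1 i
    have h2 := lt_one_of_mem_cell hc hxc.2 i
    refine ⟨?_, h2.2⟩
    have := lt_of_le_of_ne h1.1 (hx i).symm
    simp only [PiLp.add_apply]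
    linarith [hh i]

/-- The constant in the bounds for `cellSum`. -/
def cellConst (d r : ℕ) (q ρ : ℝ) (θ : ℝ≥0∞) : ℝ≥0∞ :=
  (r : ℝ≥0∞) ^ d * ∑' j : ℕ, (2 ^ d * ENNReal.ofReal (ρ ^ (-q)) * θ) ^ j

/-- The cells are disjoint, so their integrals add up to at most the integral over `Ω_{rh}`: the sum
obeys the same bound as a single cell. The factor `(2^d θ)^k` combines the rescaling with the `k`
levels by which the differences are refined. -/
theorem sum_cellSum_le {d r : ℕ} {q ρ : ℝ} {f : EuclideanSpace ℝ (Fin d) → ℝ} {B θ : ℝ≥0∞}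
    (hD : ∀ (j : ℕ) (e : Fin d → ℕ), (∀ i, e i < r) →
      ∫⁻ x in shrunkCube ((r : ℝ) • euclStep j e), ‖rDiff r (euclStep j e) f x‖ₑ ^ q ≤ B * θ ^ j)
    {ι : Type*} [Fintype ι] (c : ι → Fin d → ℝ) (k : ℕ) (hc : ∀ a, CellInCube (c a) k)
    (hdisj : Pairwise fun a b => Disjoint (cell (c a) k) (cell (c b) k)) :
    ∑ a, cellSum r q ρ f (c a) k ≤ cellConst d r q ρ θ * (B * (2 ^ d * θ) ^ k) := by
  have key : ∀ (j : ℕ) (e : Fin d → ℕ), (∀ i, e i < r) →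
      ∑ a, ∫⁻ x in {x | x ∈ cell (c a) k ∧ x + (r : ℝ) • euclStep (j + k) e ∈ cell (c a) k},
        ‖rDiff r (euclStep (j + k) e) f x‖ₑ ^ q ≤ B * θ ^ (j + k) := by
    intro j e he
    refine le_trans ?_ (hD (j + k) e he)
    rw [← tsum_fintype (L := .unconditional _), ← lintegral_iUnion]
    · refine lintegral_mono_set' ?_
      have h1 : ∀ᵐ x, ∀ a, x ∈ {x | x ∈ cell (c a) k ∧
          x + (r : ℝ) • euclStep (j + k) e ∈ cell (c a) k} →
          x ∈ shrunkCube ((r : ℝ) • euclStep (j + k) e) := by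
        rw [ae_all_iff]
        refine fun a => ae_mem_shrunkCube (hc a) fun i => ?_
        simp only [euclStep, dyadicStep, PiLp.smul_apply, smul_eq_mul]
        positivity
      filter_upwards [h1] with x hx hxU
      obtain ⟨a, ha⟩ := Set.mem_iUnion.1 hxU
      exact hx a ha
    · exact fun a => measurableSet_cell_inter _ _ _
    · exact fun a b hab => (hdisj hab).mono (fun x hx => hx.1) fun x hx => hx.1
  unfold cellSum
  rw [← Summable.tsum_finsetSum fun _ _ => ENNReal.summable, cellConst, mul_assoc,
    mul_left_comm, ← ENNReal.tsum_mul_right]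
  refine ENNReal.tsum_le_tsum fun j => ?_
  rw [← mul_sum, sum_comm]
  have h1 : ∀ e ∈ Fintype.piFinset fun _ : Fin d => range r, ∑ a, (2 ^ d : ℝ≥0∞) ^ k *
      ∫⁻ x in {x | x ∈ cell (c a) k ∧ x + (r : ℝ) • euclStep (j + k) e ∈ cell (c a) k},
        ‖rDiff r (euclStep (j + k) e) f x‖ₑ ^ q ≤ (2 ^ d) ^ k * (B * θ ^ (j + k)) := by
    intro e he
    rw [← mul_sum]
    gcongr
    exact key j e fun i => mem_range.1 (Fintype.mem_piFinset.1 he i)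
  refine (mul_le_mul_right (sum_le_sum h1) _).trans (le_of_eq ?_)
  rw [sum_const, Fintype.card_piFinset]
  simp only [card_range, prod_const, card_univ, Fintype.card_fin, nsmul_eq_mul, mul_pow, pow_add]
  push_cast
  ring

theorem cellSum_le {d r : ℕ} {q ρ : ℝ} {f : EuclideanSpace ℝ (Fin d) → ℝ} {B θ : ℝ≥0∞}
    (hD : ∀ (j : ℕ) (e : Fin d → ℕ), (∀ i, e i < r) →
      ∫⁻ x in shrunkCube ((r : ℝ) • euclStep j e), ‖rDiff r (euclStep j e) f x‖ₑ ^ q ≤ B * θ ^ j)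
    (c : Fin d → ℝ) (k : ℕ) (hc : CellInCube c k) :
    cellSum r q ρ f c k ≤ cellConst d r q ρ θ * (B * (2 ^ d * θ) ^ k) := by
  simpa using sum_cellSum_le (ρ := ρ) hD (fun _ : Unit => c) k (fun _ => hc)
    (fun a b hab => absurd (Subsingleton.elim a b) hab)

/-! ### The continuous representative. -/

theorem kuhnHat_nonneg {d : ℕ} (k : ℕ) (v : Fin d → Fin (2 ^ k + 1)) (x) : 0 ≤ kuhnHat k v x :=
  le_max_left _ _

theorem sum_kuhnHat {d : ℕ} (k : ℕ) {x : EuclideanSpace ℝ (Fin d)} (hx : x ∈ closedCube d) :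
    ∑ v, kuhnHat k v x = 1 := by
  obtain ⟨j, σ, hT⟩ := exists_mem_kuhnSimplex k hx
  simp only [kuhnHat_eq hT]
  rw [← map_sum, kuhnBary_sum, map_one]

theorem abs_lt_one_of_kuhnHat_ne_zero {d k : ℕ} {v : Fin d → Fin (2 ^ k + 1)}
    {x : EuclideanSpace ℝ (Fin d)} (h : kuhnHat k v x ≠ 0) (i : Fin d) :
    |2 ^ k * x i - ((v i : ℕ) : ℝ)| < 1 := by
  set w : Option (Fin d) → ℝ := fun o => o.elim 0 fun i => 2 ^ k * x i - ((v i : ℕ) : ℝ) with hw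
  by_contra! hle
  refine h (max_eq_left ?_)
  have h1 := inf'_le w (mem_univ none)
  have h2 := inf'_le w (mem_univ (some i))
  have h3 := le_sup' w (mem_univ none)
  have h4 := le_sup' w (mem_univ (some i))
  have h5 : w none = 0 := rfl
  have h6 : w (some i) = 2 ^ k * x i - ((v i : ℕ) : ℝ) := rfl
  rw [h5] at h1 h3
  rw [h6] at h2 h4
  rcases le_abs.1 hle with h7 | h7 <;> linarith

/-- A continuous function exceeding `b` at a point of `V` does so on a nonempty open set, which has
positive measure; the closure is reached by limits. -/
theorem le_of_ae_le {d : ℕ} {u : EuclideanSpace ℝ (Fin d) → ℝ} {V A : Set (EuclideanSpace ℝ (Fin d))}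
    {b : ℝ} (hV : IsOpen V) (hVA : V ⊆ A) (hAV : A ⊆ closure V) (hu : ContinuousOn u A)
    (h : ∀ᵐ x, x ∈ V → u x ≤ b) : ∀ x ∈ A, u x ≤ b := by
  have h1 : ∀ x ∈ V, u x ≤ b := by
    by_contra! hcon
    obtain ⟨x, hx, hbx⟩ := hcon
    have hopen : IsOpen (V ∩ u ⁻¹' Set.Ioi b) :=
      (hu.mono hVA).isOpen_inter_preimage hV isOpen_Ioi
    refine (hopen.measure_pos volume ⟨x, hx, hbx⟩).ne' ?_
    refine measure_mono_null (fun y hy => ?_) (ae_iff.1 h)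
    exact fun hy' => absurd (hy' hy.1) (not_le.2 hy.2)
  intro x hx
  have := mem_closure_iff_nhdsWithin_neBot.1 (hAV hx)
  refine le_of_tendsto ((hu x hx).mono hVA) ?_
  filter_upwards [self_mem_nhdsWithin] with y hy using h1 y hy

/-- The open cell. -/
def openCell {d : ℕ} (c : Fin d → ℝ) (k : ℕ) : Set (EuclideanSpace ℝ (Fin d)) :=
  {x | ∀ i, 0 < 2 ^ k * (x i - c i) ∧ 2 ^ k * (x i - c i) < 1}

/-- The closed cell. -/
def closedCell {d : ℕ} (c : Fin d → ℝ) (k : ℕ) : Set (EuclideanSpace ℝ (Fin d)) :=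
  {x | ∀ i, 0 ≤ 2 ^ k * (x i - c i) ∧ 2 ^ k * (x i - c i) ≤ 1}

theorem isOpen_openCell {d : ℕ} (c : Fin d → ℝ) (k : ℕ) : IsOpen (openCell c k) := by
  have : openCell c k = ⋂ i, {x | 0 < 2 ^ k * (x i - c i) ∧ 2 ^ k * (x i - c i) < 1} := by
    ext; simp [openCell]
  rw [this]
  refine isOpen_iInter_of_finite fun i => ?_
  have h : Continuous fun x : EuclideanSpace ℝ (Fin d) => 2 ^ k * (x i - c i) := by fun_prop
  exact (isOpen_lt continuous_const h).inter (isOpen_lt h continuous_const)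

theorem openCell_subset_cell {d : ℕ} (c : Fin d → ℝ) (k : ℕ) : openCell c k ⊆ cell c k :=
  fun _ hx i => ⟨(hx i).1.le, (hx i).2⟩

theorem openCell_subset_closedCell {d : ℕ} (c : Fin d → ℝ) (k : ℕ) :
    openCell c k ⊆ closedCell c k := fun _ hx i => ⟨(hx i).1.le, (hx i).2.le⟩

theorem closedCell_subset_closure {d : ℕ} (c : Fin d → ℝ) (k : ℕ) :
    closedCell c k ⊆ closure (openCell c k) := by
  intro x hx
  have h2 : (0 : ℝ) < 2 ^ k := by positivity
  set m : EuclideanSpace ℝ (Fin d) := WithLp.toLp 2 fun i => c i + (2 ^ k)⁻¹ / 2 with hm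
  have hc : Filter.Tendsto (fun t : ℝ => (1 - t) • x + t • m) (nhdsWithin 0 (Set.Ioo 0 1))
      (nhds x) := by
    have : Continuous fun t : ℝ => (1 - t) • x + t • m := by fun_prop
    have := (this.tendsto 0).mono_left (nhdsWithin_le_nhds (s := Set.Ioo 0 1))
    simpa using this
  have : (nhdsWithin (0 : ℝ) (Set.Ioo 0 1)).NeBot := left_nhdsWithin_Ioo_neBot (by norm_num)
  refine mem_closure_of_tendsto hc ?_
  filter_upwards [self_mem_nhdsWithin] with t ht i
  obtain ⟨h3, h4⟩ := hx i
  have h5 : 2 ^ k * (((1 - t) • x + t • m) i - c i) = (1 - t) * (2 ^ k * (x i - c i)) + t / 2 := by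
    simp [hm]
    field_simp
    ring
  rw [h5]
  constructor <;> nlinarith [ht.1, ht.2]

theorem openCube_eq_openCell (d : ℕ) : openCube d = openCell 0 0 := by
  ext; simp [openCube, openCell]

theorem closedCube_eq_closedCell (d : ℕ) : closedCube d = closedCell 0 0 := by
  ext; simp [closedCube, closedCell]

theorem continuous_eval_ofLp {d : ℕ} (P : MvPolynomial (Fin d) ℝ) :
    Continuous fun x : EuclideanSpace ℝ (Fin d) => MvPolynomial.eval x.ofLp P :=
  (MvPolynomial.continuous_eval P).comp (PiLp.continuous_ofLp 2 _)

/-- A function with good local approximation at all scales is uniformly near a continuous one. -/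
theorem exists_continuous_near {d k : ℕ} {f : EuclideanSpace ℝ (Fin d) → ℝ} {δ : ℝ}
    (h : ∀ c, CellInCube c k → ∃ P : MvPolynomial (Fin d) ℝ,
      ∀ᵐ x, x ∈ cell c k → |f x - MvPolynomial.eval x.ofLp P| ≤ δ) :
    ∃ g : EuclideanSpace ℝ (Fin d) → ℝ, Continuous g ∧
      ∀ᵐ x, x ∈ openCube d → |f x - g x| ≤ δ := by
  -- Inside the unit cube the support of the nodal function of level `k + 1` at `v` has width at
  -- most `2 · 2^{-(k+1)} = 2^{-k}`, so one cell of side `2^{-k}` covers it. Its corner is `(v - 1)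
  -- 2^{-(k+1)}`, pushed into the cube at both ends; truncated subtraction handles `v i = 0`. Such
  -- cells need not be dyadic.
  set a : (Fin d → Fin (2 ^ (k + 1) + 1)) → Fin d → ℕ := fun v i =>
    min ((v i : ℕ) - 1) (2 ^ (k + 1) - 2) with ha
  set c : (Fin d → Fin (2 ^ (k + 1) + 1)) → Fin d → ℝ := fun v i => (a v i : ℝ) / 2 ^ (k + 1) with hc
  have h2 : (0 : ℝ) < 2 ^ k := by positivity
  have h2n : 1 ≤ 2 ^ k := Nat.one_le_two_pow
  have hpow : 2 ^ (k + 1) = 2 * 2 ^ k := by ring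
  have hcc : ∀ v, CellInCube (c v) k := by
    intro v i
    refine ⟨by positivity, ?_⟩
    have h3 : (a v i : ℝ) + 2 ≤ 2 * 2 ^ k := by
      have : a v i + 2 ≤ 2 * 2 ^ k := by simp only [ha]; omega
      exact_mod_cast this
    simp only [hc, pow_succ]
    rw [← mul_le_mul_iff_left₀ (show (0 : ℝ) < 2 * 2 ^ k by positivity)]
    field_simp
    linarith
  choose P hP using fun v => h (c v) (hcc v)
  refine ⟨fun x => ∑ v, kuhnHat (k + 1) v x * MvPolynomial.eval x.ofLp (P v),
    continuous_finsetSum _ fun v _ => (kuhnHat_continuous v).mul (continuous_eval_ofLp _), ?_⟩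
  filter_upwards [ae_all_iff.2 hP] with x hx hxQ
  have hsum := sum_kuhnHat (k + 1) (x := x) fun i => ⟨(hxQ i).1.le, (hxQ i).2.le⟩
  have h3 : f x - ∑ v, kuhnHat (k + 1) v x * MvPolynomial.eval x.ofLp (P v) =
      ∑ v, kuhnHat (k + 1) v x * (f x - MvPolynomial.eval x.ofLp (P v)) := by
    simp only [mul_sub, sum_sub_distrib, ← sum_mul, hsum, one_mul]
  rw [h3]
  have h4 : ∀ v ∈ (univ : Finset (Fin d → Fin (2 ^ (k + 1) + 1))),
      |kuhnHat (k + 1) v x * (f x - MvPolynomial.eval x.ofLp (P v))| ≤ kuhnHat (k + 1) v x * δ := by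
    intro v _
    rw [abs_mul, abs_of_nonneg (kuhnHat_nonneg _ _ _)]
    by_cases hv : kuhnHat (k + 1) v x = 0
    · simp [hv]
    refine mul_le_mul_of_nonneg_left (hx v fun i => ?_) (kuhnHat_nonneg _ _ _)
    have h5 := abs_lt.1 (abs_lt_one_of_kuhnHat_ne_zero hv i)
    have h6 := hxQ i
    have h7 : 2 ^ k * (x i - c v i) = (2 ^ (k + 1) * x i - a v i) / 2 := by
      simp only [hc, pow_succ]; field_simp
    rw [h7]
    have h8 : 0 < 2 ^ (k + 1) * x i ∧ 2 ^ (k + 1) * x i < 2 ^ (k + 1) := by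
      have : (0 : ℝ) < 2 ^ (k + 1) := by positivity
      constructor <;> nlinarith
    have h9 : (a v i : ℝ) ≤ 2 ^ (k + 1) * x i := by
      rcases Nat.eq_zero_or_pos (v i : ℕ) with h0 | h0
      · have : a v i = 0 := by simp [ha, h0]
        rw [this]; simpa using h8.1.le
      · have : a v i + 1 ≤ (v i : ℕ) := by simp only [ha]; omega
        have : (a v i : ℝ) + 1 ≤ ((v i : ℕ) : ℝ) := by exact_mod_cast this
        linarith
    have h10 : 2 ^ (k + 1) * x i < a v i + 2 := by
      rcases min_choice ((v i : ℕ) - 1) (2 ^ (k + 1) - 2) with h0 | h0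
      · have : (v i : ℕ) ≤ a v i + 1 := by simp only [ha]; omega
        have : ((v i : ℕ) : ℝ) ≤ (a v i : ℝ) + 1 := by exact_mod_cast this
        linarith
      · have : 2 ^ (k + 1) ≤ a v i + 2 := by simp only [ha]; omega
        have : (2 : ℝ) ^ (k + 1) ≤ (a v i : ℝ) + 2 := by exact_mod_cast this
        linarith
    constructor <;> linarith
  refine (abs_sum_le_sum_abs _ _).trans ((sum_le_sum h4).trans ?_)
  rw [← sum_mul, hsum, one_mul]

/-- The continuous approximants differ by at most `δ k + δ l` almost everywhere, hence everywhere on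
the closed cube. They converge uniformly there, and the limit agrees with `f` almost everywhere. -/
theorem exists_isContRep {d : ℕ} {f : EuclideanSpace ℝ (Fin d) → ℝ} {δ : ℕ → ℝ}
    (hδ : Filter.Tendsto δ Filter.atTop (nhds 0)) (hanti : Antitone δ)
    (h : ∀ k c, CellInCube c k → ∃ P : MvPolynomial (Fin d) ℝ,
      ∀ᵐ x, x ∈ cell c k → |f x - MvPolynomial.eval x.ofLp P| ≤ δ k) :
    ∃ g, IsContRep f g := by
  choose g hg hfg using fun k => exists_continuous_near (h k)
  have hgg : ∀ k l, ∀ x ∈ closedCube d, |g k x - g l x| ≤ δ k + δ l := by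
    intro k l
    rw [closedCube_eq_closedCell]
    refine le_of_ae_le (isOpen_openCell 0 0) (openCell_subset_closedCell 0 0)
      (closedCell_subset_closure 0 0) ((hg k).sub (hg l)).abs.continuousOn ?_
    filter_upwards [hfg k, hfg l] with x h1 h2 hx
    rw [← openCube_eq_openCell] at hx
    have h1 := abs_le.1 (h1 hx)
    have h2 := abs_le.1 (h2 hx)
    rw [abs_le]
    constructor <;> linarith
  have hlim : ∀ x ∈ closedCube d, ∃ y, Filter.Tendsto (fun k => g k x) Filter.atTop (nhds y) := by
    intro x hx
    refine cauchySeq_tendsto_of_complete (cauchySeq_of_le_tendsto_0 (fun n => 2 * δ n) ?_ ?_)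
    · intro n m N hn hm
      rw [Real.dist_eq]
      have := hgg n m x hx
      linarith [hanti hn, hanti hm]
    · simpa using hδ.const_mul 2
  choose! G hG using hlim
  refine ⟨G, ?_, ?_⟩
  · have hunif : TendstoUniformlyOn g G Filter.atTop (closedCube d) := by
      rw [Metric.tendstoUniformlyOn_iff]
      intro ε hε
      filter_upwards [(hδ.eventually_lt_const hε)] with k hk x hx
      refine lt_of_le_of_lt ?_ hk
      rw [dist_comm, Real.dist_eq]
      have h1 : Filter.Tendsto (fun l => |g k x - g l x|) Filter.atTop (nhds |g k x - G x|) :=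
        ((hG x hx).const_sub (g k x)).abs
      have h2 : Filter.Tendsto (fun l => δ k + δ l) Filter.atTop (nhds (δ k)) := by
        simpa using hδ.const_add (δ k)
      exact le_of_tendsto_of_tendsto' h1 h2 fun l => hgg k l x hx
    exact hunif.continuousOn (Filter.Eventually.of_forall fun k => (hg k).continuousOn).frequently
  · refine (ae_restrict_iff' (isOpen_openCube d).measurableSet).2 ?_
    filter_upwards [ae_all_iff.2 hfg] with x hx hxQ
    refine tendsto_nhds_unique ?_ (hG x fun i => ⟨(hxQ i).1.le, (hxQ i).2.le⟩)
    rw [tendsto_iff_dist_tendsto_zero]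
    refine squeeze_zero (fun _ => dist_nonneg) (fun k => ?_) hδ
    rw [dist_comm, Real.dist_eq]
    exact hx k hxQ

/-! ### Local and global interpolation error. -/

theorem finite_tensorGrid (d k r : ℕ) : (tensorGrid d k r).Finite := by
  refine ((Set.Finite.pi fun _ : Fin d => Set.finite_Iic ((r - 1) * 2 ^ k)).image
    fun m : Fin d → ℕ => WithLp.toLp 2 fun i => (m i : ℝ) / (((r - 1 : ℕ) : ℝ) * 2 ^ k)).subset ?_
  rintro x ⟨m, hm⟩
  refine ⟨m, fun i _ => (hm i).1, ?_⟩
  ext i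
  exact (hm i).2.symm

/-- The Lebesgue constants of the interpolation on Kuhn simplices are bounded. -/
theorem exists_lebesgue_constant (d : ℕ) {r : ℕ} (hr : 2 ≤ r) :
    ∃ Λ : ℝ, 0 ≤ Λ ∧ ∀ (k : ℕ) (j : Fin d → Fin (2 ^ k)) (σ : Equiv.Perm (Fin d))
      (P : MvPolynomial (Fin d) ℝ), P.totalDegree < r → ∀ G : ℝ, 0 ≤ G →
      (∀ x ∈ tensorGrid d k r ∩ kuhnSimplex j σ, |MvPolynomial.eval x.ofLp P| ≤ G) →
      ∀ x ∈ kuhnSimplex j σ, |MvPolynomial.eval x.ofLp P| ≤ Λ * G := by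
  have hσ : ∀ σ : Equiv.Perm (Fin d), _ := fun σ =>
    exists_bound_of_unisolvent (d := d) (r := r) (by omega)
      (WithLp.ofLp '' (tensorGrid d 0 r ∩ kuhnSimplex (k := 0) (fun _ => 0) σ))
      (((finite_tensorGrid d 0 r).inter_of_left _).image _)
      (fun P hP h => kuhn_unisolvent hr (k := 0) (fun _ => 0) σ P 0 hP (by simp; omega)
        fun x hx => by simpa using h _ ⟨x, hx, rfl⟩) 1
  choose Λ hΛ0 hΛ using hσ
  -- Up to translation and dilation only the finitely many simplices of the unit cube occur, one for
  -- each permutation; the sum serves as a common bound.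
  refine ⟨∑ σ, Λ σ, sum_nonneg fun σ _ => hΛ0 σ, fun k j σ P hP G hG h x hx => ?_⟩
  have h2 : (0 : ℝ) < 2 ^ k := by positivity
  have hr1 : (0 : ℝ) < ((r - 1 : ℕ) : ℝ) := by exact_mod_cast (by omega : 0 < r - 1)
  obtain ⟨P', hP', hPP'⟩ := exists_affine_substitution P hP ((2 ^ k)⁻¹)
    (fun i => ((2 : ℝ) ^ k)⁻¹ * ((j i : ℕ) : ℝ))
  have hnodes : ∀ z ∈ (WithLp.ofLp '' (tensorGrid d 0 r ∩ kuhnSimplex (k := 0) (fun _ => 0) σ)),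
      |MvPolynomial.eval z P'| ≤ G := by
    rintro _ ⟨y, ⟨⟨m, hm⟩, hy⟩, rfl⟩
    rw [hPP']
    refine h (WithLp.toLp 2 (((2 : ℝ) ^ k)⁻¹ • y.ofLp + fun i => ((2 : ℝ) ^ k)⁻¹ * ((j i : ℕ) : ℝ)))
      ⟨⟨fun i => m i + (r - 1) * (j i : ℕ), fun i => ⟨?_, ?_⟩⟩, ?_⟩
    · have h3 := (hm i).1
      have h4 : (j i : ℕ) + 1 ≤ 2 ^ k := (j i).2
      calc m i + (r - 1) * (j i : ℕ) ≤ (r - 1) * ((j i : ℕ) + 1) := by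
            rw [mul_add, mul_one, add_comm]; simpa using h3
        _ ≤ _ := Nat.mul_le_mul_left _ h4
    · simp only [Pi.add_apply, Pi.smul_apply, smul_eq_mul, (hm i).2]
      push_cast
      field_simp
    · have h5 : ∀ i, 2 ^ k * ((((2 : ℝ) ^ k)⁻¹ • y.ofLp + fun i =>
          ((2 : ℝ) ^ k)⁻¹ * ((j i : ℕ) : ℝ)) i) - ((j i : ℕ) : ℝ) = y i := by
        intro i
        simp only [Pi.add_apply, Pi.smul_apply, smul_eq_mul]
        field_simp
        ring
      refine ⟨fun i => ?_, ?_⟩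
      · rw [h5]; simpa using hy.1 i
      · simp only [h5]; simpa using hy.2
  have hxy := hΛ σ P' hP' G hG hnodes (fun i => 2 ^ k * x i - ((j i : ℕ) : ℝ)) fun i =>
    abs_le.2 ⟨by linarith [(hx.1 i).1], (hx.1 i).2⟩
  have h6 : MvPolynomial.eval (fun i => 2 ^ k * x i - ((j i : ℕ) : ℝ)) P' =
      MvPolynomial.eval x.ofLp P := by
    rw [hPP']
    congr 2
    funext i
    simp only [Pi.add_apply, Pi.smul_apply, smul_eq_mul]
    field_simp
    ring
  rw [h6] at hxy
  exact hxy.trans (mul_le_mul_of_nonneg_right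
    (single_le_sum (f := Λ) (fun σ _ => hΛ0 σ) (mem_univ σ)) hG)

/-- The corner of a dyadic cube. -/
def dyadicCorner {d k : ℕ} (j : Fin d → Fin (2 ^ k)) : Fin d → ℝ := fun i => ((j i : ℕ) : ℝ) / 2 ^ k

theorem mul_sub_dyadicCorner {d k : ℕ} (j : Fin d → Fin (2 ^ k)) (t : ℝ) (i : Fin d) :
    2 ^ k * (t - dyadicCorner j i) = 2 ^ k * t - ((j i : ℕ) : ℝ) := by
  simp only [dyadicCorner]
  field_simp

theorem cellInCube_dyadicCorner {d k : ℕ} (j : Fin d → Fin (2 ^ k)) :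
    CellInCube (dyadicCorner j) k := by
  intro i
  have h : ((j i : ℕ) : ℝ) + 1 ≤ 2 ^ k := by exact_mod_cast (j i).2
  have h2 : (0 : ℝ) < 2 ^ k := by positivity
  refine ⟨by simp only [dyadicCorner]; positivity, ?_⟩
  simp only [dyadicCorner]
  rw [inv_eq_one_div, ← add_div, div_le_one h2]
  exact h

theorem pairwise_disjoint_dyadic (d k : ℕ) : Pairwise fun a b : Fin d → Fin (2 ^ k) =>
    Disjoint (cell (dyadicCorner a) k) (cell (dyadicCorner b) k) := by
  intro a b hab
  rw [Set.disjoint_left]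
  intro x ha hb
  apply hab
  funext i
  have h1 := ha i
  have h2 := hb i
  rw [mul_sub_dyadicCorner] at h1 h2
  have h3 : ((a i : ℕ) : ℝ) < ((b i : ℕ) : ℝ) + 1 := by linarith
  have h4 : ((b i : ℕ) : ℝ) < ((a i : ℕ) : ℝ) + 1 := by linarith
  have h3 : (a i : ℕ) < (b i : ℕ) + 1 := by exact_mod_cast h3
  have h4 : (b i : ℕ) < (a i : ℕ) + 1 := by exact_mod_cast h4
  exact Fin.ext (by omega)

theorem kuhnSimplex_subset_closedCell {d k : ℕ} (j : Fin d → Fin (2 ^ k)) (σ : Equiv.Perm (Fin d)) :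
    kuhnSimplex j σ ⊆ closedCell (dyadicCorner j) k := by
  intro x hx i
  rw [mul_sub_dyadicCorner]
  exact hx.1 i

theorem closedCell_subset_closedCube {d k : ℕ} {c : Fin d → ℝ} (hc : CellInCube c k) :
    closedCell c k ⊆ closedCube d := by
  intro x hx i
  have h1 := hc i
  have h2 := hx i
  have h3 : (0 : ℝ) < 2 ^ k := by positivity
  have h4 : 0 ≤ x i - c i := nonneg_of_mul_nonneg_right h2.1 h3
  have h5 : x i - c i ≤ (2 ^ k)⁻¹ := by
    rw [← one_div, le_div_iff₀' h3]
    exact h2.2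
  constructor <;> linarith

theorem volume_closedCell {d : ℕ} (c : Fin d → ℝ) (k : ℕ) :
    (2 ^ d) ^ k * volume (closedCell c k) = 1 ∧ MeasurableSet (closedCell c k) := by
  have hm : MeasurableSet (closedCell c k) := by
    have : closedCell c k = ⋂ i, {x | 0 ≤ 2 ^ k * (x i - c i) ∧ 2 ^ k * (x i - c i) ≤ 1} := by
      ext; simp [closedCell]
    rw [this]
    refine MeasurableSet.iInter fun i => ?_
    have h : Measurable fun x : EuclideanSpace ℝ (Fin d) => 2 ^ k * (x i - c i) := by fun_prop
    exact (measurableSet_le measurable_const h).inter (measurableSet_le h measurable_const)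
  refine ⟨?_, hm⟩
  have h2 : (2 : ℝ) ^ k ≠ 0 := by positivity
  rw [← lintegral_indicator_one hm, ← lintegral_cellMap c k (measurable_one.indicator hm)]
  have h1 : ∀ y, (closedCell c k).indicator (1 : EuclideanSpace ℝ (Fin d) → ℝ≥0∞) (cellMap c k y) =
      (Set.Icc (0 : Fin d → ℝ) 1).indicator 1 y := by
    intro y
    classical
    rw [Set.indicator_apply, Set.indicator_apply]
    refine if_congr ?_ rfl rfl
    simp [cellMap, closedCell, h2, Pi.le_def, forall_and]
  rw [lintegral_congr h1, lintegral_indicator_one measurableSet_Icc, Real.volume_Icc_pi]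
  simp

/-- Local error of the interpolation. -/
theorem abs_sub_interpolant_le {d r k : ℕ} (hr : 2 ≤ r) {Λ : ℝ}
    {g : EuclideanSpace ℝ (Fin d) → ℝ} (hg : ContinuousOn g (closedCube d))
    {j : Fin d → Fin (2 ^ k)} {σ : Equiv.Perm (Fin d)}
    (hΛ : ∀ P : MvPolynomial (Fin d) ℝ, P.totalDegree < r → ∀ G : ℝ, 0 ≤ G →
      (∀ x ∈ tensorGrid d k r ∩ kuhnSimplex j σ, |MvPolynomial.eval x.ofLp P| ≤ G) →
      ∀ x ∈ kuhnSimplex j σ, |MvPolynomial.eval x.ofLp P| ≤ Λ * G)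
    {P : MvPolynomial (Fin d) ℝ} (hP : P.totalDegree < r) {δ : ℝ} (hδ : 0 ≤ δ)
    (h : ∀ᵐ x, x ∈ cell (dyadicCorner j) k → |g x - MvPolynomial.eval x.ofLp P| ≤ δ) :
    ∀ x ∈ kuhnSimplex j σ, |g x - interpolant k r g x| ≤ (1 + Λ) * δ := by
  have h1 : ∀ x ∈ closedCell (dyadicCorner j) k, |g x - MvPolynomial.eval x.ofLp P| ≤ δ := by
    refine le_of_ae_le (isOpen_openCell _ _) (openCell_subset_closedCell _ _)
      (closedCell_subset_closure _ _) ?_ ?_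
    · exact ((hg.mono (closedCell_subset_closedCube (cellInCube_dyadicCorner j))).sub
        (continuous_eval_ofLp P).continuousOn).abs
    · filter_upwards [h] with x hx hxc using hx (openCell_subset_cell _ _ hxc)
  obtain ⟨Q, hQ, hQS, hQg⟩ := (interpolant_spec k r hr g).2 j σ
  -- At the nodes `Q` equals `g`, so `P - Q` is bounded by `δ` there, and by `Λ δ` on the simplex.
  have h2 := hΛ (P - Q) ((MvPolynomial.totalDegree_sub _ _).trans_lt (max_lt hP hQ)) δ hδ
    fun x hx => by
      rw [map_sub, hQg x hx, abs_sub_comm]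
      exact h1 x (kuhnSimplex_subset_closedCell j σ hx.2)
  intro x hx
  have h3 := abs_le.1 (h2 x hx)
  have h4 := abs_le.1 (h1 x (kuhnSimplex_subset_closedCell j σ hx))
  rw [map_sub] at h3
  rw [hQS x hx, abs_le]
  constructor <;> linarith

/-- Existence of the continuous representative, and the local interpolation error in terms of the
differences of `f`. -/
theorem exists_local_error_bound (d : ℕ) {r : ℕ} (hr : 2 ≤ r) {q ρ : ℝ} (hq : 0 < q)
    (hρ0 : 0 < ρ) (hρ1 : ρ < 1) :
    ∃ κ : ℝ≥0, ∀ f : EuclideanSpace ℝ (Fin d) → ℝ, Measurable f → ∀ b : ℕ → ℝ≥0∞,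
      (∀ k, b k ≠ ∞) → Antitone b → Filter.Tendsto b Filter.atTop (nhds 0) →
      (∀ c k, CellInCube c k → cellSum r q ρ f c k ≤ b k) →
      (∃ g, IsContRep f g) ∧ ∀ g, IsContRep f g → ∀ k (j : Fin d → Fin (2 ^ k)) σ,
        ∀ x ∈ kuhnSimplex j σ, ‖g x - interpolant k r g x‖ₑ ≤
          κ * cellSum r q ρ f (dyadicCorner j) k ^ (1 / q) := by
  obtain ⟨C, hC, hcell⟩ := exists_polynomial_near_on_cell (d := d) hr hq hρ0 hρ1
  obtain ⟨Λ, hΛ0, hΛ⟩ := exists_lebesgue_constant d hr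
  refine ⟨((1 + Λ) * C).toNNReal, fun f hf b hb hanti hlim hsum => ⟨?_, fun g hg k j σ x hx => ?_⟩⟩
  · have h1q : 0 < 1 / q := by positivity
    refine exists_isContRep (δ := fun k => C * (b k).toReal ^ (1 / q)) ?_ ?_ fun k c hc => ?_
    · have h1 := (ENNReal.tendsto_toReal ENNReal.zero_ne_top).comp hlim
      have h2 := (h1.rpow_const (p := 1 / q) (Or.inr h1q.le)).const_mul C
      rw [ENNReal.toReal_zero, Real.zero_rpow h1q.ne', mul_zero] at h2
      exact h2
    · intro k l hkl
      have := ENNReal.toReal_mono (hb k) (hanti hkl)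
      dsimp only
      gcongr
    · obtain ⟨P, -, hP⟩ := hcell f hf c k (ne_top_of_le_ne_top (hb k) (hsum c k hc))
      refine ⟨P, ?_⟩
      filter_upwards [hP] with x hx hxc
      refine (hx hxc).trans ?_
      have := ENNReal.toReal_mono (hb k) (hsum c k hc)
      gcongr
  · have hfin := ne_top_of_le_ne_top (hb k) (hsum _ k (cellInCube_dyadicCorner j))
    obtain ⟨P, hP, hPf⟩ := hcell f hf (dyadicCorner j) k hfin
    have hfg := (ae_restrict_iff' (isOpen_openCube d).measurableSet).1 hg.2
    have h1 := abs_sub_interpolant_le hr hg.1 (hΛ k j σ) hP (δ :=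
      C * (cellSum r q ρ f (dyadicCorner j) k).toReal ^ (1 / q)) (by positivity) (by
        filter_upwards [hPf, hfg, ae_apply_ne_zero d] with x hx hx' hx0 hxc
        rw [← hx' fun i => ?_]
        · exact hx hxc
        · have := lt_one_of_mem_cell (cellInCube_dyadicCorner j) hxc i
          exact ⟨lt_of_le_of_ne this.1 (hx0 i).symm, this.2⟩) x hx
    rw [← ofReal_norm, Real.norm_eq_abs]
    refine (ENNReal.ofReal_le_ofReal h1).trans (le_of_eq ?_)
    rw [← mul_assoc, ENNReal.ofReal_mul (by positivity), ← ENNReal.ofReal_rpow_of_nonneg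
      ENNReal.toReal_nonneg (by positivity), ENNReal.ofReal_toReal hfin]
    rfl

/-- The `L_t` error of the interpolation from the local errors, `t ≥ q`. -/
theorem lintegral_sub_interpolant_le {d r k : ℕ} {q ρ : ℝ} (hq : 0 < q)
    {f u : EuclideanSpace ℝ (Fin d) → ℝ} {κ : ℝ≥0} {b : ℝ≥0∞}
    (hu : ∀ (j : Fin d → Fin (2 ^ k)) σ, ∀ x ∈ kuhnSimplex j σ, ‖u x‖ₑ ≤
      κ * cellSum r q ρ f (dyadicCorner j) k ^ (1 / q))
    (hb : ∑ j : Fin d → Fin (2 ^ k), cellSum r q ρ f (dyadicCorner j) k ≤ b) {t : ℝ} (ht : q ≤ t) :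
    ∫⁻ x, ‖u x‖ₑ ^ t ∂cubeMeasure d ≤ (κ * b ^ (1 / q)) ^ t * ((2 ^ d) ^ k)⁻¹ := by
  set N : (Fin d → Fin (2 ^ k)) → ℝ≥0∞ := fun j => cellSum r q ρ f (dyadicCorner j) k with hN
  have hNb : ∀ j, N j ≤ b := fun j =>
    (single_le_sum (f := N) (fun _ _ => zero_le) (mem_univ j)).trans hb
  have hpt : ∀ x ∈ openCube d, ‖u x‖ₑ ^ t ≤ ∑ j, (closedCell (dyadicCorner j) k).indicator
      (fun _ => (κ * b ^ (1 / q)) ^ (t - q) * (κ ^ q * N j)) x := by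
    intro x hx
    obtain ⟨j, σ, hT⟩ := exists_mem_kuhnSimplex k (x := x) fun i => ⟨(hx i).1.le, (hx i).2.le⟩
    refine le_trans ?_ (single_le_sum (f := fun j => (closedCell (dyadicCorner j) k).indicator
      (fun _ => (κ * b ^ (1 / q)) ^ (t - q) * (κ ^ q * N j)) x) (fun _ _ => zero_le) (mem_univ j))
    rw [Set.indicator_of_mem (kuhnSimplex_subset_closedCell j σ hT)]
    have h1 := hu j σ x hT
    -- The first factor is estimated by the largest local error, the second by the local error of
    -- the cube containing `x`, so that the sum over cubes is used only to the power `q`.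
    have h2 : ‖u x‖ₑ ^ t = ‖u x‖ₑ ^ (t - q) * ‖u x‖ₑ ^ q := by
      rw [← ENNReal.rpow_add_of_nonneg _ _ (by linarith) hq.le, sub_add_cancel]
    rw [h2]
    refine mul_le_mul' (ENNReal.rpow_le_rpow (h1.trans ?_) (by linarith)) ?_
    · gcongr
      exact hNb j
    · refine (ENNReal.rpow_le_rpow h1 hq.le).trans (le_of_eq ?_)
      rw [ENNReal.mul_rpow_of_nonneg _ _ hq.le, ← ENNReal.rpow_mul, one_div_mul_cancel hq.ne',
        ENNReal.rpow_one]
  have hK0 : ((2 : ℝ≥0∞) ^ d) ^ k ≠ 0 := by positivity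
  have hKt : ((2 : ℝ≥0∞) ^ d) ^ k ≠ ∞ := by finiteness
  have h3 : ∀ j, volume (closedCell (dyadicCorner (k := k) j) k) = (((2 : ℝ≥0∞) ^ d) ^ k)⁻¹ :=
    fun j : Fin d → Fin (2 ^ k) =>
      ENNReal.eq_inv_of_mul_eq_one_left (by rw [mul_comm]; exact (volume_closedCell _ k).1)
  calc ∫⁻ x, ‖u x‖ₑ ^ t ∂cubeMeasure d
      ≤ ∫⁻ x, ∑ j, (closedCell (dyadicCorner j) k).indicator
          (fun _ => (κ * b ^ (1 / q)) ^ (t - q) * (κ ^ q * N j)) x :=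
        (setLIntegral_mono' (isOpen_openCube d).measurableSet hpt).trans
          (setLIntegral_le_lintegral _ _)
    _ = ∑ j, (κ * b ^ (1 / q)) ^ (t - q) * (κ ^ q * N j) * (((2 : ℝ≥0∞) ^ d) ^ k)⁻¹ := by
        rw [lintegral_finsetSum _ fun j _ =>
          measurable_const.indicator (volume_closedCell _ k).2]
        refine sum_congr rfl fun j _ => ?_
        rw [lintegral_indicator_const (volume_closedCell _ k).2, h3]
    _ = (κ * b ^ (1 / q)) ^ (t - q) * (κ ^ q * ∑ j, N j) * (((2 : ℝ≥0∞) ^ d) ^ k)⁻¹ := by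
        rw [← sum_mul, ← mul_sum, ← mul_sum]
    _ ≤ (κ * b ^ (1 / q)) ^ (t - q) * (κ ^ q * b) * (((2 : ℝ≥0∞) ^ d) ^ k)⁻¹ := by gcongr
    _ = _ := by
        congr 1
        have h4 : (κ : ℝ≥0∞) ^ q * b = (κ * b ^ (1 / q)) ^ q := by
          rw [ENNReal.mul_rpow_of_nonneg _ _ hq.le, ← ENNReal.rpow_mul, one_div_mul_cancel hq.ne',
            ENNReal.rpow_one]
        rw [h4, ← ENNReal.rpow_add_of_nonneg _ _ (by linarith) hq.le, sub_add_cancel]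

/-! ### Besov seminorm, exponents and conclusion. -/

theorem modulus_le {d : ℕ} (s : ℝ) (p : ℝ≥0∞) (f : EuclideanSpace ℝ (Fin d) → ℝ) {t : ℝ}
    (ht : 0 < t) :
    modulus (besovOrder s) p f t ≤ besovSeminorm s p f * ENNReal.ofReal (t ^ s) := by
  have h0 : ENNReal.ofReal (t ^ s) ≠ 0 := by
    rw [Ne, ENNReal.ofReal_eq_zero, not_le]
    exact Real.rpow_pos_of_pos ht s
  rw [← ENNReal.div_le_iff h0 ENNReal.ofReal_ne_top]
  refine le_sInf fun M hM => ?_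
  rw [ENNReal.div_le_iff h0 ENNReal.ofReal_ne_top]
  exact hM t ht

/-- The `L_p` norms of the dyadic differences are controlled by the Besov seminorm. -/
theorem eLpNorm_rDiff_euclStep_le {d : ℕ} (hd : 1 ≤ d) {s : ℝ} {p : ℝ≥0∞}
    (f : EuclideanSpace ℝ (Fin d) → ℝ) (j : ℕ) {e : Fin d → ℕ} (he : ∀ i, e i < besovOrder s) :
    eLpNorm (rDiff (besovOrder s) (euclStep j e) f) p
        (volume.restrict (shrunkCube ((besovOrder s : ℝ) • euclStep j e))) ≤
      besovSeminorm s p f * ENNReal.ofReal ((besovOrder s * d : ℝ) ^ s) *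
        ENNReal.ofReal ((1 / 2 : ℝ) ^ s) ^ j := by
  have hr := two_le_besovOrder s
  have hR : (0 : ℝ) < besovOrder s * d := by
    have : 0 < besovOrder s * d := by positivity
    exact_mod_cast this
  have ht : (0 : ℝ) < besovOrder s * d * (1 / 2) ^ j := by positivity
  refine le_trans ?_ ((modulus_le s p f ht).trans (le_of_eq ?_))
  -- The modulus is taken at `t = r d 2^{-j}`, which dominates the length of every step; this is the
  -- source of the constant `(r d)^s`.
  · exact le_iSup₂_of_le (euclStep j e) (norm_euclStep_le j he) le_rfl
  · rw [Real.mul_rpow hR.le (by positivity), ENNReal.ofReal_mul (by positivity), mul_assoc,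
      ← ENNReal.ofReal_pow (by positivity), ← Real.rpow_natCast, ← Real.rpow_natCast,
      ← Real.rpow_mul (by norm_num), ← Real.rpow_mul (by norm_num), mul_comm s]

theorem cellConst_ne_top {d r : ℕ} {q ρ : ℝ} {θ : ℝ≥0∞}
    (h : 2 ^ d * ENNReal.ofReal (ρ ^ (-q)) * θ < 1) : cellConst d r q ρ θ ≠ ∞ := by
  rw [cellConst, ENNReal.tsum_geometric]
  refine ENNReal.mul_ne_top (by simp) (ENNReal.inv_ne_top.2 ?_)
  exact (tsub_pos_of_lt h).ne'

/-- A bound for the sums over one cell, from bounds for the differences in the uniform norm. -/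
theorem cellSum_le_of_ae {d r : ℕ} {q ρ : ℝ} {f : EuclideanSpace ℝ (Fin d) → ℝ} {B θ : ℝ≥0∞}
    (hD : ∀ (j : ℕ) (e : Fin d → ℕ), (∀ i, e i < r) →
      ∀ᵐ x, x ∈ shrunkCube ((r : ℝ) • euclStep j e) → ‖rDiff r (euclStep j e) f x‖ₑ ^ q ≤ B * θ ^ j)
    (c : Fin d → ℝ) (k : ℕ) (hc : CellInCube c k) :
    cellSum r q ρ f c k ≤ cellConst d r q ρ θ * (B * θ ^ k) := by
  have key : ∀ (j : ℕ) (e : Fin d → ℕ), (∀ i, e i < r) → (2 ^ d) ^ k *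
      ∫⁻ x in {x | x ∈ cell c k ∧ x + (r : ℝ) • euclStep (j + k) e ∈ cell c k},
        ‖rDiff r (euclStep (j + k) e) f x‖ₑ ^ q ≤ B * θ ^ (j + k) := by
    intro j e he
    have hm := measurableSet_cell_inter c k ((r : ℝ) • euclStep (j + k) e)
    have h1 : ∫⁻ x in {x | x ∈ cell c k ∧ x + (r : ℝ) • euclStep (j + k) e ∈ cell c k},
        ‖rDiff r (euclStep (j + k) e) f x‖ₑ ^ q ≤ B * θ ^ (j + k) * volume (closedCell c k) := by
      calc _ ≤ ∫⁻ x in {x | x ∈ cell c k ∧ x + (r : ℝ) • euclStep (j + k) e ∈ cell c k},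
            B * θ ^ (j + k) := by
            refine lintegral_mono_ae ((ae_restrict_iff' hm).2 ?_)
            have h2 := ae_mem_shrunkCube hc (h := (r : ℝ) • euclStep (j + k) e) fun i => by
              simp only [euclStep, dyadicStep, PiLp.smul_apply, smul_eq_mul]
              positivity
            filter_upwards [hD (j + k) e he, h2] with x hx hx2 hxc using hx (hx2 hxc)
        _ ≤ _ := by
            rw [setLIntegral_const]
            -- The volume `2^{-dk}` of the cell cancels the rescaling factor. Hence a uniform bound
            -- gives `θ^k` in place of `(2^d θ)^k`.
            refine mul_le_mul_right (measure_mono fun x hx i => ?_) _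
            exact ⟨(hx.1 i).1, (hx.1 i).2.le⟩
    refine (mul_le_mul_right h1 _).trans (le_of_eq ?_)
    rw [mul_left_comm, (volume_closedCell c k).1, mul_one]
  unfold cellSum
  rw [cellConst, mul_assoc, mul_left_comm, ← ENNReal.tsum_mul_right]
  refine ENNReal.tsum_le_tsum fun j => ?_
  refine (mul_le_mul_right (sum_le_sum fun e he =>
    key j e fun i => mem_range.1 (Fintype.mem_piFinset.1 he i)) _).trans (le_of_eq ?_)
  rw [sum_const, Fintype.card_piFinset]
  simp only [card_range, prod_const, card_univ, Fintype.card_fin, nsmul_eq_mul, mul_pow, pow_add]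
  push_cast
  ring

theorem antitone_const_mul_pow {a x : ℝ≥0∞} (hx : x ≤ 1) : Antitone fun k : ℕ => a * x ^ k :=
  fun _ _ hkl => mul_le_mul_right (pow_le_pow_right_of_le_one' hx hkl) _

theorem tendsto_const_mul_pow {a x : ℝ≥0∞} (ha : a ≠ ∞) (hx : x < 1) :
    Filter.Tendsto (fun k : ℕ => a * x ^ k) Filter.atTop (nhds 0) := by
  have := ENNReal.Tendsto.const_mul (ENNReal.tendsto_pow_atTop_nhds_zero_of_lt_one hx)
    (Or.inr ha)
  simpa using this

theorem ofReal_two_rpow_pow (a : ℝ) (k : ℕ) :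
    ENNReal.ofReal ((2 : ℝ) ^ a) ^ k = ENNReal.ofReal ((2 : ℝ) ^ (a * k)) := by
  rw [← ENNReal.ofReal_pow (by positivity), ← Real.rpow_natCast, ← Real.rpow_mul (by norm_num)]

theorem ofReal_two_rpow_rpow (a b : ℝ) :
    ENNReal.ofReal ((2 : ℝ) ^ a) ^ b = ENNReal.ofReal ((2 : ℝ) ^ (a * b)) := by
  rw [ENNReal.ofReal_rpow_of_pos (by positivity), ← Real.rpow_mul (by norm_num)]

theorem ofReal_two_rpow_mul (a b : ℝ) :
    ENNReal.ofReal ((2 : ℝ) ^ a) * ENNReal.ofReal ((2 : ℝ) ^ b) =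
      ENNReal.ofReal ((2 : ℝ) ^ (a + b)) := by
  rw [← ENNReal.ofReal_mul (by positivity), ← Real.rpow_add (by norm_num)]

theorem two_pow_eq_ofReal (d : ℕ) : (2 : ℝ≥0∞) ^ d = ENNReal.ofReal ((2 : ℝ) ^ (d : ℝ)) := by
  rw [Real.rpow_natCast, ENNReal.ofReal_pow (by norm_num)]
  simp

theorem ofReal_two_rpow_lt_one {a : ℝ} (ha : a < 0) : ENNReal.ofReal ((2 : ℝ) ^ a) < 1 := by
  rw [ENNReal.ofReal_lt_one]
  exact Real.rpow_lt_one_of_one_lt_of_neg (by norm_num) ha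

theorem isContRep_congr {d : ℕ} {f f' g : EuclideanSpace ℝ (Fin d) → ℝ}
    (h : f =ᵐ[cubeMeasure d] f') : IsContRep f g ↔ IsContRep f' g :=
  ⟨fun hg => ⟨hg.1, h.symm.trans hg.2⟩, fun hg => ⟨hg.1, h.trans hg.2⟩⟩

/-- The geometric series of the weighted difference norms converges. -/
theorem weight_lt_one {d : ℕ} {s q : ℝ} (hq : 0 < q) (hs : (d : ℝ) < s * q) :
    2 ^ d * ENNReal.ofReal (((2 : ℝ) ^ (-(s - d / q) / 2)) ^ (-q)) *
      ENNReal.ofReal ((2 : ℝ) ^ (-(s * q))) < 1 := by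
  rw [← Real.rpow_mul (by norm_num), two_pow_eq_ofReal, ofReal_two_rpow_mul, ofReal_two_rpow_mul]
  refine ofReal_two_rpow_lt_one ?_
  have : (d : ℝ) / q * q = d := div_mul_cancel₀ _ hq.ne'
  nlinarith

theorem eLpNorm_top_sub_interpolant_le {d r k : ℕ} {q ρ : ℝ} (hq : 0 < q)
    {f u : EuclideanSpace ℝ (Fin d) → ℝ} {κ : ℝ≥0} {b : ℝ≥0∞}
    (hu : ∀ (j : Fin d → Fin (2 ^ k)) σ, ∀ x ∈ kuhnSimplex j σ, ‖u x‖ₑ ≤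
      κ * cellSum r q ρ f (dyadicCorner j) k ^ (1 / q))
    (hb : ∀ j : Fin d → Fin (2 ^ k), cellSum r q ρ f (dyadicCorner j) k ≤ b) :
    eLpNorm u ∞ (cubeMeasure d) ≤ κ * b ^ (1 / q) := by
  rw [eLpNorm_exponent_top]
  refine eLpNormEssSup_le_of_ae_enorm_bound ?_
  filter_upwards [ae_restrict_mem (isOpen_openCube d).measurableSet] with x hx
  obtain ⟨j, σ, hT⟩ := exists_mem_kuhnSimplex k (x := x) fun i => ⟨(hx i).1.le, (hx i).2.le⟩
  refine (hu j σ x hT).trans ?_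
  gcongr
  exact hb j

/-- The `t`-th root of `lintegral_sub_interpolant_le` leaves `κ b^(1/q)` free of `t` and turns the
cell volume into `2^{-kd/t}`; so the constant does not depend on `τ`. -/
theorem eLpNorm_sub_interpolant_le {d r k : ℕ} {q ρ : ℝ} (hq : 0 < q)
    {f u : EuclideanSpace ℝ (Fin d) → ℝ} {κ : ℝ≥0} {b : ℝ≥0∞}
    (hu : ∀ (j : Fin d → Fin (2 ^ k)) σ, ∀ x ∈ kuhnSimplex j σ, ‖u x‖ₑ ≤
      κ * cellSum r q ρ f (dyadicCorner j) k ^ (1 / q))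
    (hb : ∑ j : Fin d → Fin (2 ^ k), cellSum r q ρ f (dyadicCorner j) k ≤ b) {τ : ℝ≥0∞}
    (hτ : ENNReal.ofReal q ≤ τ) :
    eLpNorm u τ (cubeMeasure d) ≤ κ * b ^ (1 / q) *
      ENNReal.ofReal ((2 : ℝ) ^ (-(k : ℝ) * (d * (τ⁻¹).toReal))) := by
  by_cases hτt : τ = ∞
  · subst hτt
    simpa using eLpNorm_top_sub_interpolant_le hq hu fun j => (single_le_sum
      (f := fun j : Fin d → Fin (2 ^ k) => cellSum r q ρ f (dyadicCorner j) k)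
      (fun _ _ => zero_le) (mem_univ j)).trans hb
  · have hqt : q ≤ τ.toReal := (ENNReal.ofReal_le_iff_le_toReal hτt).1 hτ
    have ht0 : 0 < τ.toReal := hq.trans_le hqt
    have hτ0 : τ ≠ 0 := fun h => by simp [h] at ht0
    rw [eLpNorm_eq_lintegral_rpow_enorm_toReal hτ0 hτt]
    have h1 := ENNReal.rpow_le_rpow (lintegral_sub_interpolant_le hq hu hb hqt)
      (show 0 ≤ 1 / τ.toReal by positivity)
    refine h1.trans (le_of_eq ?_)
    rw [ENNReal.mul_rpow_of_nonneg _ _ (by positivity), ← ENNReal.rpow_mul,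
      mul_one_div_cancel ht0.ne', ENNReal.rpow_one]
    congr 1
    rw [two_pow_eq_ofReal, ofReal_two_rpow_pow, ← ENNReal.ofReal_inv_of_pos (by positivity),
      ← Real.rpow_neg (by norm_num), ofReal_two_rpow_rpow, ENNReal.toReal_inv]
    congr 2
    field_simp

end

theorem theorem2p1 (d : ℕ) (hd : 1 ≤ d) (s : ℝ) (p : ℝ≥0∞) (hp : 0 < p)
    (hsp : (d : ℝ) * (p⁻¹).toReal < s) :
    ∃ C : ℝ≥0, ∀ f : EuclideanSpace ℝ (Fin d) → ℝ, MemBesov s p f →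
      (∃ g, IsContRep f g) ∧
      ∀ g, IsContRep f g → ∀ τ : ℝ≥0∞, p ≤ τ → ∀ k : ℕ,
        eLpNorm (fun x => f x - interpolant k (besovOrder s) g x) τ (cubeMeasure d) ≤
          C * besovSeminorm s p f *
            ENNReal.ofReal ((2 : ℝ) ^
              (-(k : ℝ) * (s - (d : ℝ) * (p⁻¹).toReal + (d : ℝ) * (τ⁻¹).toReal))) := by
  have hs : 0 < s := lt_of_le_of_lt (by positivity) hsp
  have hr := two_le_besovOrder s
  -- For finite `p` the exponent is `p` itself and `d < s q` is the hypothesis on `s`. For `p = ∞`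
  -- an auxiliary finite exponent above `d / s` is used.
  obtain ⟨q, hq, hdq, hqp⟩ : ∃ q : ℝ, 0 < q ∧ (d : ℝ) < s * q ∧ (p ≠ ∞ → q = p.toReal) := by
    by_cases hpt : p = ∞
    · refine ⟨d / s + 1, by positivity, ?_, fun h => absurd hpt h⟩
      have : s * (d / s) = d := mul_div_cancel₀ _ hs.ne'
      nlinarith
    · have h0 : 0 < p.toReal := ENNReal.toReal_pos hp.ne' hpt
      refine ⟨p.toReal, h0, ?_, fun _ => rfl⟩
      rw [ENNReal.toReal_inv, ← div_eq_mul_inv, div_lt_iff₀ h0] at hsp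
      exact hsp
  -- Any `ρ` strictly between `2^{-(s - d/q)}` and `1` would do: below `1` for the chaining over
  -- scales, above the lower end for the convergence of the series in `cellConst`.
  set ρ : ℝ := (2 : ℝ) ^ (-(s - d / q) / 2) with hρ
  have hdqs : (d : ℝ) / q < s := (div_lt_iff₀ hq).2 hdq
  have hρ0 : 0 < ρ := by positivity
  have hρ1 : ρ < 1 := Real.rpow_lt_one_of_one_lt_of_neg (by norm_num) (by linarith)
  set θ : ℝ≥0∞ := ENNReal.ofReal ((2 : ℝ) ^ (-(s * q))) with hθ
  obtain ⟨κ, hκ⟩ := exists_local_error_bound d hr hq hρ0 hρ1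
  set C₀ := cellConst d (besovOrder s) q ρ θ with hC₀
  have hC₀t : C₀ ≠ ∞ := cellConst_ne_top (weight_lt_one hq hdq)
  set R : ℝ≥0∞ := ENNReal.ofReal ((besovOrder s * d : ℝ) ^ s) with hR
  have hRt : R ≠ ∞ := ENNReal.ofReal_ne_top
  have hCt : (κ : ℝ≥0∞) * (C₀ ^ (1 / q) * R) ≠ ∞ :=
    ENNReal.mul_ne_top ENNReal.coe_ne_top
      (ENNReal.mul_ne_top (ENNReal.rpow_ne_top_of_nonneg (by positivity) hC₀t) hRt)
  refine ⟨(κ * (C₀ ^ (1 / q) * R)).toNNReal, fun f hf => ?_⟩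
  rw [ENNReal.coe_toNNReal hCt]
  set M := besovSeminorm s p f with hM
  have hMt : M ≠ ∞ := hf.2.ne
  -- A Borel representative; on the sets `Ω_{rh}` its differences agree almost everywhere with those
  -- of `f`.
  set f' := hf.1.1.mk f
  have hff' : f =ᵐ[cubeMeasure d] f' := hf.1.1.ae_eq_mk
  have hf'm : Measurable f' := hf.1.1.stronglyMeasurable_mk.measurable
  set B : ℝ≥0∞ := (M * R) ^ q with hB
  have hBt : B ≠ ∞ := ENNReal.rpow_ne_top_of_nonneg hq.le (ENNReal.mul_ne_top hMt hRt)
  have hdiff : ∀ (j : ℕ) (e : Fin d → ℕ), (∀ i, e i < besovOrder s) →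
      eLpNorm (rDiff (besovOrder s) (euclStep j e) f') p
        (volume.restrict (shrunkCube ((besovOrder s : ℝ) • euclStep j e))) ≤
      M * R * ENNReal.ofReal ((1 / 2 : ℝ) ^ s) ^ j := fun j e he => by
    rw [← eLpNorm_congr_ae (rDiff_ae_eq hff' _)]
    exact eLpNorm_rDiff_euclStep_le hd f j he
  have hBθ : ∀ j : ℕ, (M * R * ENNReal.ofReal ((1 / 2 : ℝ) ^ s) ^ j) ^ q = B * θ ^ j := by
    intro j
    rw [ENNReal.mul_rpow_of_nonneg _ _ hq.le, one_div, Real.inv_rpow (by norm_num),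
      ← Real.rpow_neg (by norm_num), ofReal_two_rpow_pow, ofReal_two_rpow_rpow, hθ,
      ofReal_two_rpow_pow]
    congr 3
    ring
  have hroot : ∀ x : ℝ≥0∞, (C₀ * (B * x)) ^ (1 / q) = C₀ ^ (1 / q) * R * M * x ^ (1 / q) := by
    intro x
    have hq' : 0 ≤ 1 / q := by positivity
    rw [ENNReal.mul_rpow_of_nonneg _ _ hq', ENNReal.mul_rpow_of_nonneg _ _ hq', hB,
      ← ENNReal.rpow_mul, mul_one_div_cancel hq.ne', ENNReal.rpow_one]
    ring
  have hsub : ∀ g, IsContRep f g → ∀ (τ : ℝ≥0∞) k,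
      eLpNorm (fun x => f x - interpolant k (besovOrder s) g x) τ (cubeMeasure d) =
      eLpNorm (fun x => g x - interpolant k (besovOrder s) g x) τ (cubeMeasure d) := by
    intro g hg τ k
    refine eLpNorm_congr_ae ?_
    filter_upwards [hg.2] with x hx
    rw [hx]
  simp only [isContRep_congr hff'] at hsub ⊢
  by_cases hpt : p = ∞
  · have hθ1 : θ < 1 := ofReal_two_rpow_lt_one (by nlinarith)
    have hcs := cellSum_le_of_ae (ρ := ρ) (f := f') (q := q) (B := B) (θ := θ)
      (r := besovOrder s) (fun j e he => by
        have h1 := hdiff j e he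
        rw [hpt, eLpNorm_exponent_top] at h1
        have h2 := (ae_restrict_iff' (measurableSet_shrunkCube _)).1
          (enorm_ae_le_eLpNormEssSup (rDiff (besovOrder s) (euclStep j e) f')
            (volume.restrict (shrunkCube ((besovOrder s : ℝ) • euclStep j e))))
        filter_upwards [h2] with x hx hxs
        rw [← hBθ]
        exact ENNReal.rpow_le_rpow ((hx hxs).trans h1) hq.le)
    simp only [← mul_assoc] at hcs
    obtain ⟨h1, h2⟩ := hκ f' hf'm (fun k => C₀ * B * θ ^ k)
      (fun k => ENNReal.mul_ne_top (ENNReal.mul_ne_top hC₀t hBt)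
        (ENNReal.pow_ne_top ENNReal.ofReal_ne_top))
      (antitone_const_mul_pow hθ1.le) (tendsto_const_mul_pow (ENNReal.mul_ne_top hC₀t hBt) hθ1) hcs
    refine ⟨h1, fun g hg τ hτ k => ?_⟩
    rw [hsub g hg]
    -- With `p = ∞` only `τ = ∞` is left, and `θ^(k/q) = 2^{-ks}` is the asserted rate for every
    -- admissible `q`.
    obtain rfl : τ = ∞ := by rw [hpt] at hτ; exact top_le_iff.1 hτ
    refine (eLpNorm_top_sub_interpolant_le hq (h2 g hg k) fun j =>
      hcs _ k (cellInCube_dyadicCorner j)).trans (le_of_eq ?_)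
    rw [mul_assoc C₀, hroot, hθ, ofReal_two_rpow_pow, ofReal_two_rpow_rpow, hpt]
    have : -(s * q) * k * (1 / q) = -(k : ℝ) * s := by field_simp
    rw [this]
    simp only [ENNReal.inv_top, ENNReal.toReal_zero, mul_zero, sub_zero, add_zero]
    ring
  · obtain rfl := hqp hpt
    have hη : (2 : ℝ≥0∞) ^ d * θ = ENNReal.ofReal ((2 : ℝ) ^ ((d : ℝ) - s * p.toReal)) := by
      rw [two_pow_eq_ofReal, hθ, ofReal_two_rpow_mul, sub_eq_add_neg]
    have hη1 : (2 : ℝ≥0∞) ^ d * θ < 1 := by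
      rw [hη]; exact ofReal_two_rpow_lt_one (by linarith)
    have hD : ∀ (j : ℕ) (e : Fin d → ℕ), (∀ i, e i < besovOrder s) →
        ∫⁻ x in shrunkCube ((besovOrder s : ℝ) • euclStep j e),
          ‖rDiff (besovOrder s) (euclStep j e) f' x‖ₑ ^ p.toReal ≤ B * θ ^ j := by
      intro j e he
      have h1 := hdiff j e he
      rw [eLpNorm_eq_lintegral_rpow_enorm_toReal hp.ne' hpt] at h1
      have h2 := ENNReal.rpow_le_rpow h1 hq.le
      rwa [← ENNReal.rpow_mul, one_div_mul_cancel hq.ne', ENNReal.rpow_one, hBθ] at h2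
    have hcs := fun c k hc => cellSum_le (ρ := ρ) hD c k hc
    simp only [← hC₀, ← mul_assoc C₀] at hcs
    obtain ⟨h1, h2⟩ := hκ f' hf'm (fun k => C₀ * B * (2 ^ d * θ) ^ k)
      (fun k => ENNReal.mul_ne_top (ENNReal.mul_ne_top hC₀t hBt)
        (ENNReal.pow_ne_top (hη1.trans ENNReal.one_lt_top).ne))
      (antitone_const_mul_pow hη1.le) (tendsto_const_mul_pow (ENNReal.mul_ne_top hC₀t hBt) hη1) hcs
    refine ⟨h1, fun g hg τ hτ k => ?_⟩
    rw [hsub g hg]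
    refine (eLpNorm_sub_interpolant_le hq (h2 g hg k) (sum_cellSum_le (ρ := ρ) hD dyadicCorner k
      cellInCube_dyadicCorner (pairwise_disjoint_dyadic d k))
      (by rwa [ENNReal.ofReal_toReal hpt])).trans (le_of_eq ?_)
    rw [← hC₀, hroot, hη, ofReal_two_rpow_pow, ofReal_two_rpow_rpow, ENNReal.toReal_inv p]
    -- The factor `(2^d θ)^(k/p)` contributes `2^{-k(s - d/p)}`, and the cell volume contributes
    -- `2^{-kd/τ}`.
    have h3 : ((d : ℝ) - s * p.toReal) * k * (1 / p.toReal) +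
        -(k : ℝ) * (d * (τ⁻¹).toReal) =
        -(k : ℝ) * (s - d * p.toReal⁻¹ + d * (τ⁻¹).toReal) := by
      field_simp
      ring
    rw [← h3, ← ofReal_two_rpow_mul]
    ring
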